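/- **Setting.** Consider $n\ge1$ agents, a finite state space $\mathcal S$, a finite joint action space $\mathcal A=\mathcal A_1\times\dots\times\mathcal A_n$, transition probabilities $p_{s,s'}(a)$, local rewards $r^i(s,a,s')\in[0,1]$, $r^i_a(s)=\sum_{s'}p_{s,s'}(a)r^i(s,a,s')$, and team reward $r_a=\frac1n\sum_i r_a^i$. For a stationary policy $\pi(a|s)$ let $P^\pi_{s,s'}=\sum_a\pi(a|s)p_{s,s'}(a)$, let $\xi^\pi$ be its stationary distribution and $\lambda_\pi=\lim_{N\to\infty}\frac1N\mathbb E^\pi[\sum_{k<N}r(s_k,a_k)\mid s_0=s]$ its average reward; $\lambda^*=\max_\pi\lambda_\pi$. Assume that: - every policy induces an irreducible chain; - there is $\tau>1$ with $\frac1{\sqrt\tau|\mathcal S|}\le\xi^\pi(s)\le\frac{\sqrt\tau}{|\mathcal S|}$ for all $\pi,s$; - for every $\pi$ there is an integer $1\le t\le t_{mix}$ with $\|(P^\pi)^t(s,\cdot)-\xi^\pi\|_{TV}\le\frac14$ for all $s$; - at each time $t\ge0$ the agents communicate over an undirected graph with symmetric doubly stochastic weights $w^t_{ij}$, where $w_{ij}^t\ge\eta$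 if $j=i$ or $j$ is a neighbour of $i$ and $w_{ij}^t=0$ otherwise, for a constant $\eta\in(0,1)$; and for some integer $B\ge1$ the union of the graphs over any $B$ consecutive times is connected. Let $\mu^*$ be any maximizer of $\sum_{s,a}\mu(s,a)r_a(s)$ over probability distributions $\mu$ on $\mathcal S\times\mathcal A$ with $\sum_a(I-P_a^T)\mu(a)=0$, where $P_a=(p_{s,s'}(a))_{s,s'}$, and let $v^*$ solve the Bellman equation $\lambda^*+v^*(s)=\max_a\{r_a(s)+\sum_{s'}p_{s,s'}(a)v^*(s')\}$ with $\sum_s v^*(s)\sum_a\mu^*(s,a)=0$. Put $\tilde t_{mix}=1+4t_{mix}$, $\Gamma=(1-\frac{\eta}{4n^2})^{-2}$, $\rho=(1-\frac{\eta}{4n^2})^{1/B}$, $D(\Gamma,\rho)=\frac{1+\Gamma}{1-\rho}$, $\mathcal V=\{v:\|v\|_\infty\le2t_{mix}\}$, and let $\mathcal U$ be the set of probability distributions $\mu$ on $\mathcal S\times\mathcal A$ with $\sum_a\mu(s,a)\ge\frac1{\sqrt\tau|\mathcal S|}$ for all $s$. **Algorithm (step sizes $\alpha,\beta$).** Start from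 $v_i^0=0$ and $\mu_i^0=\zeta$ for all $i$, with a common $\zeta\in\mathcal U$ having positive entries (for instance the uniform distribution). At time $t$ let $\tilde\mu_i^t=\sum_jw_{ij}^t\mu_j^t$ and $\tilde v_i^t=\sum_jw_{ij}^tv_j^t$. Given the past samples of all agents, agent $i$ samples $(s,a,s')$ with probability $\tilde\mu_i^t(s,a)p_{s,s'}(a)$; the dependence between the agents' samples at the same time is arbitrary. With $$\Delta_i^{t+1}=\beta\,\frac{v_i^t(s')-v_i^t(s)+r^i(s,a,s')-(4t_{mix}+1)}{\tilde\mu_i^t(s,a)}\,\mathbf e_{s,a},\qquad d_i^{t+1}=\frac{\mu_i^t(s,a)}{\tilde\mu_i^t(s,a)}\,\alpha\,(e_s-e_{s'}),$$ let $\mu_i^{t+1/2}\propto\tilde\mu_i^t\exp(\Delta_i^{t+1})$ (normalized to total mass one), $\mu_i^{t+1}=\arg\min_{\mu\in\mathcal U}D_{KL}(\mu\|\mu_i^{t+1/2})$, and let $v_i^{t+1}$ be the Euclidean projection of $\tilde v_i^t+d_i^{t+1}$ onto $\mathcal V$. Let $\bar\mu^t=\frac1n\sum_i\mu_i^t$,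 $\bar v^t=\frac1n\sum_iv_i^t$, $\bar\pi^t(a|s)=\bar\mu^t(s,a)/\sum_{a'}\bar\mu^t(s,a')$, and $$\mathcal E_0=\frac1n\sum_iD_{KL}(\mu^*\|\mu_i^0)+\frac1{2|\mathcal S|t_{mix}^2}\|\bar v^0-v^*\|^2 .$$ **Lemma.** For all $0<c_1\le c_2$ there is a constant $C>0$, depending only on $c_1$ and $c_2$, such that the following holds for every such problem, every $\epsilon>0$ and every integer $T\ge1$ with $$T\ \ge\ C\,\tau^2\,\tilde t_{mix}^2\,\frac{\sqrt n\,\mathcal E_0\,|\mathcal S||\mathcal A|\,D(\Gamma,\rho)}{\epsilon^2}.$$ Put $\beta_0=\sqrt{\mathcal E_0/(\sqrt n|\mathcal S||\mathcal A|\tilde t_{mix}^2D(\Gamma,\rho)T)}$. If the algorithm is run for $T$ iterations with $c_1\beta_0\le\beta\le c_2\beta_0$ and $\alpha=|\mathcal S|t_{mix}^2\beta$, then the averaged policy $\hat\pi=\frac1T\sum_{t=1}^T\bar\pi^t$ satisfies $\lambda_{\hat\pi}\ge\lambda^*-\epsilon$ with probability at least $2/3$. -/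

import Mathlib

open Filter Topology MeasureTheory

/-- A finite Markov decision process shared by a team of `n` agents, with state space `S` and joint
action space `A`. `p s a s'` is the probability of moving from `s` to `s'` under the joint action
`a`; `reward i s a s'` is the reward in `[0,1]` that agent `i` observes on that transition (a reward
that depends only on `(s, a)` is the special case of a function that is constant in `s'`). -/
structure TeamMDP (n : ℕ) (S A : Type*) [Fintype S] where
  p : S → A → S → ℝ
  p_nonneg : ∀ s a s', 0 ≤ p s a s'
  p_sum : ∀ s a, ∑ s', p s a s' = 1
  reward : Fin n → S → A → S → ℝ
  reward_nonneg : ∀ i s a s', 0 ≤ reward i s a s'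
  reward_le_one : ∀ i s a s', reward i s a s' ≤ 1

/-- The local estimates of all agents: `mu i` is the occupancy measure and `v i` the differential
value vector held by agent `i`. -/
structure TeamState (n : ℕ) (S A : Type*) where
  mu : Fin n → S → A → ℝ
  v : Fin n → S → ℝ

/-- A sampled transition: state, joint action, next state. -/
abbrev Transition (S A : Type*) := S × A × S

/-- Stationary randomized policies: `pol s a` is the probability of `a` in state `s`. -/
def IsPolicy {S A : Type*} [Fintype A] (pol : S → A → ℝ) : Prop :=
  ∀ s, (∀ a, 0 ≤ pol s a) ∧ ∑ a, pol s a = 1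

/-- A minimizer of `f` over `s` (arbitrary if there is none). -/
noncomputable def argminOn {X : Type*} [Nonempty X] (f : X → ℝ) (s : Set X) : X :=
  Classical.epsilon fun x => x ∈ s ∧ ∀ y ∈ s, f x ≤ f y

/-- Kullback-Leibler divergence of distributions on `S × A`, with `0 log 0 = 0`. It is only used
with a second argument all of whose entries are positive. -/
noncomputable def klDist {S A : Type*} [Fintype S] [Fintype A] (μ ν : S → A → ℝ) : ℝ :=
  ∑ s, ∑ a, μ s a * Real.log (μ s a / ν s a)

namespace TeamMDP

variable {n : ℕ} {S A : Type*} [Fintype S] [Fintype A]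

/-- Expected one-step reward of agent `i`. -/
def localReward (M : TeamMDP n S A) (i : Fin n) (s : S) (a : A) : ℝ :=
  ∑ s', M.p s a s' * M.reward i s a s'

/-- Expected one-step reward of the team: the average of the local rewards. -/
noncomputable def teamReward (M : TeamMDP n S A) (s : S) (a : A) : ℝ :=
  (1 / (n : ℝ)) * ∑ i, M.localReward i s a

/-- Transition matrix of the Markov chain induced by a policy. -/
def chain (M : TeamMDP n S A) (pol : S → A → ℝ) : Matrix S S ℝ :=
  Matrix.of fun s s' => ∑ a, pol s a * M.p s a s'

/-- Expected one-step team reward under a policy. -/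
noncomputable def policyReward (M : TeamMDP n S A) (pol : S → A → ℝ) (s : S) : ℝ :=
  ∑ a, pol s a * M.teamReward s a

/-- `l` is the long-run average reward of the policy: from every initial state `s`, the limit of
`(1/T) E[r_0 + ... + r_{T-1} | s_0 = s]` exists and equals `l`. -/
def HasAvgReward [DecidableEq S] (M : TeamMDP n S A) (pol : S → A → ℝ) (l : ℝ) : Prop :=
  ∀ s, Tendsto
    (fun T : ℕ => (1 / (T : ℝ)) *
      ∑ t ∈ Finset.range T, ((M.chain pol ^ t).mulVec (M.policyReward pol)) s)
    atTop (𝓝 l)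

/-- The optimal average reward. -/
noncomputable def optAvgReward [DecidableEq S] (M : TeamMDP n S A) : ℝ :=
  sSup {l | ∃ pol, IsPolicy pol ∧ M.HasAvgReward pol l}

/-- The average-reward Bellman equation for the pair `(l, v)`. -/
def SolvesBellman (M : TeamMDP n S A) (l : ℝ) (v : S → ℝ) : Prop :=
  ∀ s, IsGreatest (Set.range fun a => M.teamReward s a + ∑ s', M.p s a s' * v s') (l + v s)

/-- Feasible points of the occupancy-measure linear program. -/
def IsOccupancy (M : TeamMDP n S A) (μ : S → A → ℝ) : Prop :=
  (∀ s a, 0 ≤ μ s a) ∧ ∑ s, ∑ a, μ s a = 1 ∧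
    ∀ s', ∑ a, μ s' a = ∑ s, ∑ a, M.p s a s' * μ s a

/-- Optimal solutions of the occupancy-measure linear program. -/
def IsOptOccupancy (M : TeamMDP n S A) (μ : S → A → ℝ) : Prop :=
  M.IsOccupancy μ ∧ ∀ ν, M.IsOccupancy ν →
    ∑ s, ∑ a, ν s a * M.teamReward s a ≤ ∑ s, ∑ a, μ s a * M.teamReward s a

/-- `ξ` is a stationary distribution of the chain induced by the policy. -/
def IsStationary (M : TeamMDP n S A) (pol : S → A → ℝ) (ξ : S → ℝ) : Prop :=
  (∀ s, 0 ≤ ξ s) ∧ ∑ s, ξ s = 1 ∧ Matrix.vecMul ξ (M.chain pol) = ξ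

/-- Every policy induces an irreducible Markov chain. -/
def IsIrreducible [DecidableEq S] (M : TeamMDP n S A) : Prop :=
  ∀ pol, IsPolicy pol → ∀ s s', ∃ t : ℕ, 0 < (M.chain pol ^ t) s s'

/-- The stationary distribution of every policy lies between `1 / (√τ |S|)` and `√τ / |S|`. -/
def IsTauStationary (M : TeamMDP n S A) (τ : ℝ) : Prop :=
  1 < τ ∧ ∀ pol ξ, IsPolicy pol → M.IsStationary pol ξ → ∀ s,
    1 / (Real.sqrt τ * Fintype.card S) ≤ ξ s ∧ ξ s ≤ Real.sqrt τ / Fintype.card S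

/-- Under every policy, the chain is within total variation distance `1/4` of its stationary
distribution, from every initial state, after some number `1 ≤ t ≤ tmix` of steps. -/
def IsMixing [DecidableEq S] (M : TeamMDP n S A) (tmix : ℝ) : Prop :=
  ∀ pol ξ, IsPolicy pol → M.IsStationary pol ξ → ∃ t : ℕ, 1 ≤ t ∧ (t : ℝ) ≤ tmix ∧
    ∀ s, (1 / 2) * ∑ s', |(M.chain pol ^ t) s s' - ξ s'| ≤ 1 / 4

end TeamMDP

/-- The communication network: at time `t`, `G t` is the graph of links and `W t` the weight matrix.
The weights are symmetric and doubly stochastic; the weight an agent gives to a neighbour or to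
itself is at least `η`, and all other weights vanish; the union of the graphs over any `B`
consecutive times is connected. -/
structure IsMixingNetwork {n : ℕ} (G : ℕ → SimpleGraph (Fin n)) (W : ℕ → Matrix (Fin n) (Fin n) ℝ)
    (η : ℝ) (B : ℕ) : Prop where
  eta_pos : 0 < η
  eta_lt_one : η < 1
  symm : ∀ t i j, W t i j = W t j i
  row_sum : ∀ t i, ∑ j, W t i j = 1
  col_sum : ∀ t j, ∑ i, W t i j = 1
  weight_ge : ∀ t i j, (i = j ∨ (G t).Adj i j) → η ≤ W t i j
  weight_zero : ∀ t i j, i ≠ j → ¬ (G t).Adj i j → W t i j = 0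
  B_pos : 1 ≤ B
  connected : ∀ t, (⨆ l : Fin B, G (t + l)).Connected

/-- `Γ = (1 - η/(4n²))⁻²`. -/
noncomputable def netGamma (n : ℕ) (η : ℝ) : ℝ := ((1 - η / (4 * (n : ℝ) ^ 2)) ^ 2)⁻¹

/-- `ρ = (1 - η/(4n²))^(1/B)`. -/
noncomputable def netRho (n : ℕ) (η : ℝ) (B : ℕ) : ℝ :=
  (1 - η / (4 * (n : ℝ) ^ 2)) ^ (1 / (B : ℝ))

/-- `D(Γ, ρ) = (1 + Γ)/(1 - ρ)`. -/
noncomputable def netD (n : ℕ) (η : ℝ) (B : ℕ) : ℝ :=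
  (1 + netGamma n η) / (1 - netRho n η B)

section Algorithm

variable {n : ℕ} {S A : Type*} [Fintype S] [Fintype A]

/-- The set `𝒱` of value vectors. -/
def valueSet (S : Type*) (tmix : ℝ) : Set (S → ℝ) := {v | ∀ s, |v s| ≤ 2 * tmix}

/-- The set `𝒰` of occupancy measures. -/
def occSet (S A : Type*) [Fintype S] [Fintype A] (τ : ℝ) : Set (S → A → ℝ) :=
  {μ | (∀ s a, 0 ≤ μ s a) ∧ ∑ s, ∑ a, μ s a = 1 ∧
    ∀ s, 1 / (Real.sqrt τ * Fintype.card S) ≤ ∑ a, μ s a}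

/-- Weighted average of the occupancy measures received by agent `i`. -/
def mixMu (w : Matrix (Fin n) (Fin n) ℝ) (x : TeamState n S A) (i : Fin n) (s : S) (a : A) : ℝ :=
  ∑ j, w i j * x.mu j s a

/-- Weighted average of the value vectors received by agent `i`. -/
def mixV (w : Matrix (Fin n) (Fin n) ℝ) (x : TeamState n S A) (i : Fin n) (s : S) : ℝ :=
  ∑ j, w i j * x.v j s

variable [DecidableEq S] [DecidableEq A]

/-- The stochastic dual gradient of agent `i` after sampling the transition `z`. -/
noncomputable def dualGrad (M : TeamMDP n S A) (tmix β : ℝ) (w : Matrix (Fin n) (Fin n) ℝ)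
    (x : TeamState n S A) (i : Fin n) (z : Transition S A) (s : S) (a : A) : ℝ :=
  if s = z.1 ∧ a = z.2.1 then
    β * (x.v i z.2.2 - x.v i z.1 + M.reward i z.1 z.2.1 z.2.2 - (4 * tmix + 1)) /
      mixMu w x i z.1 z.2.1
  else 0

/-- The stochastic primal direction of agent `i` after sampling the transition `z`. -/
noncomputable def primalGrad (α : ℝ) (w : Matrix (Fin n) (Fin n) ℝ)
    (x : TeamState n S A) (i : Fin n) (z : Transition S A) (s : S) : ℝ :=
  x.mu i z.1 z.2.1 / mixMu w x i z.1 z.2.1 * α *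
    ((if s = z.1 then 1 else 0) - (if s = z.2.2 then 1 else 0))

/-- The exponentiated-gradient point of agent `i`, before projection. -/
noncomputable def halfMu (M : TeamMDP n S A) (tmix β : ℝ) (w : Matrix (Fin n) (Fin n) ℝ)
    (x : TeamState n S A) (i : Fin n) (z : Transition S A) (s : S) (a : A) : ℝ :=
  mixMu w x i s a * Real.exp (dualGrad M tmix β w x i z s a) /
    ∑ s', ∑ a', mixMu w x i s' a' * Real.exp (dualGrad M tmix β w x i z s' a')

/-- One iteration for all agents: KL projection of the half step onto `𝒰`, and Euclidean projection
of the value update onto `𝒱`. -/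
noncomputable def algStep (M : TeamMDP n S A) (tmix τ α β : ℝ) (w : Matrix (Fin n) (Fin n) ℝ)
    (x : TeamState n S A) (z : Fin n → Transition S A) : TeamState n S A where
  mu i := argminOn (fun μ => klDist μ (halfMu M tmix β w x i (z i))) (occSet S A τ)
  v i := argminOn
    (fun u => ∑ s, (u s - (mixV w x i s + primalGrad α w x i (z i) s)) ^ 2) (valueSet S tmix)

/-- Common initialization: occupancy measure `ζ` and value vector `0` for every agent. -/
def initState (n : ℕ) {S A : Type*} (ζ : S → A → ℝ) : TeamState n S A where
  mu _ := ζ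
  v _ _ := 0

/-- The iterates along a given sequence of sampled transitions; the iterate at time `t` depends only
on the samples at times `0, ..., t - 1`. -/
noncomputable def iterates (M : TeamMDP n S A) (tmix τ α β : ℝ)
    (W : ℕ → Matrix (Fin n) (Fin n) ℝ) (ζ : S → A → ℝ)
    (z : ℕ → Fin n → Transition S A) : ℕ → TeamState n S A
  | 0 => initState n ζ
  | t + 1 => algStep M tmix τ α β (W t) (iterates M tmix τ α β W ζ z t) (z t)

/-- `Z` is the sequence of transitions sampled in a random run of the algorithm: given the samples
of all agents at earlier times, the transition that agent `i` samples at time `t` equals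
`(s, a, s')` with probability `μ̃_i^t(s, a) p(s' | s, a)`. Nothing is required about the dependence
between the samples of different agents at the same time. -/
structure IsRun {Ω : Type*} [MeasurableSpace Ω] (P : Measure Ω) (M : TeamMDP n S A)
    (tmix τ α β : ℝ) (W : ℕ → Matrix (Fin n) (Fin n) ℝ) (ζ : S → A → ℝ)
    (Z : ℕ → Ω → Fin n → Transition S A) : Prop where
  measurable : ∀ t z, MeasurableSet {ω | Z t ω = z}
  law : ∀ (t : ℕ) (i : Fin n) (h : ℕ → Fin n → Transition S A) (s : S) (a : A) (s' : S),
    P.real {ω | (∀ k < t, Z k ω = h k) ∧ Z t ω i = (s, a, s')} =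
      P.real {ω | ∀ k < t, Z k ω = h k} *
        (mixMu (W t) (iterates M tmix τ α β W ζ h t) i s a * M.p s a s')

/-- The Lyapunov function `ℰ`, relative to an optimal pair `(μ*, v*)`. -/
noncomputable def lyapunov (tmix : ℝ) (muStar : S → A → ℝ) (vStar : S → ℝ)
    (x : TeamState n S A) : ℝ :=
  (1 / (n : ℝ)) * ∑ i, klDist muStar (x.mu i) +
    1 / (2 * Fintype.card S * tmix ^ 2) * ∑ s, ((1 / (n : ℝ)) * ∑ i, x.v i s - vStar s) ^ 2

/-- The network average of the occupancy measures. -/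
noncomputable def avgMu (x : TeamState n S A) (s : S) (a : A) : ℝ :=
  (1 / (n : ℝ)) * ∑ i, x.mu i s a

/-- The policy obtained by normalizing the network-average occupancy measure. -/
noncomputable def avgPolicy (x : TeamState n S A) (s : S) (a : A) : ℝ :=
  avgMu x s a / ∑ a', avgMu x s a'

/-- The time-averaged policy over the iterates `1, ..., T`. -/
noncomputable def outputPolicy (x : ℕ → TeamState n S A) (T : ℕ) (s : S) (a : A) : ℝ :=
  (1 / (T : ℝ)) * ∑ t ∈ Finset.Icc 1 T, avgPolicy (x t) s a

end Algorithm

/-! The algorithm is stochastic primal-dual mirror descent for the saddle point of the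
occupancy-measure linear program. Let the advantage be `λ* + v*(s) - r_a(s) - ∑ p v*`, which is
nonnegative by the Bellman equation. Under an occupancy measure its mean is the loss of average
reward. Every stationary distribution is at most `√τ/|S|`, hence at most `τ` times the state
marginal of any measure in `𝒰`. So the loss of the averaged policy is at most `τ` times the time
average of the gap, the mean advantage under `μ̄^t` (`exists_hasAvgReward_of_average`). By Markov's
inequality it suffices that the expected average gap be at most `ε/(3τ)`.

The expected gap is controlled by `potential`, the average over agents of `KL(μ*‖μ_i) + ‖v_i -
v*‖²/(2|S|tmix²)`, which starts at `ℰ₀`. Mixing does not increase it, by convexity; neither do the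
projections, since `μ* ∈ 𝒰` and `v* ∈ 𝒱`. For the gradient steps, the dual update contributes the
pairing of `μ̃_i` with `v_i`, the primal update that of `μ_i` with `ṽ_i`. With the given ratio `α/β`
they carry the same weight, and summed over the agents they cancel because the weights are
symmetric. What remains is `-β · gap`, plus second moments of order `β²`, plus `β` times a consensus
error: each agent sees only its own reward, and replacing `μ̃_i` by `μ̄` costs their ℓ¹ distance.

The consensus error is itself of order `β`. The expected ℓ¹ deviation of a new measure from its
mixed one is `O(β)` by a weak Pinsker inequality, and over `B` rounds averaging contracts the
disagreement by `1 - η/(4n²)` (`disagreement_window`), so the deviations sum to at most a multiple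
of `D(Γ, ρ)`.

With `R = √n|S||A|(1+4tmix)²D`, each round gives `E Φ' + β E gap ≤ E Φ + 9β²R`. Telescoping yields
an average gap of at most `ℰ₀/(βT) + 18βR`, and `β` of order `√(ℰ₀/(RT))` balances the two terms. -/

theorem argminOn_eq {X : Type*} [Nonempty X] {f : X → ℝ} {s : Set X} {p : X} (hp : p ∈ s)
    (h : ∀ y ∈ s, y ≠ p → f p < f y) : argminOn f s = p := by
  -- Strict minimality leaves a single admissible value for the arbitrary choice in `argminOn`.
  have hspec : argminOn f s ∈ s ∧ ∀ y ∈ s, f (argminOn f s) ≤ f y :=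
    Classical.epsilon_spec (p := fun x => x ∈ s ∧ ∀ y ∈ s, f x ≤ f y)
      ⟨p, hp, fun y hy => by
        rcases eq_or_ne y p with rfl | hne
        · exact le_rfl
        · exact (h y hy hne).le⟩
  by_contra hne
  exact absurd (h _ hspec.1 hne) (not_lt.2 (hspec.2 p hp))

/-- Euclidean projection onto a box decreases the distance to every point of the box. -/
theorem argminOn_box {S : Type*} [Fintype S] {b : ℝ} (hb : 0 ≤ b) (y : S → ℝ) :
    (∀ s, |argminOn (fun u : S → ℝ => ∑ s, (u s - y s) ^ 2) {v | ∀ s, |v s| ≤ b} s| ≤ b) ∧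
      ∀ v : S → ℝ, (∀ s, |v s| ≤ b) →
        ∑ s, (argminOn (fun u : S → ℝ => ∑ s, (u s - y s) ^ 2) {v | ∀ s, |v s| ≤ b} s - v s) ^ 2
          ≤ ∑ s, (y s - v s) ^ 2 := by
  -- The projection clips each coordinate. A coordinatewise Pythagorean inequality gives both strict
  -- minimality and the distance bound.
  set p : S → ℝ := fun s => max (-b) (min b (y s)) with hpdef
  have hp : ∀ s, |p s| ≤ b := fun s =>
    abs_le.2 ⟨le_max_left _ _, max_le (by linarith) (min_le_left _ _)⟩
  have hpyth : ∀ v : S → ℝ, (∀ s, |v s| ≤ b) → ∀ s,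
      (p s - v s) ^ 2 + (p s - y s) ^ 2 ≤ (v s - y s) ^ 2 := by
    intro v hv s
    obtain ⟨h1, h2⟩ := abs_le.1 (hv s)
    simp only [hpdef]
    rcases le_total b (y s) with h | h
    · rw [min_eq_left h, max_eq_right (by linarith)]
      nlinarith [mul_nonneg (sub_nonneg.2 h) (sub_nonneg.2 h2)]
    · rw [min_eq_right h]
      rcases le_total (-b) (y s) with h' | h'
      · rw [max_eq_right h']; nlinarith
      · rw [max_eq_left h']
        nlinarith [mul_nonneg (sub_nonneg.2 h') (by linarith : 0 ≤ v s + b)]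
  have heq : argminOn (fun u : S → ℝ => ∑ s, (u s - y s) ^ 2) {v | ∀ s, |v s| ≤ b} = p := by
    refine argminOn_eq hp fun v hv hne => ?_
    obtain ⟨s₀, hs₀⟩ := Function.ne_iff.1 hne
    refine Finset.sum_lt_sum (fun s _ => ?_) ⟨s₀, Finset.mem_univ _, ?_⟩
    · nlinarith [hpyth v hv s, sq_nonneg (p s - v s)]
    · have : 0 < (p s₀ - v s₀) ^ 2 := by
        have : p s₀ - v s₀ ≠ 0 := sub_ne_zero.2 (Ne.symm hs₀)
        positivity
      linarith [hpyth v hv s₀]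
  rw [heq]
  refine ⟨hp, fun v hv => Finset.sum_le_sum fun s _ => ?_⟩
  nlinarith [hpyth v hv s, sq_nonneg (p s - y s)]

/-! ### Kullback-Leibler divergence and the projection onto `𝒰` -/

section KL

variable {S A : Type*} [Fintype S] [Fintype A]

/-- This is `log u ≤ u - 1` at `u = √y/√x`. Summed over two distributions, the linear part cancels
and the squared Hellinger distance remains. -/
theorem sub_add_sqrt_sub_sqrt_sq_le_mul_log {x y : ℝ} (hx : 0 ≤ x) (hy : 0 < y) :
    x - y + (√x - √y) ^ 2 ≤ x * Real.log (x / y) := by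
  rcases hx.eq_or_lt with rfl | hx
  · simp [Real.sq_sqrt hy.le]
  have hsx := Real.sqrt_pos.2 hx
  have hsy := Real.sqrt_pos.2 hy
  have h1 : Real.log (x / y) = -(2 * Real.log (√y / √x)) := by
    rw [Real.log_div hx.ne' hy.ne', Real.log_div hsy.ne' hsx.ne', Real.log_sqrt hx.le,
      Real.log_sqrt hy.le]
    ring
  have h2 : Real.log (√y / √x) ≤ √y / √x - 1 := Real.log_le_sub_one_of_pos (by positivity)
  have h3 : x * (√y / √x) = √x * √y := by
    rw [mul_div_assoc', div_eq_iff hsx.ne']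
    nlinarith [Real.mul_self_sqrt hx.le]
  rw [h1]
  nlinarith [Real.sq_sqrt hx.le, Real.sq_sqrt hy.le, mul_le_mul_of_nonneg_left h2 hx.le]

theorem sum_sqrt_sub_sqrt_sq_le_klDist {μ ν : S → A → ℝ} (hμ : ∀ s a, 0 ≤ μ s a)
    (hν : ∀ s a, 0 < ν s a) (hμ1 : ∑ s, ∑ a, μ s a = 1) (hν1 : ∑ s, ∑ a, ν s a = 1) :
    ∑ s, ∑ a, (√(μ s a) - √(ν s a)) ^ 2 ≤ klDist μ ν := by
  have h : ∑ s, ∑ a, (μ s a - ν s a + (√(μ s a) - √(ν s a)) ^ 2) ≤ klDist μ ν :=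
    Finset.sum_le_sum fun s _ => Finset.sum_le_sum fun a _ =>
      sub_add_sqrt_sub_sqrt_sq_le_mul_log (hμ s a) (hν s a)
  simp only [Finset.sum_add_distrib, Finset.sum_sub_distrib, hμ1, hν1] at h
  linarith

theorem klDist_nonneg {μ ν : S → A → ℝ} (hμ : ∀ s a, 0 ≤ μ s a)
    (hν : ∀ s a, 0 < ν s a) (hμ1 : ∑ s, ∑ a, μ s a = 1) (hν1 : ∑ s, ∑ a, ν s a = 1) :
    0 ≤ klDist μ ν :=
  (Finset.sum_nonneg fun _ _ => Finset.sum_nonneg fun _ _ => sq_nonneg _).trans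
    (sum_sqrt_sub_sqrt_sq_le_klDist hμ hν hμ1 hν1)

/-- A weak form of Pinsker's inequality. -/
theorem sq_sum_abs_sub_le_klDist {μ ν : S → A → ℝ} (hμ : ∀ s a, 0 ≤ μ s a)
    (hν : ∀ s a, 0 < ν s a) (hμ1 : ∑ s, ∑ a, μ s a = 1) (hν1 : ∑ s, ∑ a, ν s a = 1) :
    (∑ s, ∑ a, |μ s a - ν s a|) ^ 2 ≤ 4 * klDist μ ν := by
  have h1 := sum_sqrt_sub_sqrt_sq_le_klDist hμ hν hμ1 hν1
  simp only [← Fintype.sum_prod_type'] at h1 hμ1 hν1 ⊢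
  -- Cauchy-Schwarz for `|μ - ν| = |√μ - √ν| (√μ + √ν)`. The second factor has squared norm at most
  -- 4, whence the constant 4 in place of the sharp 2.
  have h2 := Finset.sum_mul_sq_le_sq_mul_sq (Finset.univ : Finset (S × A))
    (fun x => |√(μ x.1 x.2) - √(ν x.1 x.2)|) (fun x => √(μ x.1 x.2) + √(ν x.1 x.2))
  have h3 : ∀ x : S × A, |√(μ x.1 x.2) - √(ν x.1 x.2)| * (√(μ x.1 x.2) + √(ν x.1 x.2)) =
      |μ x.1 x.2 - ν x.1 x.2| := by
    intro x
    rw [← abs_of_nonneg (by positivity : 0 ≤ √(μ x.1 x.2) + √(ν x.1 x.2)), ← abs_mul]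
    congr 1
    nlinarith [Real.sq_sqrt (hμ x.1 x.2), Real.sq_sqrt (hν x.1 x.2).le]
  have h4 : ∑ x : S × A, (√(μ x.1 x.2) + √(ν x.1 x.2)) ^ 2 ≤ 4 := by
    calc ∑ x : S × A, (√(μ x.1 x.2) + √(ν x.1 x.2)) ^ 2
        ≤ ∑ x : S × A, (2 * μ x.1 x.2 + 2 * ν x.1 x.2) := Finset.sum_le_sum fun x _ => by
          nlinarith [Real.sq_sqrt (hμ x.1 x.2), Real.sq_sqrt (hν x.1 x.2).le,
            sq_nonneg (√(μ x.1 x.2) - √(ν x.1 x.2))]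
      _ = 4 := by
          rw [Finset.sum_add_distrib, ← Finset.mul_sum, ← Finset.mul_sum, hμ1, hν1]; norm_num
  simp only [h3, sq_abs] at h2
  refine h2.trans ?_
  rw [mul_comm]
  exact mul_le_mul h4 h1 (Finset.sum_nonneg fun _ _ => sq_nonneg _) (by norm_num)

theorem eq_of_klDist_nonpos {μ ν : S → A → ℝ} (hμ : ∀ s a, 0 ≤ μ s a)
    (hν : ∀ s a, 0 < ν s a) (hμ1 : ∑ s, ∑ a, μ s a = 1) (hν1 : ∑ s, ∑ a, ν s a = 1)
    (h : klDist μ ν ≤ 0) : μ = ν := by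
  have h0 : ∑ s, ∑ a, |μ s a - ν s a| = 0 := by
    have := sq_sum_abs_sub_le_klDist hμ hν hμ1 hν1
    exact pow_eq_zero_iff (two_ne_zero) |>.1
      (le_antisymm (by linarith) (sq_nonneg _))
  rw [← Fintype.sum_prod_type', Finset.sum_eq_zero_iff_of_nonneg fun _ _ => abs_nonneg _] at h0
  funext s a
  exact sub_eq_zero.1 (abs_eq_zero.1 (h0 (s, a) (Finset.mem_univ _)))

theorem klDist_eq_sub {μ ν : S → A → ℝ} (hν : ∀ s a, 0 < ν s a) :
    klDist μ ν = ∑ s, ∑ a, (μ s a * Real.log (μ s a) - μ s a * Real.log (ν s a)) := by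
  refine Finset.sum_congr rfl fun s _ => Finset.sum_congr rfl fun a _ => ?_
  rcases eq_or_ne (μ s a) 0 with h | h
  · simp [h]
  · rw [Real.log_div h (hν s a).ne']; ring

/-- The Kullback-Leibler divergence is convex in its second argument. -/
theorem klDist_sum_le {ι : Type*} [Fintype ι] {μ : S → A → ℝ} (hμ : ∀ s a, 0 ≤ μ s a)
    {w : ι → ℝ} (hw : ∀ j, 0 ≤ w j) (hw1 : ∑ j, w j = 1) {ν : ι → S → A → ℝ}
    (hν : ∀ j s a, 0 < ν j s a) :
    klDist μ (fun s a => ∑ j, w j * ν j s a) ≤ ∑ j, w j * klDist μ (ν j) := by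
  have hlog : ∀ s a, ∑ j, w j * Real.log (ν j s a) ≤ Real.log (∑ j, w j * ν j s a) := by
    intro s a
    have := strictConcaveOn_log_Ioi.concaveOn.le_map_sum (t := Finset.univ) (w := w)
      (p := fun j => ν j s a) (fun j _ => hw j) hw1 (fun j _ => hν j s a)
    simpa using this
  have hpos : ∀ s a, 0 < ∑ j, w j * ν j s a := by
    intro s a
    obtain ⟨j, -, hj⟩ := Finset.exists_ne_zero_of_sum_ne_zero (hw1 ▸ one_ne_zero)
    exact Finset.sum_pos' (fun j _ => mul_nonneg (hw j) (hν j s a).le)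
      ⟨j, Finset.mem_univ _, mul_pos (lt_of_le_of_ne (hw j) (Ne.symm hj)) (hν j s a)⟩
  have hterm : ∀ s a, μ s a * Real.log (μ s a) - μ s a * Real.log (∑ j, w j * ν j s a) ≤
      ∑ j, w j * (μ s a * Real.log (μ s a) - μ s a * Real.log (ν j s a)) := by
    intro s a
    have : ∑ j, w j * (μ s a * Real.log (μ s a) - μ s a * Real.log (ν j s a)) =
        μ s a * Real.log (μ s a) - μ s a * ∑ j, w j * Real.log (ν j s a) := by
      simp only [mul_sub, Finset.sum_sub_distrib, ← Finset.sum_mul, hw1, one_mul, Finset.mul_sum]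
      congr 1
      exact Finset.sum_congr rfl fun j _ => by ring
    rw [this]
    linarith [mul_le_mul_of_nonneg_left (hlog s a) (hμ s a)]
  calc klDist μ (fun s a => ∑ j, w j * ν j s a)
      = ∑ s, ∑ a, (μ s a * Real.log (μ s a) - μ s a * Real.log (∑ j, w j * ν j s a)) :=
        klDist_eq_sub hpos
    _ ≤ ∑ s, ∑ a, ∑ j, w j * (μ s a * Real.log (μ s a) - μ s a * Real.log (ν j s a)) :=
        Finset.sum_le_sum fun s _ => Finset.sum_le_sum fun a _ => hterm s a
    _ = ∑ s, ∑ j, ∑ a, w j * (μ s a * Real.log (μ s a) - μ s a * Real.log (ν j s a)) :=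
        Finset.sum_congr rfl fun s _ => Finset.sum_comm
    _ = ∑ j, ∑ s, ∑ a, w j * (μ s a * Real.log (μ s a) - μ s a * Real.log (ν j s a)) :=
        Finset.sum_comm
    _ = ∑ j, w j * klDist μ (ν j) :=
        Finset.sum_congr rfl fun j _ => by rw [klDist_eq_sub (hν j)]; simp only [Finset.mul_sum]

/-- The Kullback-Leibler projection onto the distributions whose first marginal is bounded below
exists, is positive, and satisfies the Pythagorean inequality. -/
theorem exists_klProjection [Nonempty S] [Nonempty A] {c : ℝ} (hc : 0 ≤ c)
    (hc1 : Fintype.card S * c < 1) {ν : S → A → ℝ} (hν : ∀ s a, 0 < ν s a)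
    (hν1 : ∑ s, ∑ a, ν s a = 1) :
    ∃ p : S → A → ℝ, (∀ s a, 0 < p s a) ∧ ∑ s, ∑ a, p s a = 1 ∧ (∀ s, c ≤ ∑ a, p s a) ∧
      ∀ μ : S → A → ℝ, (∀ s a, 0 ≤ μ s a) → ∑ s, ∑ a, μ s a = 1 → (∀ s, c ≤ ∑ a, μ s a) →
        klDist μ p + klDist p ν ≤ klDist μ ν := by
  set m : S → ℝ := fun s => ∑ a, ν s a with hm
  have hmpos : ∀ s, 0 < m s := fun s => Finset.sum_pos (fun a _ => hν s a) Finset.univ_nonempty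
  -- The optimality conditions suggest rescaling the rows of `ν` to have marginals `max c (κ m s)`,
  -- with `κ` fixed by the total mass. The mass is `|S| c < 1` at `κ = 0` and at least 1 at `κ = 1`.
  obtain ⟨κ, ⟨hκ0, -⟩, hκ⟩ : ∃ κ ∈ Set.Icc (0 : ℝ) 1, ∑ s, max c (κ * m s) = 1 := by
    have hcont : ContinuousOn (fun κ : ℝ => ∑ s, max c (κ * m s)) (Set.Icc 0 1) := by fun_prop
    refine intermediate_value_Icc zero_le_one hcont ⟨?_, ?_⟩
    · simp [max_eq_left hc]; linarith
    · simp only [one_mul]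
      calc (1 : ℝ) = ∑ s, m s := hν1.symm
        _ ≤ _ := Finset.sum_le_sum fun s _ => le_max_right _ _
  have hκpos : 0 < κ := by
    refine lt_of_le_of_ne hκ0 fun h => ?_
    rw [← h] at hκ
    simp [max_eq_left hc] at hκ
    linarith
  set q : S → ℝ := fun s => max c (κ * m s) with hq
  have hqpos : ∀ s, 0 < q s := fun s => lt_of_lt_of_le (mul_pos hκpos (hmpos s)) (le_max_right _ _)
  set p : S → A → ℝ := fun s a => ν s a * (q s / m s) with hp
  have hpm : ∀ s, ∑ a, p s a = q s := fun s => by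
    simp only [hp, ← Finset.sum_mul]
    exact mul_div_cancel₀ _ (hmpos s).ne'
  have hppos : ∀ s a, 0 < p s a := fun s a => mul_pos (hν s a) (div_pos (hqpos s) (hmpos s))
  refine ⟨p, hppos, by simp only [hpm]; exact hκ, fun s => (hpm s).symm ▸ le_max_left _ _, ?_⟩
  intro μ hμ hμ1 hμc
  have hlogp : ∀ s a, Real.log (p s a) = Real.log (ν s a) + Real.log (q s / m s) := fun s a =>
    Real.log_mul (hν s a).ne' (div_pos (hqpos s) (hmpos s)).ne'
  have hdiff : ∀ ρ : S → A → ℝ, klDist ρ ν - klDist ρ p =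
      ∑ s, (∑ a, ρ s a) * Real.log (q s / m s) := by
    intro ρ
    rw [klDist_eq_sub hν, klDist_eq_sub hppos, ← Finset.sum_sub_distrib]
    refine Finset.sum_congr rfl fun s _ => ?_
    rw [← Finset.sum_sub_distrib, Finset.sum_mul]
    exact Finset.sum_congr rfl fun a _ => by rw [hlogp]; ring
  have hpp : klDist p p = 0 := by
    rw [klDist_eq_sub hppos]; simp
  have h1 := hdiff μ
  have h2 := hdiff p
  -- The variational inequality. The coefficient `log (q/m)` equals `log κ` where the constraint is
  -- slack and is at least `log κ` where the marginal of `p` sits at the floor `c`, and there `μ`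
  -- has at least as much mass. Subtracting `log κ` is free because the total masses agree.
  have h3 : ∑ s, (∑ a, p s a) * Real.log (q s / m s) ≤ ∑ s, (∑ a, μ s a) * Real.log (q s / m s) := by
    have hz : ∑ s, ((∑ a, μ s a) - ∑ a, p s a) * Real.log κ = 0 := by
      rw [← Finset.sum_mul, Finset.sum_sub_distrib, hμ1]
      simp only [hpm]
      rw [hκ]; simp
    have : 0 ≤ ∑ s, ((∑ a, μ s a) - ∑ a, p s a) * (Real.log (q s / m s) - Real.log κ) := by
      refine Finset.sum_nonneg fun s _ => ?_
      rw [hpm]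
      rcases le_total c (κ * m s) with h | h
      · have : q s / m s = κ := by
          rw [hq]; simp only [max_eq_right h]
          exact mul_div_cancel_right₀ _ (hmpos s).ne'
        simp [this]
      · have hqs : q s = c := max_eq_left h
        refine mul_nonneg (by rw [hqs]; linarith [hμc s]) (sub_nonneg.2 ?_)
        refine Real.log_le_log hκpos ?_
        rw [le_div_iff₀ (hmpos s)]
        exact le_max_right _ _
    simp only [mul_sub, Finset.sum_sub_distrib, sub_mul] at this hz
    linarith
  linarith

/-- The Pythagorean inequality makes the explicit projection the unique minimizer. The floors in `𝒰`
have total mass `1/√τ`, which is below 1 because `τ > 1`. -/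
theorem argminOn_occSet [Nonempty S] [Nonempty A] {τ : ℝ} (hτ : 1 < τ) {ν : S → A → ℝ}
    (hν : ∀ s a, 0 < ν s a) (hν1 : ∑ s, ∑ a, ν s a = 1) :
    (∀ s a, 0 < argminOn (fun μ => klDist μ ν) (occSet S A τ) s a) ∧
      argminOn (fun μ => klDist μ ν) (occSet S A τ) ∈ occSet S A τ ∧
      ∀ μ ∈ occSet S A τ,
        klDist μ (argminOn (fun μ => klDist μ ν) (occSet S A τ)) ≤ klDist μ ν := by
  have hcard : (0 : ℝ) < Fintype.card S := by exact_mod_cast Fintype.card_pos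
  have hsq : 1 < √τ := by
    rw [show (1 : ℝ) = √1 by simp]; exact Real.sqrt_lt_sqrt zero_le_one hτ
  have hc1 : Fintype.card S * (1 / (√τ * Fintype.card S)) < 1 := by
    rw [mul_one_div, div_lt_one (by positivity)]
    nlinarith
  obtain ⟨p, hppos, hp1, hpc, hpyth⟩ := exists_klProjection (by positivity) hc1 hν hν1
  have hpmem : p ∈ occSet S A τ := ⟨fun s a => (hppos s a).le, hp1, hpc⟩
  have heq : argminOn (fun μ => klDist μ ν) (occSet S A τ) = p := by
    refine argminOn_eq hpmem fun μ hμ hne => ?_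
    by_contra hle
    refine hne (eq_of_klDist_nonpos hμ.1 hppos hμ.2.1 hp1 ?_)
    linarith [hpyth μ hμ.1 hμ.2.1 hμ.2.2]
  rw [heq]
  refine ⟨hppos, hpmem, fun μ hμ => ?_⟩
  linarith [hpyth μ hμ.1 hμ.2.1 hμ.2.2, klDist_nonneg (fun s a => (hppos s a).le) hν hp1 hν1]

end KL

/-! ### Contraction of disagreement by averaging over the network -/

section Network

variable {n : ℕ}

/-- The mean of a vector with one entry per agent. -/
noncomputable def agentMean (x : Fin n → ℝ) : ℝ := (1 / (n : ℝ)) * ∑ i, x i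

/-- The Euclidean distance of a vector with one entry per agent to consensus. -/
noncomputable def disagreement (x : Fin n → ℝ) : ℝ := √(∑ i, (x i - agentMean x) ^ 2)

theorem agentMean_add (x y : Fin n → ℝ) : agentMean (x + y) = agentMean x + agentMean y := by
  simp [agentMean, Finset.sum_add_distrib, mul_add]

theorem disagreement_nonneg (x : Fin n → ℝ) : 0 ≤ disagreement x := Real.sqrt_nonneg _

theorem disagreement_sq (x : Fin n → ℝ) :
    disagreement x ^ 2 = ∑ i, (x i - agentMean x) ^ 2 :=
  Real.sq_sqrt (Finset.sum_nonneg fun _ _ => sq_nonneg _)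

theorem sum_sub_agentMean (hn : 0 < n) (x : Fin n → ℝ) : ∑ i, (x i - agentMean x) = 0 := by
  have : (n : ℝ) ≠ 0 := by positivity
  simp [agentMean, Finset.sum_sub_distrib]
  field_simp
  ring

theorem disagreement_add_le (x y : Fin n → ℝ) :
    disagreement (x + y) ≤ disagreement x + disagreement y := by
  have h : ∀ z : Fin n → ℝ,
      disagreement z = ‖WithLp.toLp 2 (fun i => z i - agentMean z)‖ := by
    intro z
    rw [EuclideanSpace.norm_eq]
    simp [disagreement]
  rw [h, h, h]
  refine le_trans (le_of_eq ?_) (norm_add_le _ _)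
  congr 1
  ext i
  simp [agentMean_add]
  ring

theorem disagreement_le_sum_abs (hn : 0 < n) (x : Fin n → ℝ) : disagreement x ≤ ∑ i, |x i| := by
  refine Real.sqrt_le_iff.2 ⟨Finset.sum_nonneg fun _ _ => abs_nonneg _, ?_⟩
  calc ∑ i, (x i - agentMean x) ^ 2
      = ∑ i, x i ^ 2 - ∑ _i : Fin n, agentMean x ^ 2 := by
        have h := sum_sub_agentMean hn x
        have h2 : ∑ i, (x i - agentMean x) ^ 2 =
            ∑ i, x i ^ 2 - ∑ _i : Fin n, agentMean x ^ 2 - 2 * agentMean x * ∑ i, (x i - agentMean x) := by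
          rw [Finset.mul_sum, ← Finset.sum_sub_distrib, ← Finset.sum_sub_distrib]
          exact Finset.sum_congr rfl fun i _ => by ring
        rw [h2, h]; ring
    _ ≤ ∑ i, |x i| ^ 2 := by
        simp only [sq_abs]
        have : 0 ≤ ∑ _i : Fin n, agentMean x ^ 2 := Finset.sum_nonneg fun _ _ => sq_nonneg _
        linarith
    _ ≤ (∑ i, |x i|) ^ 2 := Finset.sum_sq_le_sq_sum_of_nonneg fun _ _ => abs_nonneg _

theorem sum_abs_sub_agentMean_le (x : Fin n → ℝ) :
    ∑ i, |x i - agentMean x| ≤ √n * disagreement x := by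
  rw [disagreement, ← Real.sqrt_mul (Nat.cast_nonneg n)]
  refine Real.le_sqrt_of_sq_le ?_
  have := sq_sum_le_card_mul_sum_sq (s := (Finset.univ : Finset (Fin n)))
    (f := fun i => |x i - agentMean x|)
  simpa using this

namespace IsMixingNetwork

variable {G : ℕ → SimpleGraph (Fin n)} {W : ℕ → Matrix (Fin n) (Fin n) ℝ} {η : ℝ} {B : ℕ}

theorem weight_nonneg (h : IsMixingNetwork G W η B) (t : ℕ) (i j : Fin n) : 0 ≤ W t i j := by
  by_cases hij : i = j ∨ (G t).Adj i j
  · exact h.eta_pos.le.trans (h.weight_ge t i j hij)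
  · rw [not_or] at hij
    exact (h.weight_zero t i j hij.1 hij.2).ge

theorem sum_mulVec (h : IsMixingNetwork G W η B) (t : ℕ) (x : Fin n → ℝ) :
    ∑ i, (W t).mulVec x i = ∑ i, x i := by
  simp only [Matrix.mulVec, dotProduct]
  rw [Finset.sum_comm]
  simp only [← Finset.sum_mul, h.col_sum, one_mul]

theorem agentMean_mulVec (h : IsMixingNetwork G W η B) (t : ℕ) (x : Fin n → ℝ) :
    agentMean ((W t).mulVec x) = agentMean x := by
  simp only [agentMean, h.sum_mulVec]

/-- One round of averaging reduces the variance by at least the weighted squared difference between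
each agent and one of its neighbours. -/
theorem disagreement_sq_mulVec_add_le (h : IsMixingNetwork G W η B) (t : ℕ) (x : Fin n → ℝ)
    (l : Fin n → Fin n) (hl : ∀ k, l k = k ∨ (G t).Adj k (l k)) :
    disagreement ((W t).mulVec x) ^ 2 + η / 2 * ∑ k, |x k - x (l k)| ^ 2 ≤ disagreement x ^ 2 := by
  set y := (W t).mulVec x with hy
  set m := agentMean x with hm
  have h1 : disagreement x ^ 2 = ∑ k, ∑ i, W t k i * (x i - m) ^ 2 := by
    rw [disagreement_sq, Finset.sum_comm]
    simp only [← Finset.sum_mul, h.col_sum, one_mul, hm]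
  have h2 : disagreement y ^ 2 = ∑ k, (y k - m) ^ 2 := by
    rw [disagreement_sq, hy, h.agentMean_mulVec]
  rw [h1, h2, Finset.mul_sum, ← Finset.sum_add_distrib]
  refine Finset.sum_le_sum fun k _ => ?_
  have hyk : y k = ∑ i, W t k i * x i := rfl
  -- Bias-variance identity: `y k` is the mean of `x` under row `k`, so averaging loses exactly the
  -- variance of that row.
  have h3 : ∑ i, W t k i * (x i - m) ^ 2 = (y k - m) ^ 2 + ∑ i, W t k i * (x i - y k) ^ 2 := by
    have e1 : ∑ i, W t k i * (x i - m) ^ 2 =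
        ∑ i, W t k i * (x i - y k) ^ 2 + 2 * (y k - m) * ((∑ i, W t k i * x i)
          - (∑ i, W t k i) * y k) + (∑ i, W t k i) * (y k - m) ^ 2 := by
      rw [Finset.sum_mul, Finset.sum_mul, ← Finset.sum_sub_distrib, Finset.mul_sum,
        ← Finset.sum_add_distrib, ← Finset.sum_add_distrib]
      exact Finset.sum_congr rfl fun i _ => by ring
    rw [e1, h.row_sum, ← hyk]; ring
  rw [h3]
  have hη := h.eta_pos
  have hnn : ∀ i, 0 ≤ W t k i * (x i - y k) ^ 2 := fun i =>
    mul_nonneg (h.weight_nonneg t k i) (sq_nonneg _)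
  rcases eq_or_ne (l k) k with hlk | hlk
  · rw [hlk]
    have := Finset.sum_nonneg fun i (_ : i ∈ Finset.univ) => hnn i
    simpa using this
  · have hadj := (hl k).resolve_left hlk
    -- Two terms of the row variance suffice. Both weights are at least `η`, and `a² + b² ≥ (a -
    -- b)²/2` produces `η/2`.
    have h4 : W t k k * (x k - y k) ^ 2 + W t k (l k) * (x (l k) - y k) ^ 2 ≤
        ∑ i, W t k i * (x i - y k) ^ 2 := by
      rw [← Finset.sum_pair (f := fun i => W t k i * (x i - y k) ^ 2) hlk.symm]
      exact Finset.sum_le_sum_of_subset_of_nonneg (Finset.subset_univ _) fun i _ _ => hnn i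
    have h5 := mul_le_mul_of_nonneg_right (h.weight_ge t k k (Or.inl rfl)) (sq_nonneg (x k - y k))
    have h6 := mul_le_mul_of_nonneg_right (h.weight_ge t k (l k) (Or.inr hadj))
      (sq_nonneg (x (l k) - y k))
    rw [sq_abs]
    nlinarith [mul_nonneg hη.le (sq_nonneg ((x k - y k) + (x (l k) - y k)))]

theorem disagreement_mulVec_le (h : IsMixingNetwork G W η B) (t : ℕ) (x : Fin n → ℝ) :
    disagreement ((W t).mulVec x) ≤ disagreement x := by
  have := h.disagreement_sq_mulVec_add_le t x id fun k => Or.inl rfl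
  simp at this
  exact le_of_sq_le_sq this (disagreement_nonneg _)

/-- If the values in `S` are at least `b` and the others at most `a`, then within `B` rounds an edge
joins `S` to its complement at a time at which its two ends still satisfy these bounds. -/
theorem exists_crossing (h : IsMixingNetwork G W η B) (t : ℕ) (x : ℕ → Fin n → ℝ)
    (hx : ∀ k, x (k + 1) = (W (t + k)).mulVec (x k)) (S : Set (Fin n)) {i j : Fin n} (hi : i ∈ S)
    (hj : j ∉ S) {a b : ℝ} (hb : ∀ i ∈ S, b ≤ x 0 i) (ha : ∀ j ∉ S, x 0 j ≤ a) :
    ∃ k < B, ∃ u ∈ S, ∃ l ∉ S, (G (t + k)).Adj u l ∧ b ≤ x k u ∧ x k l ≤ a := by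
  -- As long as the bounds hold, any edge across the cut would be one of those sought. Without it no
  -- weight crosses, so averaging preserves the bounds for the whole window, and the union of the
  -- graphs would be disconnected.
  by_contra! hcon
  have hind : ∀ k ≤ B, (∀ i ∈ S, b ≤ x k i) ∧ (∀ j ∉ S, x k j ≤ a) := by
    intro k
    induction k with
    | zero => exact fun _ => ⟨hb, ha⟩
    | succ k ih =>
      intro hk
      obtain ⟨ihb, iha⟩ := ih (by omega)
      have hno : ∀ u ∈ S, ∀ l ∉ S, ¬ (G (t + k)).Adj u l := fun u hu l hl hadj =>
        absurd (iha l hl) (not_le.2 (hcon k (by omega) u hu l hl hadj (ihb u hu)))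
      have hz : ∀ u ∈ S, ∀ l ∉ S, W (t + k) u l = 0 := fun u hu l hl =>
        h.weight_zero _ _ _ (fun e => hl (e ▸ hu)) (hno u hu l hl)
      have hconst : ∀ (c : ℝ) (u : Fin n), ∑ j, W (t + k) u j * c = c := fun c u => by
        rw [← Finset.sum_mul, h.row_sum, one_mul]
      refine ⟨fun u hu => ?_, fun l hl => ?_⟩
      · rw [hx, ← hconst b u]
        change _ ≤ ∑ j, W (t + k) u j * x k j
        refine Finset.sum_le_sum fun j _ => ?_
        by_cases hjS : j ∈ S
        · exact mul_le_mul_of_nonneg_left (ihb j hjS) (h.weight_nonneg _ _ _)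
        · simp [hz u hu j hjS]
      · rw [hx, ← hconst a l]
        change ∑ j, W (t + k) l j * x k j ≤ _
        refine Finset.sum_le_sum fun j _ => ?_
        by_cases hjS : j ∈ S
        · simp [h.symm (t + k) l j, hz j hjS l hl]
        · exact mul_le_mul_of_nonneg_left (iha j hjS) (h.weight_nonneg _ _ _)
  obtain ⟨p⟩ := (h.connected t).preconnected i j
  obtain ⟨d, -, hd1, hd2⟩ := p.exists_boundary_dart S hi hj
  have hadj := d.adj
  rw [SimpleGraph.iSup_adj] at hadj
  obtain ⟨k, hk⟩ := hadj
  obtain ⟨h1, h2⟩ := hind k k.2.le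
  exact absurd (h2 _ hd2) (not_le.2 (hcon k k.2 _ hd1 _ hd2 hk (h1 _ hd1)))

/-- Over `B` rounds the variance contracts by the factor `1 - η / (2 n²)`. -/
theorem disagreement_sq_window (h : IsMixingNetwork G W η B) (hn : 0 < n) (t : ℕ)
    (x : ℕ → Fin n → ℝ) (hx : ∀ k, x (k + 1) = (W (t + k)).mulVec (x k)) :
    disagreement (x B) ^ 2 ≤ (1 - η / (2 * (n : ℝ) ^ 2)) * disagreement (x 0) ^ 2 := by
  classical
  have hη := h.eta_pos
  have hn' : (0 : ℝ) < n := by exact_mod_cast hn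
  -- For each agent and round select the neighbour (or the agent itself) with the largest
  -- difference. This single term dominates every edge at the agent.
  have hex : ∀ (k : ℕ) (u : Fin n), ∃ l, (l = u ∨ (G (t + k)).Adj u l) ∧
      ∀ l', (G (t + k)).Adj u l' → |x k u - x k l'| ≤ |x k u - x k l| := by
    intro k u
    obtain ⟨l, hl, hmax⟩ := Finset.exists_max_image
      (Finset.univ.filter fun l => l = u ∨ (G (t + k)).Adj u l) (fun l => |x k u - x k l|)
      ⟨u, by simp⟩
    exact ⟨l, (Finset.mem_filter.1 hl).2, fun l' hl' => hmax l' (by simp [hl'])⟩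
  choose l hl hlmax using hex
  set δ : ℕ → Fin n → ℝ := fun k u => |x k u - x k (l k u)| with hδ
  have hdec : ∀ K, disagreement (x K) ^ 2 + η / 2 * ∑ k ∈ Finset.range K, ∑ u, δ k u ^ 2 ≤
      disagreement (x 0) ^ 2 := by
    intro K
    induction K with
    | zero => simp
    | succ K ih =>
      have := h.disagreement_sq_mulVec_add_le (t + K) (x K) (l K) (hl K)
      rw [← hx] at this
      rw [Finset.sum_range_succ, mul_add]
      simp only [hδ] at ih ⊢
      linarith
  have hne : (Finset.univ : Finset (Fin n)).Nonempty := ⟨⟨0, hn⟩, Finset.mem_univ _⟩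
  obtain ⟨iM, -, hM⟩ := Finset.exists_max_image Finset.univ (x 0) hne
  obtain ⟨im, -, hm⟩ := Finset.exists_min_image Finset.univ (x 0) hne
  set M := x 0 iM with hMdef
  set m := x 0 im with hmdef
  -- Cut the agents just above the value `x 0 i`. A crossing edge at agent `u` in round `k` makes
  -- the interval of length `δ k u` below `x k u` cover the gap from `x 0 i` to the next larger
  -- initial value.
  have hcross : ∀ i : Fin n, ∃ q : ℕ × Fin n, x 0 i < M → q.1 < B ∧
      ∀ c, x 0 i ≤ c → (∀ j, x 0 i < x 0 j → c < x 0 j) →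
        c ∈ Set.Icc (x q.1 q.2 - δ q.1 q.2) (x q.1 q.2) := by
    intro i
    by_cases hi : x 0 i < M
    · obtain ⟨j, hj, hjmin⟩ := Finset.exists_min_image (Finset.univ.filter fun j => x 0 i < x 0 j)
        (x 0) ⟨iM, by simpa using hi⟩
      simp only [Finset.mem_filter, Finset.mem_univ, true_and] at hj hjmin
      obtain ⟨k, hk, u, hu, v, hv, hadj, hbu, hav⟩ := h.exists_crossing t x hx
        {j | x 0 i < x 0 j} (i := iM) (j := i) hi (by simp) (a := x 0 i) (b := x 0 j)
        (fun r hr => hjmin r hr) (fun r hr => not_lt.1 hr)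
      refine ⟨(k, u), fun _ => ⟨hk, fun c hc1 hc2 => ⟨?_, (hc2 j hj).le.trans hbu⟩⟩⟩
      have h1 := hlmax k u v hadj
      have h2 := le_abs_self (x k u - x k v)
      simp only [hδ]
      linarith
    · exact ⟨(0, i), fun h => absurd h hi⟩
  choose q hq using hcross
  -- Being an image, `Q` counts once a pair that serves several gaps, and it has at most `n`
  -- elements whatever the value of `B`.
  set Q : Finset (ℕ × Fin n) := (Finset.univ.filter fun i => x 0 i < M).image q with hQ
  have hQcard : (Q.card : ℝ) ≤ n := by
    have : Q.card ≤ n := by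
      refine Finset.card_image_le.trans ((Finset.card_le_univ _).trans ?_)
      simp
    exact_mod_cast this
  have hQsub : Q ⊆ Finset.range B ×ˢ Finset.univ := by
    intro p hp
    obtain ⟨i, hi, rfl⟩ := Finset.mem_image.1 hp
    simp only [Finset.mem_filter, Finset.mem_univ, true_and] at hi
    simpa using (hq i hi).1
  have hcover : Set.Ico m M ⊆ ⋃ p ∈ Q, Set.Icc (x p.1 p.2 - δ p.1 p.2) (x p.1 p.2) := by
    intro c hc
    obtain ⟨i, hi, himax⟩ := Finset.exists_max_image (Finset.univ.filter fun j => x 0 j ≤ c)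
      (x 0) ⟨im, by simpa using hc.1⟩
    simp only [Finset.mem_filter, Finset.mem_univ, true_and] at hi himax
    have hiM : x 0 i < M := lt_of_le_of_lt hi hc.2
    refine Set.mem_biUnion (x := q i) (Finset.mem_image_of_mem q (by simpa using hiM)) ?_
    refine (hq i hiM).2 c hi fun j hj => ?_
    by_contra hle
    exact absurd (himax j (not_lt.1 hle)) (not_le.2 hj)
  have hδ0 : ∀ k u, 0 ≤ δ k u := fun k u => abs_nonneg _
  -- Comparing Lebesgue measures of a cover replaces any ordering of the gaps. With Cauchy-Schwarz
  -- over `Q` and `V ≤ n (M - m)²` for the initial variance sum `V`, this gives `∑ δ² ≥ V / n²`.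
  have hlen : M - m ≤ ∑ p ∈ Q, δ p.1 p.2 := by
    have h1 : volume (Set.Ico m M) ≤ ∑ p ∈ Q, volume (Set.Icc (x p.1 p.2 - δ p.1 p.2) (x p.1 p.2)) :=
      (measure_mono hcover).trans (measure_biUnion_finset_le _ _)
    simp only [Real.volume_Ico, Real.volume_Icc, sub_sub_cancel] at h1
    rw [← ENNReal.ofReal_sum_of_nonneg fun p _ => hδ0 _ _] at h1
    exact (ENNReal.ofReal_le_ofReal_iff (Finset.sum_nonneg fun p _ => hδ0 _ _)).1 h1
  have hmM : m ≤ M := hM im (Finset.mem_univ _)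
  have hsq : (M - m) ^ 2 ≤ n * ∑ k ∈ Finset.range B, ∑ u, δ k u ^ 2 := by
    calc (M - m) ^ 2 ≤ (∑ p ∈ Q, δ p.1 p.2) ^ 2 := pow_le_pow_left₀ (by linarith) hlen 2
      _ ≤ Q.card * ∑ p ∈ Q, δ p.1 p.2 ^ 2 := sq_sum_le_card_mul_sum_sq
      _ ≤ n * ∑ p ∈ Finset.range B ×ˢ Finset.univ, δ p.1 p.2 ^ 2 := by
          refine mul_le_mul hQcard (Finset.sum_le_sum_of_subset_of_nonneg hQsub
            fun _ _ _ => sq_nonneg _) (Finset.sum_nonneg fun _ _ => sq_nonneg _) hn'.le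
      _ = n * ∑ k ∈ Finset.range B, ∑ u, δ k u ^ 2 := by rw [Finset.sum_product]
  have hV : disagreement (x 0) ^ 2 ≤ n * (M - m) ^ 2 := by
    rw [disagreement_sq]
    have hmean : agentMean (x 0) * n = ∑ i, x 0 i := by
      rw [agentMean]; field_simp
    have hmean1 : agentMean (x 0) ≤ M := by
      have : ∑ i, x 0 i ≤ ∑ _i : Fin n, M := Finset.sum_le_sum fun i _ => hM i (Finset.mem_univ _)
      simp at this
      nlinarith
    have hmean2 : m ≤ agentMean (x 0) := by
      have : ∑ _i : Fin n, m ≤ ∑ i, x 0 i := Finset.sum_le_sum fun i _ => hm i (Finset.mem_univ _)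
      simp at this
      nlinarith
    calc ∑ i, (x 0 i - agentMean (x 0)) ^ 2 ≤ ∑ _i : Fin n, (M - m) ^ 2 := by
          refine Finset.sum_le_sum fun i _ => sq_le_sq.2 ?_
          rw [abs_of_nonneg (sub_nonneg.2 hmM), abs_le]
          constructor <;> linarith [hM i (Finset.mem_univ _), hm i (Finset.mem_univ _)]
      _ = n * (M - m) ^ 2 := by simp
  have hB := hdec B
  have hfin : η / (2 * (n : ℝ) ^ 2) * disagreement (x 0) ^ 2 ≤
      η / 2 * ∑ k ∈ Finset.range B, ∑ u, δ k u ^ 2 := by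
    rw [div_mul_eq_mul_div, div_le_iff₀ (by positivity)]
    nlinarith [mul_le_mul_of_nonneg_left hsq hn'.le, mul_le_mul_of_nonneg_left hV hη.le,
      mul_le_mul_of_nonneg_left (mul_le_mul_of_nonneg_left hsq hn'.le) hη.le]
  linarith

/-- With `q = η/(4n²)`, the variance factor `1 - 2q` is at most `(1 - q)²`. -/
theorem disagreement_window (h : IsMixingNetwork G W η B) (hn : 0 < n) (t : ℕ)
    (x : ℕ → Fin n → ℝ) (hx : ∀ k, x (k + 1) = (W (t + k)).mulVec (x k)) :
    disagreement (x B) ≤ (1 - η / (4 * (n : ℝ) ^ 2)) * disagreement (x 0) := by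
  have h1 := h.disagreement_sq_window hn t x hx
  have hn' : (1 : ℝ) ≤ n := by exact_mod_cast hn
  have hx1 : η / (4 * (n : ℝ) ^ 2) ≤ 1 := by
    rw [div_le_one (by positivity)]; nlinarith [h.eta_lt_one]
  refine le_of_sq_le_sq (h1.trans ?_) (mul_nonneg (by linarith) (disagreement_nonneg _))
  rw [mul_pow]
  refine mul_le_mul_of_nonneg_right ?_ (sq_nonneg _)
  have : η / (2 * (n : ℝ) ^ 2) = 2 * (η / (4 * (n : ℝ) ^ 2)) := by field_simp; ring
  rw [this]
  nlinarith [sq_nonneg (η / (4 * (n : ℝ) ^ 2))]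

/-- Perturbed averaging over `B` rounds. -/
theorem disagreement_perturbed_window (h : IsMixingNetwork G W η B) (hn : 0 < n) (t : ℕ)
    (y : ℕ → Fin n → ℝ) :
    disagreement (y (t + B)) ≤ (1 - η / (4 * (n : ℝ) ^ 2)) * disagreement (y t) +
      ∑ k ∈ Finset.range B, disagreement (y (t + k + 1) - (W (t + k)).mulVec (y (t + k))) := by
  -- Compare with unperturbed averaging from the same start. Averaging does not amplify
  -- disagreement, so the perturbations merely add up.
  set x : ℕ → Fin n → ℝ := fun k => Nat.rec (y t) (fun k z => (W (t + k)).mulVec z) k with hxdef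
  have hx : ∀ k, x (k + 1) = (W (t + k)).mulVec (x k) := fun k => rfl
  have hind : ∀ K, disagreement (y (t + K) - x K) ≤
      ∑ k ∈ Finset.range K, disagreement (y (t + k + 1) - (W (t + k)).mulVec (y (t + k))) := by
    intro K
    induction K with
    | zero => simp [hxdef, disagreement, agentMean]
    | succ K ih =>
      rw [Finset.sum_range_succ, hx]
      have : y (t + (K + 1)) - (W (t + K)).mulVec (x K) =
          (W (t + K)).mulVec (y (t + K) - x K) +
            (y (t + K + 1) - (W (t + K)).mulVec (y (t + K))) := by
        rw [Matrix.mulVec_sub]; abel_nf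
      rw [this]
      exact (disagreement_add_le _ _).trans
        (add_le_add ((h.disagreement_mulVec_le _ _).trans ih) le_rfl)
  have h1 := h.disagreement_window hn t x hx
  have h2 := disagreement_add_le (x B) (y (t + B) - x B)
  rw [add_sub_cancel] at h2
  have h3 : x 0 = y t := rfl
  rw [h3] at h1
  linarith [hind B]

/-- `D(Γ, ρ)` dominates the accumulated effect of unit perturbations. -/
theorem le_netD (h : IsMixingNetwork G W η B) (hn : 0 < n) :
    B / (η / (4 * (n : ℝ) ^ 2)) ≤ netD n η B := by
  have hη := h.eta_pos
  have hη1 := h.eta_lt_one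
  have hn' : (1 : ℝ) ≤ n := by exact_mod_cast hn
  have hB : (1 : ℝ) ≤ B := by exact_mod_cast h.B_pos
  unfold netD netGamma netRho
  set x := η / (4 * (n : ℝ) ^ 2) with hxdef
  have hx0 : 0 < x := by positivity
  have hx1 : x ≤ 1 / 4 := by
    rw [hxdef, div_le_iff₀ (by positivity)]; nlinarith
  have hpos : 0 < 1 - x := by linarith
  -- Since `e^u ≥ 1 + u`, the left side is at most `-log(1 - x)/B`. The factor 2 lost in the
  -- logarithm is recovered from `1 + Γ ≥ 2`.
  have hρ : 1 - (1 - x) ^ (1 / (B : ℝ)) ≤ 2 * x / B := by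
    have h1 : 1 + Real.log (1 - x) * (1 / (B : ℝ)) ≤ (1 - x) ^ (1 / (B : ℝ)) := by
      rw [Real.rpow_def_of_pos hpos]
      linarith [Real.add_one_le_exp (Real.log (1 - x) * (1 / (B : ℝ)))]
    have h2 : -(2 * x) ≤ Real.log (1 - x) := by
      refine le_trans ?_ (Real.one_sub_inv_le_log_of_pos hpos)
      have : (1 - x)⁻¹ ≤ 1 + 2 * x := by
        rw [inv_le_iff_one_le_mul₀ hpos]; nlinarith
      linarith
    have h3 := mul_le_mul_of_nonneg_right h2 (by positivity : 0 ≤ 1 / (B : ℝ))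
    have h4 : 2 * x / B = 2 * x * (1 / (B : ℝ)) := by ring
    rw [h4]; linarith
  have hρ1 : (1 - x) ^ (1 / (B : ℝ)) < 1 :=
    Real.rpow_lt_one hpos.le (by linarith) (by positivity)
  have hΓ : 1 ≤ ((1 - x) ^ 2)⁻¹ := by
    refine (one_le_inv₀ (by positivity)).2 ?_
    nlinarith
  rw [div_le_div_iff₀ hx0 (by linarith)]
  have h5 : B * (1 - (1 - x) ^ (1 / (B : ℝ))) ≤ 2 * x := by
    have := mul_le_mul_of_nonneg_left hρ (by linarith : (0 : ℝ) ≤ B)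
    rwa [mul_div_cancel₀ _ (by positivity)] at this
  nlinarith

end IsMixingNetwork

end Network

/-! ### Stochastic matrices: stationary distributions and contraction of the span -/

section Stochastic

variable {S : Type*} [Fintype S] [DecidableEq S] {P : Matrix S S ℝ}

/-- A stochastic matrix has a stationary distribution. -/
theorem exists_stationary_of_mem_rowStochastic [Nonempty S] (hP : P ∈ Matrix.rowStochastic ℝ S) :
    ∃ ξ : S → ℝ, (∀ s, 0 ≤ ξ s) ∧ ∑ s, ξ s = 1 ∧ Matrix.vecMul ξ P = ξ := by
  have hdet : (P - 1).det = 0 := by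
    refine Matrix.exists_mulVec_eq_zero_iff.1 ⟨1, one_ne_zero, ?_⟩
    rw [Matrix.sub_mulVec, Matrix.one_mulVec, Matrix.one_vecMul_of_mem_rowStochastic hP, sub_self]
  obtain ⟨x, hx0, hx⟩ := Matrix.exists_vecMul_eq_zero_iff.2 hdet
  rw [Matrix.vecMul_sub, Matrix.vecMul_one, sub_eq_zero] at hx
  -- An invariant vector may change sign. Its absolute value is subinvariant, and since `P`
  -- preserves total mass every inequality is an equality.
  set y : S → ℝ := fun s => |x s| with hy
  have hle : ∀ s, y s ≤ Matrix.vecMul y P s := by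
    intro s
    have : x s = ∑ u, x u * P u s := (congrFun hx s).symm
    simp only [hy]
    calc |x s| = |∑ u, x u * P u s| := by rw [← this]
      _ ≤ ∑ u, |x u * P u s| := Finset.abs_sum_le_sum_abs _ _
      _ = ∑ u, |x u| * P u s := Finset.sum_congr rfl fun u _ => by
          rw [abs_mul, abs_of_nonneg (Matrix.nonneg_of_mem_rowStochastic hP)]
  have hsum : ∑ s, Matrix.vecMul y P s = ∑ s, y s := by
    simp only [Matrix.vecMul, dotProduct]
    rw [Finset.sum_comm]
    simp only [← Finset.mul_sum, Matrix.sum_row_of_mem_rowStochastic hP, mul_one]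
  have heq : ∀ s, y s = Matrix.vecMul y P s := fun s =>
    (Finset.sum_eq_sum_iff_of_le fun s _ => hle s).1 hsum.symm s (Finset.mem_univ s)
  have hpos : 0 < ∑ s, y s := by
    obtain ⟨s, hs⟩ := Function.ne_iff.1 hx0
    exact Finset.sum_pos' (fun s _ => abs_nonneg _) ⟨s, Finset.mem_univ _, abs_pos.2 hs⟩
  refine ⟨(∑ s, y s)⁻¹ • y, fun s => mul_nonneg (inv_nonneg.2 hpos.le) (abs_nonneg _), ?_, ?_⟩
  · simp only [Pi.smul_apply, smul_eq_mul, ← Finset.mul_sum]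
    exact inv_mul_cancel₀ hpos.ne'
  · rw [Matrix.smul_vecMul]
    congr 1
    funext s
    exact (heq s).symm

/-- A stochastic matrix does not increase the span of a function. -/
theorem mulVec_sub_le_of_mem_rowStochastic (hP : P ∈ Matrix.rowStochastic ℝ S) {f : S → ℝ} {d : ℝ}
    (hf : ∀ s s', f s - f s' ≤ d) (s s' : S) : P.mulVec f s - P.mulVec f s' ≤ d := by
  have h1 : ∀ u, P.mulVec f s ≤ f u + d := fun u => by
    calc P.mulVec f s = ∑ r, P s r * f r := rfl
      _ ≤ ∑ r, P s r * (f u + d) := Finset.sum_le_sum fun r _ =>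
          mul_le_mul_of_nonneg_left (by linarith [hf r u]) (Matrix.nonneg_of_mem_rowStochastic hP)
      _ = f u + d := by rw [← Finset.sum_mul, Matrix.sum_row_of_mem_rowStochastic hP, one_mul]
  have h2 : P.mulVec f s - d ≤ P.mulVec f s' := by
    calc P.mulVec f s - d = ∑ r, P s' r * (P.mulVec f s - d) := by
          rw [← Finset.sum_mul, Matrix.sum_row_of_mem_rowStochastic hP, one_mul]
      _ ≤ ∑ r, P s' r * f r := Finset.sum_le_sum fun r _ =>
          mul_le_mul_of_nonneg_left (by linarith [h1 r]) (Matrix.nonneg_of_mem_rowStochastic hP)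
  linarith

/-- A stochastic matrix whose rows are within total variation distance `1/4` of a common vector
halves the span of every function. -/
theorem mulVec_sub_le_half (hP : P ∈ Matrix.rowStochastic ℝ S) {ξ : S → ℝ}
    (hmix : ∀ s, (1 / 2) * ∑ s', |P s s' - ξ s'| ≤ 1 / 4) {f : S → ℝ} {d : ℝ}
    (hf : ∀ s s', f s - f s' ≤ d) (s s' : S) : P.mulVec f s - P.mulVec f s' ≤ d / 2 := by
  have hne : (Finset.univ : Finset S).Nonempty := ⟨s, Finset.mem_univ s⟩
  obtain ⟨sM, -, hM⟩ := Finset.exists_max_image Finset.univ f hne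
  obtain ⟨sm, -, hm⟩ := Finset.exists_min_image Finset.univ f hne
  -- Centring at the midrange bounds `|f - c|` by `d/2`, while two rows differ by at most 1 in ℓ¹,
  -- each being within 1/2 of `ξ`.
  set c := (f sM + f sm) / 2 with hc
  have hd := hf sM sm
  have hd0 : 0 ≤ d := by linarith [hf s s]
  have hfc : ∀ u, |f u - c| ≤ d / 2 := fun u => by
    rw [abs_le]
    constructor <;> linarith [hM u (Finset.mem_univ _), hm u (Finset.mem_univ _)]
  have hl1 : ∑ u, |P s u - P s' u| ≤ 1 := by
    calc ∑ u, |P s u - P s' u| ≤ ∑ u, (|P s u - ξ u| + |P s' u - ξ u|) :=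
          Finset.sum_le_sum fun u _ => by
            rw [abs_sub_comm (P s' u)]; exact abs_sub_le _ _ _
      _ ≤ 1 := by
          rw [Finset.sum_add_distrib]; linarith [hmix s, hmix s']
  calc P.mulVec f s - P.mulVec f s' = ∑ u, (P s u - P s' u) * (f u - c) := by
        simp only [Matrix.mulVec, dotProduct, sub_mul, mul_sub, Finset.sum_sub_distrib,
          ← Finset.sum_mul, Matrix.sum_row_of_mem_rowStochastic hP]
        ring
    _ ≤ ∑ u, |P s u - P s' u| * (d / 2) := Finset.sum_le_sum fun u _ =>
        (le_abs_self _).trans (by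
          rw [abs_mul]; exact mul_le_mul_of_nonneg_left (hfc u) (abs_nonneg _))
    _ ≤ 1 * (d / 2) := by
        rw [← Finset.sum_mul]; exact mul_le_mul_of_nonneg_right hl1 (by linarith)
    _ = d / 2 := one_mul _

/-- Convergence of a chain whose `t`-step transition matrix mixes. -/
theorem tendsto_pow_mulVec (hP : P ∈ Matrix.rowStochastic ℝ S) {ξ : S → ℝ}
    (hξ0 : ∀ s, 0 ≤ ξ s) (hξ1 : ∑ s, ξ s = 1) (hξ : Matrix.vecMul ξ P = ξ) {t : ℕ}
    (hmix : ∀ s, (1 / 2) * ∑ s', |(P ^ t) s s' - ξ s'| ≤ 1 / 4) (f : S → ℝ) (s : S) :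
    Tendsto (fun k => (P ^ k).mulVec f s) atTop (𝓝 (∑ u, ξ u * f u)) := by
  have hne : (Finset.univ : Finset S).Nonempty := ⟨s, Finset.mem_univ s⟩
  obtain ⟨sM, -, hM⟩ := Finset.exists_max_image Finset.univ f hne
  obtain ⟨sm, -, hm⟩ := Finset.exists_min_image Finset.univ f hne
  set d := f sM - f sm with hd
  have hspan0 : ∀ s s', f s - f s' ≤ d := fun s s' => by
    linarith [hM s (Finset.mem_univ _), hm s' (Finset.mem_univ _)]
  -- Each block of `t` steps halves the span. The `ξ`-mean is invariant, so it is the limit.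
  have hspan : ∀ j : ℕ, ∀ s s', (P ^ (t * j)).mulVec f s - (P ^ (t * j)).mulVec f s' ≤
      d / 2 ^ j := by
    intro j
    induction j with
    | zero => simpa using hspan0
    | succ j ih =>
      intro s s'
      have := mulVec_sub_le_half (pow_mem hP t) hmix ih s s'
      rw [Matrix.mulVec_mulVec, ← pow_add, add_comm t, ← Nat.mul_succ] at this
      rwa [pow_succ, ← div_div]
  have hspan' : ∀ j k : ℕ, t * j ≤ k → ∀ s s', (P ^ k).mulVec f s - (P ^ k).mulVec f s' ≤
      d / 2 ^ j := by
    intro j k hk s s'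
    have := mulVec_sub_le_of_mem_rowStochastic (pow_mem hP (k - t * j)) (hspan j) s s'
    rwa [Matrix.mulVec_mulVec, ← pow_add, Nat.sub_add_cancel hk] at this
  have hinv : ∀ k, ∑ u, ξ u * (P ^ k).mulVec f u = ∑ u, ξ u * f u := by
    intro k
    have h1 : Matrix.vecMul ξ (P ^ k) = ξ := by
      induction k with
      | zero => simp
      | succ k ih => rw [pow_succ, ← Matrix.vecMul_vecMul, ih, hξ]
    change ξ ⬝ᵥ (P ^ k).mulVec f = ξ ⬝ᵥ f
    rw [Matrix.dotProduct_mulVec, h1]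
  have hclose : ∀ j k : ℕ, t * j ≤ k → |(P ^ k).mulVec f s - ∑ u, ξ u * f u| ≤ d / 2 ^ j := by
    intro j k hk
    have h1 : (P ^ k).mulVec f s - ∑ u, ξ u * f u =
        ∑ u, ξ u * ((P ^ k).mulVec f s - (P ^ k).mulVec f u) := by
      simp only [mul_sub, Finset.sum_sub_distrib, ← Finset.sum_mul, hξ1, one_mul, hinv]
    rw [h1]
    calc |∑ u, ξ u * ((P ^ k).mulVec f s - (P ^ k).mulVec f u)|
        ≤ ∑ u, |ξ u * ((P ^ k).mulVec f s - (P ^ k).mulVec f u)| := Finset.abs_sum_le_sum_abs _ _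
      _ ≤ ∑ u, ξ u * (d / 2 ^ j) := Finset.sum_le_sum fun u _ => by
          rw [abs_mul, abs_of_nonneg (hξ0 u)]
          refine mul_le_mul_of_nonneg_left (abs_le.2 ⟨?_, hspan' j k hk s u⟩) (hξ0 u)
          linarith [hspan' j k hk u s]
      _ = d / 2 ^ j := by rw [← Finset.sum_mul, hξ1, one_mul]
  have hlim : Tendsto (fun j : ℕ => d / 2 ^ j) atTop (𝓝 0) := by
    have := (tendsto_pow_atTop_nhds_zero_of_lt_one (r := (1 / 2 : ℝ)) (by norm_num)
      (by norm_num)).const_mul d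
    simpa [div_eq_mul_inv] using this
  rw [Metric.tendsto_atTop]
  intro ε hε
  obtain ⟨j, hj⟩ := ((tendsto_order.1 hlim).2 ε hε).exists
  exact ⟨t * j, fun k hk => lt_of_le_of_lt (hclose j k hk) hj⟩

end Stochastic

/-! ### Average reward, the Bellman equation and occupancy measures -/

namespace TeamMDP

variable {n : ℕ} {S A : Type*} [Fintype S] (M : TeamMDP n S A)

theorem localReward_nonneg (i : Fin n) (s : S) (a : A) : 0 ≤ M.localReward i s a :=
  Finset.sum_nonneg fun _ _ => mul_nonneg (M.p_nonneg _ _ _) (M.reward_nonneg _ _ _ _)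

theorem localReward_le_one (i : Fin n) (s : S) (a : A) : M.localReward i s a ≤ 1 := by
  rw [← M.p_sum s a]
  exact Finset.sum_le_sum fun _ _ =>
    mul_le_of_le_one_right (M.p_nonneg _ _ _) (M.reward_le_one _ _ _ _)

theorem teamReward_nonneg (s : S) (a : A) : 0 ≤ M.teamReward s a :=
  mul_nonneg (by positivity) (Finset.sum_nonneg fun _ _ => M.localReward_nonneg _ _ _)

theorem teamReward_le_one (s : S) (a : A) : M.teamReward s a ≤ 1 := by
  unfold teamReward
  have h : ∑ i, M.localReward i s a ≤ n := by
    calc ∑ i, M.localReward i s a ≤ ∑ _i : Fin n, (1 : ℝ) :=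
          Finset.sum_le_sum fun i _ => M.localReward_le_one i s a
      _ = n := by simp
  rw [one_div_mul_eq_div]
  exact div_le_one_of_le₀ h (Nat.cast_nonneg n)

variable {M}

/-- The suboptimality of an action relative to a solution of the Bellman equation. -/
noncomputable def advantage (M : TeamMDP n S A) (l : ℝ) (v : S → ℝ) (s : S) (a : A) : ℝ :=
  l + v s - M.teamReward s a - ∑ s', M.p s a s' * v s'

theorem SolvesBellman.advantage_nonneg {l : ℝ} {v : S → ℝ} (h : M.SolvesBellman l v) (s : S)
    (a : A) : 0 ≤ M.advantage l v s a := by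
  have := (h s).2 ⟨a, rfl⟩
  unfold advantage
  linarith

variable [Fintype A]

theorem sum_chain_mul (pol : S → A → ℝ) (f : S → ℝ) (s : S) :
    ∑ s', M.chain pol s s' * f s' = ∑ a, pol s a * ∑ s', M.p s a s' * f s' := by
  simp only [chain, Matrix.of_apply, Finset.sum_mul, Finset.mul_sum]
  rw [Finset.sum_comm]
  simp only [mul_assoc]

/-- Under an occupancy measure, the mean suboptimality is the loss of average reward. -/
theorem IsOccupancy.sum_mul_advantage {μ : S → A → ℝ} (hμ : M.IsOccupancy μ) (l : ℝ) (v : S → ℝ) :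
    ∑ s, ∑ a, μ s a * M.advantage l v s a = l - ∑ s, ∑ a, μ s a * M.teamReward s a := by
  have hflow : ∑ s, ∑ a, μ s a * ∑ s', M.p s a s' * v s' = ∑ s, ∑ a, μ s a * v s := by
    calc ∑ s, ∑ a, μ s a * ∑ s', M.p s a s' * v s'
        = ∑ s, ∑ a, ∑ s', M.p s a s' * μ s a * v s' := by
          simp only [Finset.mul_sum]
          exact Finset.sum_congr rfl fun s _ => Finset.sum_congr rfl fun a _ =>
            Finset.sum_congr rfl fun s' _ => by ring
      _ = ∑ s', ∑ s, ∑ a, M.p s a s' * μ s a * v s' := by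
          exact (Finset.sum_congr rfl fun _ _ => Finset.sum_comm).trans Finset.sum_comm
      _ = ∑ s', ∑ a, μ s' a * v s' := Finset.sum_congr rfl fun s' _ => by
          simp only [← Finset.sum_mul]; rw [hμ.2.2 s']
  have h1 : ∀ s a, μ s a * M.advantage l v s a = μ s a * l + μ s a * v s -
      μ s a * M.teamReward s a - μ s a * ∑ s', M.p s a s' * v s' := fun s a => by
    unfold advantage; ring
  simp only [h1, Finset.sum_sub_distrib, Finset.sum_add_distrib, hflow, ← Finset.sum_mul]
  rw [hμ.2.1]
  ring

/-- A stationary distribution and its policy define an occupancy measure. -/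
theorem IsStationary.isOccupancy {pol : S → A → ℝ} (hpol : IsPolicy pol) {ξ : S → ℝ}
    (hξ : M.IsStationary pol ξ) : M.IsOccupancy fun s a => ξ s * pol s a := by
  refine ⟨fun s a => mul_nonneg (hξ.1 s) ((hpol s).1 a), ?_, fun s' => ?_⟩
  · simp only [← Finset.mul_sum, (hpol _).2, mul_one, hξ.2.1]
  · simp only [← Finset.mul_sum, (hpol _).2, mul_one]
    conv_lhs => rw [← hξ.2.2]
    simp only [Matrix.vecMul, dotProduct, chain, Matrix.of_apply, Finset.mul_sum]
    exact Finset.sum_congr rfl fun s _ => Finset.sum_congr rfl fun a _ => by ring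

/-- The deterministic policy that attains the maximum in the Bellman equation. -/
theorem SolvesBellman.exists_greedy [DecidableEq A] {l : ℝ} {v : S → ℝ} (h : M.SolvesBellman l v) :
    ∃ g : S → A, IsPolicy (fun s a => if a = g s then (1 : ℝ) else 0) ∧
      ∀ s, M.advantage l v s (g s) = 0 := by
  choose g hg using fun s => (h s).1
  refine ⟨g, fun s => ⟨fun a => by positivity, by simp⟩, fun s => ?_⟩
  have := hg s
  simp only at this
  unfold advantage
  linarith

/-- Every occupancy measure is a stationary distribution combined with a policy. -/
theorem IsOccupancy.exists_policy [Nonempty A] {μ : S → A → ℝ} (hμ : M.IsOccupancy μ) :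
    ∃ pol, IsPolicy pol ∧ M.IsStationary pol fun s => ∑ a, μ s a := by
  classical
  obtain ⟨a₀⟩ := ‹Nonempty A›
  -- At a state of mass zero there is no conditional law; the action taken there is immaterial.
  set pol : S → A → ℝ := fun s a =>
    if ∑ b, μ s b = 0 then (if a = a₀ then 1 else 0) else μ s a / ∑ b, μ s b with hpoldef
  have hm0 : ∀ s, 0 ≤ ∑ b, μ s b := fun s => Finset.sum_nonneg fun b _ => hμ.1 s b
  have hpol : IsPolicy pol := by
    intro s
    by_cases h : ∑ b, μ s b = 0
    · simp only [hpoldef, h, if_true]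
      exact ⟨fun a => by positivity, by simp⟩
    · simp only [hpoldef, h, if_false]
      exact ⟨fun a => div_nonneg (hμ.1 s a) (hm0 s), by rw [← Finset.sum_div, div_self h]⟩
  have hmul : ∀ s a, (∑ b, μ s b) * pol s a = μ s a := by
    intro s a
    by_cases h : ∑ b, μ s b = 0
    · rw [h, zero_mul]
      exact ((Finset.sum_eq_zero_iff_of_nonneg fun b _ => hμ.1 s b).1 h a (Finset.mem_univ a)).symm
    · simp only [hpoldef, h, if_false]
      exact mul_div_cancel₀ _ h
  refine ⟨pol, hpol, hm0, hμ.2.1, ?_⟩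
  funext s'
  rw [hμ.2.2 s']
  simp only [Matrix.vecMul, dotProduct, chain, Matrix.of_apply]
  refine Finset.sum_congr rfl fun s _ => ?_
  rw [Finset.mul_sum]
  exact Finset.sum_congr rfl fun a _ => by rw [← mul_assoc, hmul, mul_comm]

/-- Thus `μ*` lies in `𝒰`, and projecting onto `𝒰` never increases the divergence from it. -/
theorem IsTauStationary.mem_occSet [Nonempty A] {τ : ℝ} (h : M.IsTauStationary τ) {μ : S → A → ℝ}
    (hμ : M.IsOccupancy μ) : μ ∈ occSet S A τ := by
  obtain ⟨pol, hpol, hst⟩ := hμ.exists_policy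
  exact ⟨hμ.1, hμ.2.1, fun s => (h.2 pol _ hpol hst s).1⟩

variable [DecidableEq S]

theorem chain_mem_rowStochastic {pol : S → A → ℝ} (hpol : IsPolicy pol) :
    M.chain pol ∈ Matrix.rowStochastic ℝ S := by
  rw [Matrix.mem_rowStochastic_iff_sum]
  refine ⟨fun s s' => Finset.sum_nonneg fun a _ => mul_nonneg ((hpol s).1 a) (M.p_nonneg _ _ _),
    fun s => ?_⟩
  have := sum_chain_mul (M := M) pol (fun _ => 1) s
  simpa [M.p_sum, (hpol s).2] using this

theorem exists_isStationary [Nonempty S] {pol : S → A → ℝ} (hpol : IsPolicy pol) :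
    ∃ ξ, M.IsStationary pol ξ :=
  exists_stationary_of_mem_rowStochastic (chain_mem_rowStochastic hpol)

theorem IsMixing.hasAvgReward {tmix : ℝ} (hM : M.IsMixing tmix) {pol : S → A → ℝ}
    (hpol : IsPolicy pol) {ξ : S → ℝ} (hξ : M.IsStationary pol ξ) :
    M.HasAvgReward pol (∑ s, ∑ a, ξ s * pol s a * M.teamReward s a) := by
  intro s
  obtain ⟨t, -, -, hmix⟩ := hM pol ξ hpol hξ
  have h := (tendsto_pow_mulVec (chain_mem_rowStochastic hpol) hξ.1 hξ.2.1 hξ.2.2 hmix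
    (M.policyReward pol) s).cesaro
  simpa [policyReward, Finset.mul_sum, mul_assoc] using h

theorem IsMixing.one_le [Nonempty S] {tmix : ℝ} (hM : M.IsMixing tmix) {pol : S → A → ℝ}
    (hpol : IsPolicy pol) : 1 ≤ tmix := by
  obtain ⟨ξ, hξ⟩ := exists_isStationary (M := M) hpol
  obtain ⟨t, ht, ht', -⟩ := hM pol ξ hpol hξ
  exact le_trans (by exact_mod_cast ht) ht'

/-- The loss of average reward of an average of policies that are conditionals of measures in
`occSet` is at most `τ` times the average of their suboptimalities. -/
theorem exists_hasAvgReward_of_average [Nonempty S] {tmix τ : ℝ} (hM : M.IsMixing tmix)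
    (hτ : M.IsTauStationary τ) {l : ℝ} {v : S → ℝ} (hv : M.SolvesBellman l v) {T : ℕ} (hT : 1 ≤ T)
    (μ : ℕ → S → A → ℝ) (hμ : ∀ t, μ t ∈ occSet S A τ) {δ : ℝ}
    (hδ : (1 / (T : ℝ)) * ∑ t ∈ Finset.Icc 1 T, ∑ s, ∑ a, μ t s a * M.advantage l v s a ≤ δ) :
    ∃ r, M.HasAvgReward (fun s a => (1 / (T : ℝ)) *
      ∑ t ∈ Finset.Icc 1 T, μ t s a / ∑ a', μ t s a') r ∧ l - τ * δ ≤ r := by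
  set pol : S → A → ℝ := fun s a => (1 / (T : ℝ)) *
      ∑ t ∈ Finset.Icc 1 T, μ t s a / ∑ a', μ t s a' with hpoldef
  have hT0 : (0 : ℝ) < T := by exact_mod_cast hT
  have hcard : (0 : ℝ) < Fintype.card S := by exact_mod_cast Fintype.card_pos
  have hτ1 := hτ.1
  have hsτ : 0 < √τ := Real.sqrt_pos.2 (by linarith)
  have hmpos : ∀ t s, 0 < ∑ a, μ t s a := fun t s =>
    lt_of_lt_of_le (by positivity) ((hμ t).2.2 s)
  have hpol : IsPolicy pol := by
    intro s
    refine ⟨fun a => mul_nonneg (by positivity) (Finset.sum_nonneg fun t _ =>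
      div_nonneg ((hμ t).1 s a) (hmpos t s).le), ?_⟩
    simp only [hpoldef, ← Finset.mul_sum]
    rw [Finset.sum_comm]
    simp only [← Finset.sum_div, div_self (hmpos _ s).ne']
    simp
    field_simp
  obtain ⟨ξ, hξ⟩ := exists_isStationary (M := M) hpol
  refine ⟨_, hM.hasAvgReward hpol hξ, ?_⟩
  have h1 := (hξ.isOccupancy hpol).sum_mul_advantage l v
  -- The factor `τ` is the ratio of `√τ/|S|`, the upper bound for `ξ`, to `1/(√τ|S|)`, the floor of
  -- the marginals in `𝒰`. Nonnegative advantages allow a termwise comparison.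
  have hterm : ∀ t s a, ξ s * (μ t s a / ∑ a', μ t s a') * M.advantage l v s a ≤
      τ * (μ t s a * M.advantage l v s a) := by
    intro t s a
    have h2 : ξ s ≤ τ * ∑ a', μ t s a' := by
      refine (hτ.2 pol ξ hpol hξ s).2.trans ?_
      refine le_trans (le_of_eq ?_) (mul_le_mul_of_nonneg_left ((hμ t).2.2 s) (by linarith))
      rw [mul_one_div, div_eq_div_iff (by positivity) (by positivity)]
      nlinarith [Real.mul_self_sqrt (by linarith : 0 ≤ τ)]
    rw [← mul_assoc]
    refine mul_le_mul_of_nonneg_right ?_ (hv.advantage_nonneg s a)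
    rw [mul_div_assoc', div_le_iff₀ (hmpos t s)]
    nlinarith [(hμ t).1 s a]
  have h3 : ∑ s, ∑ a, ξ s * pol s a * M.advantage l v s a ≤ τ * δ := by
    calc ∑ s, ∑ a, ξ s * pol s a * M.advantage l v s a
        = (1 / (T : ℝ)) * ∑ t ∈ Finset.Icc 1 T, ∑ s, ∑ a,
            ξ s * (μ t s a / ∑ a', μ t s a') * M.advantage l v s a := by
          symm
          simp only [hpoldef, Finset.mul_sum, Finset.sum_mul]
          refine Finset.sum_comm.trans (Finset.sum_congr rfl fun s _ => ?_)
          refine Finset.sum_comm.trans (Finset.sum_congr rfl fun a _ => ?_)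
          exact Finset.sum_congr rfl fun t _ => by ring
      _ ≤ (1 / (T : ℝ)) * ∑ t ∈ Finset.Icc 1 T, ∑ s, ∑ a,
            τ * (μ t s a * M.advantage l v s a) := by
          refine mul_le_mul_of_nonneg_left ?_ (by positivity)
          exact Finset.sum_le_sum fun t _ => Finset.sum_le_sum fun s _ =>
            Finset.sum_le_sum fun a _ => hterm t s a
      _ = τ * ((1 / (T : ℝ)) * ∑ t ∈ Finset.Icc 1 T, ∑ s, ∑ a,
            μ t s a * M.advantage l v s a) := by
          simp only [← Finset.mul_sum]; ring
      _ ≤ τ * δ := mul_le_mul_of_nonneg_left hδ (by linarith)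
  linarith

variable [DecidableEq A]

/-- The optimal occupancy measure attains the constant of the Bellman equation. -/
theorem SolvesBellman.le_sum_mul_teamReward [Nonempty S] {l : ℝ} {v : S → ℝ}
    (h : M.SolvesBellman l v) {μ : S → A → ℝ} (hμ : M.IsOptOccupancy μ) :
    l ≤ ∑ s, ∑ a, μ s a * M.teamReward s a := by
  -- The greedy policy has zero advantage, so its occupancy measure attains exactly `l`.
  obtain ⟨g, hpol, hg⟩ := h.exists_greedy
  obtain ⟨ξ, hξ⟩ := exists_isStationary (M := M) hpol
  have hocc := hξ.isOccupancy hpol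
  have h1 := hocc.sum_mul_advantage l v
  have h2 : ∑ s, ∑ a, ξ s * (if a = g s then (1 : ℝ) else 0) * M.advantage l v s a = 0 :=
    Finset.sum_eq_zero fun s _ => Finset.sum_eq_zero fun a _ => by
      by_cases ha : a = g s
      · simp [ha, hg]
      · simp [ha]
  have h3 := hμ.2 _ hocc
  linarith

/-- The normalized solution of the Bellman equation is bounded by twice the mixing time. -/
theorem SolvesBellman.abs_le {l : ℝ} {v : S → ℝ} (h : M.SolvesBellman l v) {tmix : ℝ}
    (hM : M.IsMixing tmix) {ξ : S → ℝ} (hξ0 : ∀ s, 0 ≤ ξ s) (hξ1 : ∑ s, ξ s = 1)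
    (hξv : ∑ s, v s * ξ s = 0) (s : S) : |v s| ≤ 2 * tmix := by
  have : Nonempty S := ⟨s⟩
  obtain ⟨g, hpol, hg⟩ := h.exists_greedy
  obtain ⟨ζ, hζ⟩ := exists_isStationary (M := M) hpol
  obtain ⟨t, -, ht, hmix⟩ := hM _ ζ hpol hζ
  set P := M.chain fun s a => if a = g s then (1 : ℝ) else 0 with hPdef
  have hP : P ∈ Matrix.rowStochastic ℝ S := chain_mem_rowStochastic hpol
  set c : S → ℝ := fun s => M.teamReward s (g s) - l with hc
  have hv : v = c + P.mulVec v := by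
    funext s
    have h1 : P.mulVec v s = ∑ s', M.p s (g s) s' * v s' := by
      change ∑ s', P s s' * v s' = _
      rw [hPdef, sum_chain_mul]
      simp
    have h2 := hg s
    unfold advantage at h2
    simp only [Pi.add_apply, h1, hc]
    linarith
  -- Unrolling `v = c + P v` costs at most 1 in span per step, the rewards lying in `[0,1]`. At the
  -- mixing step `t ≤ tmix` of the greedy chain the remaining term has at most half the span, so the
  -- span is at most `2 tmix`.
  have hspan : ∀ k : ℕ, ∀ s s', v s - v s' ≤ k + ((P ^ k).mulVec v s - (P ^ k).mulVec v s') := by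
    intro k
    induction k with
    | zero => intro s s'; simp
    | succ k ih =>
      intro s s'
      have h1 : (P ^ k).mulVec v = (P ^ k).mulVec c + (P ^ (k + 1)).mulVec v := by
        conv_lhs => rw [hv]
        rw [Matrix.mulVec_add, Matrix.mulVec_mulVec, ← pow_succ]
      have h2 : (P ^ k).mulVec c s - (P ^ k).mulVec c s' ≤ 1 :=
        mulVec_sub_le_of_mem_rowStochastic (pow_mem hP k) (fun u u' => by
          simp only [hc]
          linarith [M.teamReward_le_one u (g u), M.teamReward_nonneg u' (g u')]) s s'
      have h3 := ih s s'
      rw [h1] at h3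
      simp only [Pi.add_apply] at h3
      push_cast
      linarith
  obtain ⟨sM, -, hmax⟩ := Finset.exists_max_image Finset.univ v ⟨s, Finset.mem_univ s⟩
  obtain ⟨sm, -, hmin⟩ := Finset.exists_min_image Finset.univ v ⟨s, Finset.mem_univ s⟩
  have hd : ∀ s s', v s - v s' ≤ v sM - v sm := fun s s' => by
    linarith [hmax s (Finset.mem_univ _), hmin s' (Finset.mem_univ _)]
  have h1 := mulVec_sub_le_half (pow_mem hP t) hmix hd sM sm
  have h2 := hspan t sM sm
  have hd2 : ∀ s s', v s - v s' ≤ 2 * tmix := fun s s' => by linarith [hd s s']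
  have hvs : v s = ∑ u, ξ u * (v s - v u) := by
    simp only [mul_sub, Finset.sum_sub_distrib, ← Finset.sum_mul, hξ1, one_mul]
    simp only [mul_comm (v _)] at hξv
    rw [hξv, sub_zero]
  rw [hvs]
  calc |∑ u, ξ u * (v s - v u)| ≤ ∑ u, |ξ u * (v s - v u)| := Finset.abs_sum_le_sum_abs _ _
    _ ≤ ∑ u, ξ u * (2 * tmix) := Finset.sum_le_sum fun u _ => by
        rw [abs_mul, abs_of_nonneg (hξ0 u)]
        exact mul_le_mul_of_nonneg_left (_root_.abs_le.2 ⟨by linarith [hd2 u s], hd2 s u⟩) (hξ0 u)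
    _ = 2 * tmix := by rw [← Finset.sum_mul, hξ1, one_mul]

end TeamMDP

/-- The invariants of the iterates: positive occupancy measures in `𝒰`, value vectors in `𝒱`. -/
structure TeamState.IsFeasible {n : ℕ} {S A : Type*} [Fintype S] [Fintype A] (τ tmix : ℝ)
    (x : TeamState n S A) : Prop where
  mu_pos : ∀ i s a, 0 < x.mu i s a
  mu_mem : ∀ i, x.mu i ∈ occSet S A τ
  v_le : ∀ i s, |x.v i s| ≤ 2 * tmix

/-- For `x ≤ 0` one has `(1 - x)(1 + x + x²) = 1 - x³ ≥ 1 ≥ (1 - x) eˣ`. No lower bound on `x` is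
needed, which matters because the dual gradient is divided by a possibly tiny probability. -/
theorem Real.exp_le_one_add_self_add_sq {x : ℝ} (hx : x ≤ 0) : Real.exp x ≤ 1 + x + x ^ 2 := by
  have h1 : 1 - x ≤ Real.exp (-x) := by linarith [Real.add_one_le_exp (-x)]
  have h2 : Real.exp x * Real.exp (-x) = 1 := by rw [← Real.exp_add]; simp
  have h3 : Real.exp x * (1 - x) ≤ 1 := by
    exact (mul_le_mul_of_nonneg_left h1 (Real.exp_pos x).le).trans h2.le
  nlinarith [mul_nonneg (sq_nonneg x) (neg_nonneg.2 hx)]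

theorem sq_sum_mul_le {ι : Type*} [Fintype ι] {w : ι → ℝ} (hw : ∀ j, 0 ≤ w j)
    (hw1 : ∑ j, w j = 1) (f : ι → ℝ) : (∑ j, w j * f j) ^ 2 ≤ ∑ j, w j * f j ^ 2 := by
  have := (even_two.convexOn_pow (𝕜 := ℝ)).map_sum_le (t := Finset.univ) (w := w) (p := f)
    (fun j _ => hw j) hw1 (fun _ _ => Set.mem_univ _)
  simpa using this

/-! ### The bilinear pairing and the mean over one sample -/

namespace TeamMDP

variable {n : ℕ} {S A : Type*} [Fintype S] [Fintype A] {M : TeamMDP n S A}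

/-- The pairing of an occupancy measure with the drift of a value vector. -/
noncomputable def flow (M : TeamMDP n S A) (μ : S → A → ℝ) (v : S → ℝ) : ℝ :=
  ∑ s, ∑ a, μ s a * (v s - ∑ s', M.p s a s' * v s')

theorem flow_sum_left {ι : Type*} [Fintype ι] (w : ι → ℝ) (μ : ι → S → A → ℝ) (v : S → ℝ) :
    M.flow (fun s a => ∑ j, w j * μ j s a) v = ∑ j, w j * M.flow (μ j) v := by
  simp only [flow, Finset.sum_mul, Finset.mul_sum]
  refine ((Finset.sum_congr rfl fun _ _ => Finset.sum_comm).trans Finset.sum_comm).trans ?_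
  exact Finset.sum_congr rfl fun _ _ => Finset.sum_congr rfl fun _ _ =>
    Finset.sum_congr rfl fun _ _ => by ring

theorem flow_sub_right (μ : S → A → ℝ) (u v : S → ℝ) :
    M.flow μ (fun s => u s - v s) = M.flow μ u - M.flow μ v := by
  simp only [flow, ← Finset.sum_sub_distrib, mul_sub]
  refine Finset.sum_congr rfl fun _ _ => Finset.sum_congr rfl fun _ _ => ?_
  simp only [Finset.sum_sub_distrib]
  ring

theorem flow_sum_right {ι : Type*} [Fintype ι] (μ : S → A → ℝ) (w : ι → ℝ) (v : ι → S → ℝ) :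
    M.flow μ (fun s => ∑ j, w j * v j s) = ∑ j, w j * M.flow μ (v j) := by
  have h : ∀ s a, ∑ s', M.p s a s' * ∑ j, w j * v j s' =
      ∑ j, w j * ∑ s', M.p s a s' * v j s' := fun s a => by
    simp only [Finset.mul_sum]
    rw [Finset.sum_comm]
    exact Finset.sum_congr rfl fun _ _ => Finset.sum_congr rfl fun _ _ => by ring
  simp only [flow, h, ← Finset.sum_sub_distrib]
  simp only [← mul_sub, Finset.mul_sum (s := (Finset.univ : Finset ι))]
  refine ((Finset.sum_congr rfl fun _ _ => Finset.sum_comm).trans Finset.sum_comm).trans ?_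
  refine Finset.sum_congr rfl fun _ _ => ?_
  rw [Finset.mul_sum]
  refine Finset.sum_congr rfl fun _ _ => ?_
  rw [Finset.mul_sum]
  exact Finset.sum_congr rfl fun _ _ => by ring

theorem IsOccupancy.flow_eq_zero {μ : S → A → ℝ} (hμ : M.IsOccupancy μ) (v : S → ℝ) :
    M.flow μ v = 0 := by
  have h := hμ.sum_mul_advantage 0 v
  have h1 : ∀ s a, μ s a * M.advantage 0 v s a =
      μ s a * (v s - ∑ s', M.p s a s' * v s') - μ s a * M.teamReward s a := fun s a => by
    unfold advantage; ring
  simp only [h1, Finset.sum_sub_distrib] at h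
  unfold flow
  linarith

/-- The iterates are not stationary measures, so their gap keeps a pairing with `v*`. The mean of
the primal update supplies precisely this term. -/
theorem sum_mul_advantage_eq {μ : S → A → ℝ} (hμ : ∑ s, ∑ a, μ s a = 1) (l : ℝ) (v : S → ℝ) :
    ∑ s, ∑ a, μ s a * M.advantage l v s a =
      l + M.flow μ v - ∑ s, ∑ a, μ s a * M.teamReward s a := by
  have h1 : ∀ s a, μ s a * M.advantage l v s a = μ s a * l +
      μ s a * (v s - ∑ s', M.p s a s' * v s') - μ s a * M.teamReward s a := fun s a => by
    unfold advantage; ring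
  simp only [h1, Finset.sum_sub_distrib, Finset.sum_add_distrib, ← Finset.sum_mul, hμ, one_mul,
    flow]

/-- The mean of a function of the transition sampled by agent `i`. -/
noncomputable def sampleMean (M : TeamMDP n S A) (w : Matrix (Fin n) (Fin n) ℝ)
    (x : TeamState n S A) (i : Fin n) (f : Transition S A → ℝ) : ℝ :=
  ∑ z : Transition S A, mixMu w x i z.1 z.2.1 * M.p z.1 z.2.1 z.2.2 * f z

theorem sampleMean_eq (w : Matrix (Fin n) (Fin n) ℝ) (x : TeamState n S A) (i : Fin n)
    (f : Transition S A → ℝ) : M.sampleMean w x i f =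
      ∑ s, ∑ a, ∑ s', mixMu w x i s a * M.p s a s' * f (s, a, s') := by
  simp only [sampleMean, Fintype.sum_prod_type]

theorem sampleMean_add (w : Matrix (Fin n) (Fin n) ℝ) (x : TeamState n S A) (i : Fin n)
    (f g : Transition S A → ℝ) : M.sampleMean w x i (fun z => f z + g z) =
      M.sampleMean w x i f + M.sampleMean w x i g := by
  simp only [sampleMean, mul_add, Finset.sum_add_distrib]

theorem sampleMean_const_mul (w : Matrix (Fin n) (Fin n) ℝ) (x : TeamState n S A) (i : Fin n)
    (c : ℝ) (f : Transition S A → ℝ) : M.sampleMean w x i (fun z => c * f z) =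
      c * M.sampleMean w x i f := by
  simp only [sampleMean, Finset.mul_sum]
  exact Finset.sum_congr rfl fun _ _ => by ring

end TeamMDP

/-! ### One step of the algorithm: feasibility, means and second moments -/

section Step

variable {n : ℕ} {S A : Type*} [Fintype S] [Fintype A] {M : TeamMDP n S A}
  {G : ℕ → SimpleGraph (Fin n)} {W : ℕ → Matrix (Fin n) (Fin n) ℝ} {η : ℝ} {B : ℕ}
  {τ tmix α β : ℝ} {x : TeamState n S A}

namespace IsMixingNetwork

/-- The weight an agent gives itself is at least `η`, so the importance ratio `μ_i/μ̃_i` is at most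
`1/η`. -/
theorem mul_le_mixMu (h : IsMixingNetwork G W η B) (t : ℕ) (hx : x.IsFeasible τ tmix) (i : Fin n)
    (s : S) (a : A) : η * x.mu i s a ≤ mixMu (W t) x i s a :=
  (mul_le_mul_of_nonneg_right (h.weight_ge t i i (Or.inl rfl)) (hx.mu_pos i s a).le).trans
    (Finset.single_le_sum (f := fun j => W t i j * x.mu j s a)
      (fun j _ => mul_nonneg (h.weight_nonneg t i j) (hx.mu_pos j s a).le) (Finset.mem_univ i))

theorem mixMu_pos (h : IsMixingNetwork G W η B) (t : ℕ) (hx : x.IsFeasible τ tmix) (i : Fin n)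
    (s : S) (a : A) : 0 < mixMu (W t) x i s a :=
  lt_of_lt_of_le (mul_pos h.eta_pos (hx.mu_pos i s a)) (h.mul_le_mixMu t hx i s a)

theorem sum_mixMu (h : IsMixingNetwork G W η B) (t : ℕ) (hx : x.IsFeasible τ tmix) (i : Fin n) :
    ∑ s, ∑ a, mixMu (W t) x i s a = 1 := by
  simp only [mixMu]
  rw [(Finset.sum_congr rfl fun _ _ => Finset.sum_comm).trans Finset.sum_comm]
  simp only [← Finset.mul_sum, (hx.mu_mem _).2.1, mul_one, h.row_sum]

theorem mixMu_mem (h : IsMixingNetwork G W η B) (t : ℕ) (hx : x.IsFeasible τ tmix) (i : Fin n) :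
    mixMu (W t) x i ∈ occSet S A τ := by
  refine ⟨fun s a => (h.mixMu_pos t hx i s a).le, h.sum_mixMu t hx i, fun s => ?_⟩
  simp only [mixMu]
  rw [Finset.sum_comm]
  simp only [← Finset.mul_sum]
  calc 1 / (√τ * Fintype.card S) = ∑ j, W t i j * (1 / (√τ * Fintype.card S)) := by
        rw [← Finset.sum_mul, h.row_sum, one_mul]
    _ ≤ _ := Finset.sum_le_sum fun j _ =>
        mul_le_mul_of_nonneg_left ((hx.mu_mem j).2.2 s) (h.weight_nonneg t i j)

end IsMixingNetwork

/-- The shift `4 tmix + 1` is the largest possible value of the rest when the value vectors lie in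
`𝒱`. It forces the sign that the one-sided exponential bound requires. -/
theorem tdError_bounds (hx : x.IsFeasible τ tmix) (i : Fin n) (s : S) (a : A) (s' : S) :
    x.v i s' - x.v i s + M.reward i s a s' - (4 * tmix + 1) ≤ 0 ∧
      (x.v i s' - x.v i s + M.reward i s a s' - (4 * tmix + 1)) ^ 2 ≤ 4 * (1 + 4 * tmix) ^ 2 := by
  have h1 := abs_le.1 (hx.v_le i s)
  have h2 := abs_le.1 (hx.v_le i s')
  have h3 := M.reward_nonneg i s a s'
  have h4 := M.reward_le_one i s a s'
  refine ⟨by linarith [h1.1, h2.2], ?_⟩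
  nlinarith [h1.1, h2.2, h1.2, h2.1]

variable [DecidableEq S]

/-- The importance ratio turns the sampling law `μ̃_i` into the agent's own `μ_i`, as the later
cancellation of bilinear terms requires. -/
theorem sampleMean_sum_primalGrad_mul (h : IsMixingNetwork G W η B) (t : ℕ)
    (hx : x.IsFeasible τ tmix) (i : Fin n) (u : S → ℝ) :
    M.sampleMean (W t) x i (fun z => ∑ s, primalGrad α (W t) x i z s * u s) =
      α * M.flow (x.mu i) u := by
  have h0 : ∀ z, ∑ s, primalGrad α (W t) x i z s * u s =
      x.mu i z.1 z.2.1 / mixMu (W t) x i z.1 z.2.1 * α * (u z.1 - u z.2.2) := fun z => by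
    simp [primalGrad, mul_sub, sub_mul, Finset.sum_sub_distrib]
  simp only [h0, TeamMDP.sampleMean_eq, TeamMDP.flow]
  rw [Finset.mul_sum]
  refine Finset.sum_congr rfl fun s _ => ?_
  rw [Finset.mul_sum]
  refine Finset.sum_congr rfl fun a _ => ?_
  have hm := (h.mixMu_pos t hx i s a).ne'
  calc _ = ∑ s', α * x.mu i s a * (M.p s a s' * u s - M.p s a s' * u s') := by
        refine Finset.sum_congr rfl fun s' _ => ?_
        field_simp
    _ = _ := by
        rw [← Finset.mul_sum, Finset.sum_sub_distrib, ← Finset.sum_mul, M.p_sum]; ring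

/-- Of the squared ratio, one factor converts the sampling law into `μ_i` and the other is at most
`1/η`; moreover `‖e_s - e_s'‖² ≤ 2`. -/
theorem sampleMean_sum_primalGrad_sq_le (h : IsMixingNetwork G W η B) (t : ℕ)
    (hx : x.IsFeasible τ tmix) (i : Fin n) :
    M.sampleMean (W t) x i (fun z => ∑ s, primalGrad α (W t) x i z s ^ 2) ≤ 2 * α ^ 2 / η := by
  have hη := h.eta_pos
  have h0 : ∀ z : Transition S A, ∑ s, primalGrad α (W t) x i z s ^ 2 ≤
      (x.mu i z.1 z.2.1 / mixMu (W t) x i z.1 z.2.1 * α) ^ 2 * 2 := fun z => by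
    simp only [primalGrad, mul_pow, ← Finset.mul_sum]
    refine mul_le_mul_of_nonneg_left ?_ (by positivity)
    calc ∑ s, ((if s = z.1 then (1 : ℝ) else 0) - (if s = z.2.2 then 1 else 0)) ^ 2
        ≤ ∑ s, ((if s = z.1 then (1 : ℝ) else 0) + (if s = z.2.2 then 1 else 0)) :=
          Finset.sum_le_sum fun s _ => by split_ifs <;> norm_num
      _ = 2 := by rw [Finset.sum_add_distrib]; simp; norm_num
  rw [TeamMDP.sampleMean_eq]
  calc _ ≤ ∑ s, ∑ a, x.mu i s a * (2 * α ^ 2 / η) := by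
        refine Finset.sum_le_sum fun s _ => Finset.sum_le_sum fun a _ => ?_
        have hm := h.mixMu_pos t hx i s a
        have hμ := hx.mu_pos i s a
        calc _ ≤ ∑ s', M.p s a s' * (x.mu i s a * (2 * α ^ 2 / η)) := by
              refine Finset.sum_le_sum fun s' _ => ?_
              rw [mul_comm (mixMu (W t) x i s a), mul_assoc]
              refine mul_le_mul_of_nonneg_left ?_ (M.p_nonneg s a s')
              refine (mul_le_mul_of_nonneg_left (h0 (s, a, s')) hm.le).trans ?_
              have h1 : x.mu i s a / mixMu (W t) x i s a ≤ 1 / η := by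
                rw [div_le_div_iff₀ hm hη]
                linarith [h.mul_le_mixMu t hx i s a]
              calc mixMu (W t) x i s a * ((x.mu i s a / mixMu (W t) x i s a * α) ^ 2 * 2)
                  = x.mu i s a * (2 * α ^ 2) * (x.mu i s a / mixMu (W t) x i s a) := by
                    field_simp
                _ ≤ x.mu i s a * (2 * α ^ 2) * (1 / η) :=
                    mul_le_mul_of_nonneg_left h1 (by positivity)
                _ = _ := by ring
          _ = _ := by rw [← Finset.sum_mul, M.p_sum, one_mul]
    _ = 2 * α ^ 2 / η := by simp only [← Finset.sum_mul, (hx.mu_mem i).2.1, one_mul]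

variable [DecidableEq A]

theorem sum_mul_dualGrad (M : TeamMDP n S A) (tmix β : ℝ) (w : Matrix (Fin n) (Fin n) ℝ)
    (x : TeamState n S A) (i : Fin n) (z : Transition S A) (f : S → A → ℝ) (k : ℕ) (hk : k ≠ 0) :
    ∑ s, ∑ a, f s a * dualGrad M tmix β w x i z s a ^ k = f z.1 z.2.1 *
      (β * (x.v i z.2.2 - x.v i z.1 + M.reward i z.1 z.2.1 z.2.2 - (4 * tmix + 1)) /
        mixMu w x i z.1 z.2.1) ^ k := by
  simp only [← Fintype.sum_prod_type']
  rw [Finset.sum_eq_single (z.1, z.2.1)]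
  · simp [dualGrad]
  · rintro ⟨s, a⟩ - hne
    have : ¬ (s = z.1 ∧ a = z.2.1) := fun hh => hne (Prod.ext hh.1 hh.2)
    simp [dualGrad, this, hk]
  · simp

theorem dualGrad_nonpos (h : IsMixingNetwork G W η B) (t : ℕ) (hx : x.IsFeasible τ tmix)
    (hβ : 0 ≤ β) (i : Fin n) (z : Transition S A) (s : S) (a : A) :
    dualGrad M tmix β (W t) x i z s a ≤ 0 := by
  unfold dualGrad
  split_ifs
  · exact div_nonpos_of_nonpos_of_nonneg
      (mul_nonpos_of_nonneg_of_nonpos hβ (tdError_bounds hx i _ _ _).1) (h.mixMu_pos t hx i _ _).le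
  · exact le_rfl

theorem sum_mul_exp_pos [Nonempty S] [Nonempty A] (h : IsMixingNetwork G W η B) (t : ℕ)
    (hx : x.IsFeasible τ tmix) (i : Fin n) (z : Transition S A) :
    0 < ∑ s', ∑ a', mixMu (W t) x i s' a' * Real.exp (dualGrad M tmix β (W t) x i z s' a') :=
  Finset.sum_pos (fun s _ => Finset.sum_pos (fun a _ => mul_pos (h.mixMu_pos t hx i s a)
    (Real.exp_pos _)) Finset.univ_nonempty) Finset.univ_nonempty

theorem halfMu_pos [Nonempty S] [Nonempty A] (h : IsMixingNetwork G W η B) (t : ℕ)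
    (hx : x.IsFeasible τ tmix) (i : Fin n) (z : Transition S A) (s : S) (a : A) :
    0 < halfMu M tmix β (W t) x i z s a :=
  div_pos (mul_pos (h.mixMu_pos t hx i s a) (Real.exp_pos _)) (sum_mul_exp_pos h t hx i z)

theorem sum_halfMu [Nonempty S] [Nonempty A] (h : IsMixingNetwork G W η B) (t : ℕ)
    (hx : x.IsFeasible τ tmix) (i : Fin n) (z : Transition S A) :
    ∑ s, ∑ a, halfMu M tmix β (W t) x i z s a = 1 := by
  simp only [halfMu, ← Finset.sum_div]
  exact div_self (sum_mul_exp_pos h t hx i z).ne'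

/-- The effect of the exponentiated-gradient step on the divergence from a distribution. -/
theorem klDist_halfMu_le [Nonempty S] [Nonempty A] (h : IsMixingNetwork G W η B) (t : ℕ)
    (hx : x.IsFeasible τ tmix) (hβ : 0 ≤ β) (i : Fin n) (z : Transition S A) {μ : S → A → ℝ}
    (hμ1 : ∑ s, ∑ a, μ s a = 1) :
    klDist μ (halfMu M tmix β (W t) x i z) ≤ klDist μ (mixMu (W t) x i) +
      ∑ s, ∑ a, (mixMu (W t) x i s a - μ s a) * dualGrad M tmix β (W t) x i z s a +
      ∑ s, ∑ a, mixMu (W t) x i s a * dualGrad M tmix β (W t) x i z s a ^ 2 := by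
  set m := mixMu (W t) x i with hm
  set Δ := dualGrad M tmix β (W t) x i z with hΔ
  have hmpos : ∀ s a, 0 < m s a := h.mixMu_pos t hx i
  have hZpos : 0 < ∑ s', ∑ a', m s' a' * Real.exp (Δ s' a') := sum_mul_exp_pos h t hx i z
  set Z := ∑ s', ∑ a', m s' a' * Real.exp (Δ s' a') with hZ
  have hlog : ∀ s a, Real.log (halfMu M tmix β (W t) x i z s a) =
      Real.log (m s a) + Δ s a - Real.log Z := by
    intro s a
    change Real.log (m s a * Real.exp (Δ s a) / Z) = _
    rw [Real.log_div (mul_pos (hmpos s a) (Real.exp_pos _)).ne' hZpos.ne',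
      Real.log_mul (hmpos s a).ne' (Real.exp_pos _).ne', Real.log_exp]
  have h1 : klDist μ (halfMu M tmix β (W t) x i z) =
      klDist μ m - ∑ s, ∑ a, μ s a * Δ s a + Real.log Z := by
    rw [klDist_eq_sub (halfMu_pos h t hx i z), klDist_eq_sub hmpos]
    have : Real.log Z = ∑ s, ∑ a, μ s a * Real.log Z := by
      simp only [← Finset.sum_mul, hμ1, one_mul]
    rw [this]
    simp only [← Finset.sum_sub_distrib, ← Finset.sum_add_distrib]
    exact Finset.sum_congr rfl fun s _ => Finset.sum_congr rfl fun a _ => by rw [hlog]; ring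
  -- `log Z ≤ Z - 1`, and the exponential bound applies because the dual gradient is nonpositive.
  have h2 : Real.log Z ≤ ∑ s, ∑ a, m s a * Δ s a + ∑ s, ∑ a, m s a * Δ s a ^ 2 := by
    have h3 : Z ≤ ∑ s, ∑ a, m s a * (1 + Δ s a + Δ s a ^ 2) :=
      Finset.sum_le_sum fun s _ => Finset.sum_le_sum fun a _ =>
        mul_le_mul_of_nonneg_left (Real.exp_le_one_add_self_add_sq
          (dualGrad_nonpos h t hx hβ i z s a)) (hmpos s a).le
    simp only [mul_add, mul_one, Finset.sum_add_distrib] at h3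
    have h4 : ∑ s, ∑ a, m s a = 1 := h.sum_mixMu t hx i
    linarith [Real.log_le_sub_one_of_pos hZpos]
  simp only [sub_mul, Finset.sum_sub_distrib]
  linarith

theorem algStep_isFeasible [Nonempty S] [Nonempty A] (hτ : 1 < τ) (htmix : 0 ≤ tmix)
    (h : IsMixingNetwork G W η B) (t : ℕ) (hx : x.IsFeasible τ tmix)
    (z : Fin n → Transition S A) :
    (algStep M tmix τ α β (W t) x z).IsFeasible τ tmix := by
  have h1 := fun i => argminOn_occSet hτ (halfMu_pos (M := M) (β := β) h t hx i (z i))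
    (sum_halfMu h t hx i (z i))
  exact ⟨fun i => (h1 i).1, fun i => (h1 i).2.1,
    fun i => (argminOn_box (by linarith) _).1⟩

theorem klDist_algStep_le [Nonempty S] [Nonempty A] (hτ : 1 < τ)
    (h : IsMixingNetwork G W η B) (t : ℕ) (hx : x.IsFeasible τ tmix) (hβ : 0 ≤ β)
    (z : Fin n → Transition S A) (i : Fin n) {μ : S → A → ℝ} (hμ : μ ∈ occSet S A τ) :
    klDist μ ((algStep M tmix τ α β (W t) x z).mu i) ≤ klDist μ (mixMu (W t) x i) +
      ∑ s, ∑ a, (mixMu (W t) x i s a - μ s a) * dualGrad M tmix β (W t) x i (z i) s a +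
      ∑ s, ∑ a, mixMu (W t) x i s a * dualGrad M tmix β (W t) x i (z i) s a ^ 2 :=
  ((argminOn_occSet hτ (halfMu_pos (M := M) (β := β) h t hx i (z i))
    (sum_halfMu h t hx i (z i))).2.2 μ hμ).trans (klDist_halfMu_le h t hx hβ i (z i) hμ.2.1)

/-- The dual step moves an occupancy measure by at most the size of the dual gradient. -/
theorem sq_sum_abs_algStep_sub_mixMu_le [Nonempty S] [Nonempty A] (hτ : 1 < τ) (htmix : 0 ≤ tmix)
    (h : IsMixingNetwork G W η B) (t : ℕ) (hx : x.IsFeasible τ tmix) (hβ : 0 ≤ β)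
    (z : Fin n → Transition S A) (i : Fin n) :
    (∑ s, ∑ a, |(algStep M tmix τ α β (W t) x z).mu i s a - mixMu (W t) x i s a|) ^ 2 ≤
      4 * ∑ s, ∑ a, mixMu (W t) x i s a * dualGrad M tmix β (W t) x i (z i) s a ^ 2 := by
  have hx' := algStep_isFeasible (M := M) (α := α) (β := β) hτ htmix h t hx z
  have h1 := sq_sum_abs_sub_le_klDist (fun s a => (h.mixMu_pos t hx i s a).le) (hx'.mu_pos i)
    (h.sum_mixMu t hx i) (hx'.mu_mem i).2.1
  -- Taking the mixed measure itself as comparison point removes the divergence and the linear term,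
  -- leaving only the second-order one.
  have h2 := klDist_algStep_le (M := M) (α := α) hτ h t hx hβ z i (h.mixMu_mem t hx i)
  have h3 : klDist (mixMu (W t) x i) (mixMu (W t) x i) = 0 := by
    rw [klDist_eq_sub (h.mixMu_pos t hx i)]; simp
  simp only [sub_self, zero_mul, Finset.sum_const_zero, h3, zero_add] at h2
  simp only [abs_sub_comm ((algStep M tmix τ α β (W t) x z).mu i _ _)]
  linarith

theorem sum_sq_algStep_sub_le (htmix : 0 ≤ tmix) (t : ℕ) (z : Fin n → Transition S A) (i : Fin n)
    {v : S → ℝ} (hv : ∀ s, |v s| ≤ 2 * tmix) :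
    ∑ s, ((algStep M tmix τ α β (W t) x z).v i s - v s) ^ 2 ≤
      ∑ s, (mixV (W t) x i s - v s) ^ 2 +
        2 * ∑ s, primalGrad α (W t) x i (z i) s * (mixV (W t) x i s - v s) +
        ∑ s, primalGrad α (W t) x i (z i) s ^ 2 := by
  refine ((argminOn_box (by linarith) (fun s => mixV (W t) x i s +
    primalGrad α (W t) x i (z i) s)).2 v hv).trans (le_of_eq ?_)
  rw [Finset.mul_sum, ← Finset.sum_add_distrib, ← Finset.sum_add_distrib]
  exact Finset.sum_congr rfl fun s _ => by ring

/-- Division by `μ̃` cancels the sampling probability. The shift enters only through the total mass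
of `f`, which vanishes for a difference of two distributions. -/
theorem sampleMean_sum_mul_dualGrad (h : IsMixingNetwork G W η B) (t : ℕ)
    (hx : x.IsFeasible τ tmix) (i : Fin n) (f : S → A → ℝ) :
    M.sampleMean (W t) x i (fun z => ∑ s, ∑ a, f s a * dualGrad M tmix β (W t) x i z s a) =
      β * (-M.flow f (x.v i) + ∑ s, ∑ a, f s a * M.localReward i s a -
        (4 * tmix + 1) * ∑ s, ∑ a, f s a) := by
  have h0 : ∀ z, ∑ s, ∑ a, f s a * dualGrad M tmix β (W t) x i z s a = f z.1 z.2.1 *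
      (β * (x.v i z.2.2 - x.v i z.1 + M.reward i z.1 z.2.1 z.2.2 - (4 * tmix + 1)) /
        mixMu (W t) x i z.1 z.2.1) := fun z => by
    simpa using sum_mul_dualGrad M tmix β (W t) x i z f 1 one_ne_zero
  simp only [h0, TeamMDP.sampleMean_eq, TeamMDP.flow, Finset.mul_sum, ← Finset.sum_neg_distrib,
    ← Finset.sum_add_distrib, ← Finset.sum_sub_distrib]
  refine Finset.sum_congr rfl fun s _ => Finset.sum_congr rfl fun a _ => ?_
  have hp := M.p_sum s a
  have hm := (h.mixMu_pos t hx i s a).ne'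
  calc ∑ s', mixMu (W t) x i s a * M.p s a s' * (f s a * (β * (x.v i s' - x.v i s +
        M.reward i s a s' - (4 * tmix + 1)) / mixMu (W t) x i s a))
      = ∑ s', β * f s a * (M.p s a s' * x.v i s' + M.p s a s' * M.reward i s a s' -
          M.p s a s' * (x.v i s + (4 * tmix + 1))) := by
        refine Finset.sum_congr rfl fun s' _ => ?_
        field_simp
        ring
    _ = β * f s a * (∑ s', M.p s a s' * x.v i s' + M.localReward i s a -
          (x.v i s + (4 * tmix + 1))) := by
        rw [← Finset.mul_sum, Finset.sum_sub_distrib, Finset.sum_add_distrib, ← Finset.sum_mul, hp,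
          one_mul, TeamMDP.localReward]
    _ = _ := by ring

/-- The sampling probability and the weight `μ̃` cancel both factors `1/μ̃`, so every state-action
pair contributes the same bound; hence the factor `|S||A|`. -/
theorem sampleMean_sum_mul_dualGrad_sq_le (h : IsMixingNetwork G W η B) (t : ℕ)
    (hx : x.IsFeasible τ tmix) (i : Fin n) :
    M.sampleMean (W t) x i (fun z => ∑ s, ∑ a, mixMu (W t) x i s a *
        dualGrad M tmix β (W t) x i z s a ^ 2) ≤
      4 * β ^ 2 * (1 + 4 * tmix) ^ 2 * (Fintype.card S * Fintype.card A) := by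
  simp only [fun z => sum_mul_dualGrad M tmix β (W t) x i z (mixMu (W t) x i) 2 two_ne_zero,
    TeamMDP.sampleMean_eq]
  calc _ ≤ ∑ _s : S, ∑ _a : A, 4 * β ^ 2 * (1 + 4 * tmix) ^ 2 := by
        refine Finset.sum_le_sum fun s _ => Finset.sum_le_sum fun a _ => ?_
        have hm := (h.mixMu_pos t hx i s a).ne'
        calc _ ≤ ∑ s', M.p s a s' * (4 * β ^ 2 * (1 + 4 * tmix) ^ 2) := by
              refine Finset.sum_le_sum fun s' _ => ?_
              have h1 := (tdError_bounds (M := M) hx i s a s').2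
              have h2 : mixMu (W t) x i s a * M.p s a s' * (mixMu (W t) x i s a * (β *
                  (x.v i s' - x.v i s + M.reward i s a s' - (4 * tmix + 1)) /
                    mixMu (W t) x i s a) ^ 2) = M.p s a s' * (β ^ 2 *
                  (x.v i s' - x.v i s + M.reward i s a s' - (4 * tmix + 1)) ^ 2) := by
                field_simp
              refine h2.le.trans (mul_le_mul_of_nonneg_left ?_ (M.p_nonneg s a s'))
              nlinarith [mul_le_mul_of_nonneg_left h1 (sq_nonneg β)]
          _ = _ := by rw [← Finset.sum_mul, M.p_sum, one_mul]
    _ = _ := by simp; ring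

end Step

/-! ### The potential and its mean change in one round -/

section Potential

variable {n : ℕ} {S A : Type*} [Fintype S] [Fintype A] {M : TeamMDP n S A}
  {G : ℕ → SimpleGraph (Fin n)} {W : ℕ → Matrix (Fin n) (Fin n) ℝ} {η : ℝ} {B : ℕ}
  {τ tmix α β : ℝ} {x : TeamState n S A} {muStar : S → A → ℝ} {vStar : S → ℝ}

/-- The potential of the analysis. It dominates `lyapunov`, and agrees with it at consensus. -/
noncomputable def potential (tmix : ℝ) (muStar : S → A → ℝ) (vStar : S → ℝ)
    (x : TeamState n S A) : ℝ :=
  (1 / (n : ℝ)) * ∑ i, (klDist muStar (x.mu i) +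
    1 / (2 * Fintype.card S * tmix ^ 2) * ∑ s, (x.v i s - vStar s) ^ 2)

/-- The distance of the mixed occupancy measures to their network average. -/
noncomputable def consensusError (w : Matrix (Fin n) (Fin n) ℝ) (x : TeamState n S A) : ℝ :=
  (1 / (n : ℝ)) * ∑ i, ∑ s, ∑ a, |mixMu w x i s a - avgMu x s a|

theorem potential_initState (hn : 0 < n) (ζ : S → A → ℝ) :
    potential tmix muStar vStar (initState n ζ) = lyapunov tmix muStar vStar (initState n ζ) := by
  have : (n : ℝ) ≠ 0 := by positivity
  simp [potential, lyapunov, initState]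
  field_simp

theorem potential_nonneg (hmu : muStar ∈ occSet S A τ) (hx : x.IsFeasible τ tmix) :
    0 ≤ potential tmix muStar vStar x :=
  mul_nonneg (by positivity) (Finset.sum_nonneg fun i _ => add_nonneg
    (klDist_nonneg hmu.1 (hx.mu_pos i) hmu.2.1 (hx.mu_mem i).2.1)
    (mul_nonneg (by positivity) (Finset.sum_nonneg fun _ _ => sq_nonneg _)))

theorem avgMu_mem (hn : 0 < n) (hx : x.IsFeasible τ tmix) : avgMu x ∈ occSet S A τ := by
  have hn' : (n : ℝ) ≠ 0 := by positivity
  refine ⟨fun s a => mul_nonneg (by positivity) (Finset.sum_nonneg fun i _ => (hx.mu_pos i s a).le),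
    ?_, fun s => ?_⟩
  · simp only [avgMu, ← Finset.mul_sum]
    rw [(Finset.sum_congr rfl fun _ _ => Finset.sum_comm).trans Finset.sum_comm]
    simp only [(hx.mu_mem _).2.1]
    simp [hn']
  · simp only [avgMu, ← Finset.mul_sum]
    rw [Finset.sum_comm]
    calc 1 / (√τ * Fintype.card S) = 1 / (n : ℝ) * ∑ _i : Fin n, 1 / (√τ * Fintype.card S) := by
          simp only [Finset.sum_const, Finset.card_univ, Fintype.card_fin, nsmul_eq_mul]
          field_simp
      _ ≤ _ := mul_le_mul_of_nonneg_left
          (Finset.sum_le_sum fun i _ => (hx.mu_mem i).2.2 s) (by positivity)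

namespace IsMixingNetwork

theorem sum_sum_weight_mul (h : IsMixingNetwork G W η B) (t : ℕ) (f : Fin n → ℝ) :
    ∑ i, ∑ j, W t i j * f j = ∑ j, f j :=
  h.sum_mulVec t f

/-- The bilinear terms of the dual and the primal step cancel. -/
theorem sum_flow_mixMu (h : IsMixingNetwork G W η B) (t : ℕ) (M : TeamMDP n S A)
    (x : TeamState n S A) :
    ∑ i, M.flow (mixMu (W t) x i) (x.v i) = ∑ i, M.flow (x.mu i) (mixV (W t) x i) := by
  have h1 : ∀ i, M.flow (mixMu (W t) x i) (x.v i) = ∑ j, W t i j * M.flow (x.mu j) (x.v i) :=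
    fun i => TeamMDP.flow_sum_left _ _ _
  have h2 : ∀ i, M.flow (x.mu i) (mixV (W t) x i) = ∑ j, W t i j * M.flow (x.mu i) (x.v j) :=
    fun i => TeamMDP.flow_sum_right _ _ _
  simp only [h1, h2]
  rw [Finset.sum_comm]
  exact Finset.sum_congr rfl fun i _ => Finset.sum_congr rfl fun j _ => by rw [h.symm]

end IsMixingNetwork

variable [DecidableEq S] [DecidableEq A]

/-- The change of the potential of agent `i` that is due to its sample `z`. -/
noncomputable def sampleGain (M : TeamMDP n S A) (tmix α β : ℝ) (muStar : S → A → ℝ)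
    (vStar : S → ℝ) (w : Matrix (Fin n) (Fin n) ℝ) (x : TeamState n S A) (i : Fin n)
    (z : Transition S A) : ℝ :=
  ∑ s, ∑ a, (mixMu w x i s a - muStar s a) * dualGrad M tmix β w x i z s a +
    ∑ s, ∑ a, mixMu w x i s a * dualGrad M tmix β w x i z s a ^ 2 +
    1 / (2 * Fintype.card S * tmix ^ 2) *
      (2 * ∑ s, primalGrad α w x i z s * (mixV w x i s - vStar s) + ∑ s, primalGrad α w x i z s ^ 2)

/-- Mixing is harmless by convexity and unit column sums, and the projections are harmless because
`μ* ∈ 𝒰` and `v* ∈ 𝒱`. The projections act agent by agent, and so does the potential. -/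
theorem potential_algStep_le [Nonempty S] [Nonempty A] (hτ : 1 < τ) (htmix : 0 ≤ tmix)
    (h : IsMixingNetwork G W η B) (t : ℕ) (hx : x.IsFeasible τ tmix) (hβ : 0 ≤ β)
    (hmu : muStar ∈ occSet S A τ) (hv : ∀ s, |vStar s| ≤ 2 * tmix)
    (z : Fin n → Transition S A) :
    potential tmix muStar vStar (algStep M tmix τ α β (W t) x z) ≤ potential tmix muStar vStar x +
      (1 / (n : ℝ)) * ∑ i, sampleGain M tmix α β muStar vStar (W t) x i (z i) := by
  set b : ℝ := 1 / (2 * Fintype.card S * tmix ^ 2) with hb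
  have hb0 : 0 ≤ b := by positivity
  have hw := h.weight_nonneg t
  have h1 : ∀ i, klDist muStar (mixMu (W t) x i) ≤ ∑ j, W t i j * klDist muStar (x.mu j) :=
    fun i => klDist_sum_le hmu.1 (hw i) (h.row_sum t i) hx.mu_pos
  have h2 : ∀ i, ∑ s, (mixV (W t) x i s - vStar s) ^ 2 ≤
      ∑ j, W t i j * ∑ s, (x.v j s - vStar s) ^ 2 := by
    intro i
    simp only [Finset.mul_sum]
    rw [Finset.sum_comm]
    refine Finset.sum_le_sum fun s _ => ?_
    refine le_trans (le_of_eq ?_) (sq_sum_mul_le (hw i) (h.row_sum t i) _)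
    simp only [mul_sub, Finset.sum_sub_distrib, ← Finset.sum_mul, h.row_sum, one_mul, mixV]
  have h3 : ∀ i, klDist muStar ((algStep M tmix τ α β (W t) x z).mu i) +
      b * ∑ s, ((algStep M tmix τ α β (W t) x z).v i s - vStar s) ^ 2 ≤
      ∑ j, W t i j * (klDist muStar (x.mu j) + b * ∑ s, (x.v j s - vStar s) ^ 2) +
        sampleGain M tmix α β muStar vStar (W t) x i (z i) := by
    intro i
    have e1 := klDist_algStep_le (M := M) (α := α) hτ h t hx hβ z i hmu
    have e2 := mul_le_mul_of_nonneg_left ((sum_sq_algStep_sub_le (M := M) (τ := τ) (α := α) (β := β)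
      (W := W) (x := x) htmix t z i hv).trans
        (add_le_add_left (add_le_add_left (h2 i) _) _)) hb0
    have e3 : ∑ j, W t i j * (klDist muStar (x.mu j) + b * ∑ s, (x.v j s - vStar s) ^ 2) =
        ∑ j, W t i j * klDist muStar (x.mu j) +
          b * ∑ j, W t i j * ∑ s, (x.v j s - vStar s) ^ 2 := by
      rw [Finset.mul_sum (a := b), ← Finset.sum_add_distrib]
      exact Finset.sum_congr rfl fun j _ => by ring
    rw [e3]
    unfold sampleGain
    linarith [h1 i]
  unfold potential
  rw [← mul_add, ← h.sum_sum_weight_mul t (fun j => klDist muStar (x.mu j) + _),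
    ← Finset.sum_add_distrib]
  exact mul_le_mul_of_nonneg_left (Finset.sum_le_sum fun i _ => h3 i) (by positivity)

/-- The mean change of the potential. -/
theorem sum_sampleMean_sampleGain_le [Nonempty S] (hn : 0 < n) (htmix : 0 < tmix)
    (h : IsMixingNetwork G W η B) (t : ℕ) (hx : x.IsFeasible τ tmix) (hβ : 0 ≤ β)
    (hα : α = Fintype.card S * tmix ^ 2 * β)
    (hmu : M.IsOccupancy muStar) {l : ℝ} (hl : l ≤ ∑ s, ∑ a, muStar s a * M.teamReward s a) :
    (1 / (n : ℝ)) * ∑ i, M.sampleMean (W t) x i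
        (fun z => sampleGain M tmix α β muStar vStar (W t) x i z) ≤
      -(β * ∑ s, ∑ a, avgMu x s a * M.advantage l vStar s a) + β * consensusError (W t) x +
        β ^ 2 * (4 * (1 + 4 * tmix) ^ 2 * (Fintype.card S * Fintype.card A) +
          Fintype.card S * tmix ^ 2 / η) := by
  have hn' : (0 : ℝ) < n := by exact_mod_cast hn
  have hη := h.eta_pos
  have hm : (0 : ℝ) < Fintype.card S := by exact_mod_cast Fintype.card_pos
  set κ := 4 * (1 + 4 * tmix) ^ 2 * (Fintype.card S * Fintype.card A) +
          Fintype.card S * tmix ^ 2 / η with hκ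
  set avg := avgMu x with havg
  have havg1 := (avgMu_mem hn hx).2.1
  have hagent : ∀ i, M.sampleMean (W t) x i
      (fun z => sampleGain M tmix α β muStar vStar (W t) x i z) ≤
      β * (-M.flow (mixMu (W t) x i) (x.v i) + M.flow (x.mu i) (mixV (W t) x i)
        - M.flow (x.mu i) vStar + ∑ s, ∑ a, |mixMu (W t) x i s a - avg s a|
        + ∑ s, ∑ a, (avg s a - muStar s a) * M.localReward i s a) + β ^ 2 * κ := by
    intro i
    have e1 := sampleMean_sum_mul_dualGrad (M := M) (β := β) h t hx i
      (fun s a => mixMu (W t) x i s a - muStar s a)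
    have e2 := sampleMean_sum_mul_dualGrad_sq_le (M := M) (β := β) h t hx i
    have e3 := sampleMean_sum_primalGrad_mul (M := M) (α := α) h t hx i
      (fun s => mixV (W t) x i s - vStar s)
    have e4 := sampleMean_sum_primalGrad_sq_le (M := M) (α := α) h t hx i
    have f1 : M.flow (fun s a => mixMu (W t) x i s a - muStar s a) (x.v i) =
        M.flow (mixMu (W t) x i) (x.v i) := by
      have : M.flow (fun s a => mixMu (W t) x i s a - muStar s a) (x.v i) =
          M.flow (mixMu (W t) x i) (x.v i) - M.flow muStar (x.v i) := by
        simp only [TeamMDP.flow, sub_mul, Finset.sum_sub_distrib]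
      rw [this, hmu.flow_eq_zero, sub_zero]
    have f2 : ∑ s, ∑ a, (mixMu (W t) x i s a - muStar s a) = 0 := by
      simp only [Finset.sum_sub_distrib, h.sum_mixMu t hx i, hmu.2.1, sub_self]
    -- Moving from `μ̃_i` to the network average costs their ℓ¹ distance, since local rewards lie in
    -- `[0,1]`. With a measure common to all agents, the local rewards then average to the team
    -- reward.
    have f3 : ∑ s, ∑ a, (mixMu (W t) x i s a - muStar s a) * M.localReward i s a ≤
        ∑ s, ∑ a, |mixMu (W t) x i s a - avg s a|
        + ∑ s, ∑ a, (avg s a - muStar s a) * M.localReward i s a := by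
      simp only [← Finset.sum_add_distrib]
      refine Finset.sum_le_sum fun s _ => Finset.sum_le_sum fun a _ => ?_
      have g1 : (mixMu (W t) x i s a - avg s a) * M.localReward i s a ≤
          |mixMu (W t) x i s a - avg s a| :=
        (mul_le_mul_of_nonneg_right (le_abs_self _) (M.localReward_nonneg i s a)).trans
          (mul_le_of_le_one_right (abs_nonneg _) (M.localReward_le_one i s a))
      linarith
    rw [f1, f2] at e1
    rw [TeamMDP.flow_sub_right (u := mixV (W t) x i)] at e3
    have e5 : M.sampleMean (W t) x i (fun z => sampleGain M tmix α β muStar vStar (W t) x i z) =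
        M.sampleMean (W t) x i (fun z => ∑ s, ∑ a, (mixMu (W t) x i s a - muStar s a) *
          dualGrad M tmix β (W t) x i z s a) +
        M.sampleMean (W t) x i (fun z => ∑ s, ∑ a, mixMu (W t) x i s a *
          dualGrad M tmix β (W t) x i z s a ^ 2) +
        1 / (2 * Fintype.card S * tmix ^ 2) * (2 * M.sampleMean (W t) x i (fun z =>
          ∑ s, primalGrad α (W t) x i z s * (mixV (W t) x i s - vStar s)) +
          M.sampleMean (W t) x i (fun z => ∑ s, primalGrad α (W t) x i z s ^ 2)) := by
      simp only [sampleGain, TeamMDP.sampleMean_add, TeamMDP.sampleMean_const_mul]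
    rw [e5, e1, e3]
    have g2 := mul_le_mul_of_nonneg_left f3 hβ
    -- The choice of `α` gives the primal terms the same weight `β` as the dual ones.
    have g3 : 1 / (2 * Fintype.card S * tmix ^ 2) * (2 * (α * (M.flow (x.mu i) (mixV (W t) x i) -
        M.flow (x.mu i) vStar))) = β * (M.flow (x.mu i) (mixV (W t) x i) -
        M.flow (x.mu i) vStar) := by
      rw [hα]; field_simp
    have g4 : 1 / (2 * Fintype.card S * tmix ^ 2) * (2 * α ^ 2 / η) =
        β ^ 2 * (Fintype.card S * tmix ^ 2 / η) := by
      rw [hα]; field_simp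
    have g5 := mul_le_mul_of_nonneg_left e4
      (by positivity : 0 ≤ 1 / (2 * Fintype.card S * tmix ^ 2))
    rw [g4] at g5
    rw [mul_add (1 / (2 * Fintype.card S * tmix ^ 2)), g3, hκ]
    linarith
  have hsum := Finset.sum_le_sum fun i (_ : i ∈ Finset.univ) => hagent i
  -- The bilinear terms cancel only in the sum over agents, not agent by agent.
  have hflow := h.sum_flow_mixMu t M x
  have havgflow : (1 / (n : ℝ)) * ∑ i, M.flow (x.mu i) vStar = M.flow avg vStar := by
    have : avg = fun s a => ∑ i, (1 / (n : ℝ)) * x.mu i s a := by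
      funext s a; simp only [havg, avgMu, Finset.mul_sum]
    rw [this, TeamMDP.flow_sum_left, Finset.mul_sum]
  have hteam : (1 / (n : ℝ)) * ∑ i, ∑ s, ∑ a, (avg s a - muStar s a) * M.localReward i s a =
      ∑ s, ∑ a, avg s a * M.teamReward s a - ∑ s, ∑ a, muStar s a * M.teamReward s a := by
    rw [Finset.sum_comm, Finset.mul_sum, ← Finset.sum_sub_distrib]
    refine Finset.sum_congr rfl fun s _ => ?_
    rw [Finset.sum_comm, Finset.mul_sum, ← Finset.sum_sub_distrib]
    refine Finset.sum_congr rfl fun a _ => ?_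
    rw [← Finset.mul_sum, TeamMDP.teamReward]
    ring
  have hgap := TeamMDP.sum_mul_advantage_eq (M := M) havg1 l vStar
  simp only [← Finset.mul_sum, Finset.sum_add_distrib, Finset.sum_sub_distrib,
    Finset.sum_neg_distrib, hflow, Finset.sum_const, Finset.card_univ, Fintype.card_fin,
    nsmul_eq_mul] at hsum
  have hscaled := mul_le_mul_of_nonneg_left hsum (by positivity : 0 ≤ 1 / (n : ℝ))
  refine hscaled.trans ?_
  simp only [← havg] at hgap
  have hc : (1 / (n : ℝ)) * ∑ i, ∑ s, ∑ a, |mixMu (W t) x i s a - avg s a| =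
      consensusError (W t) x := rfl
  have hfin : 1 / (n : ℝ) * (β * (-∑ i, M.flow (x.mu i) (mixV (W t) x i)
      + ∑ i, M.flow (x.mu i) (mixV (W t) x i) - ∑ i, M.flow (x.mu i) vStar
      + ∑ i, ∑ s, ∑ a, |mixMu (W t) x i s a - avg s a|
      + ∑ i, ∑ s, ∑ a, (avg s a - muStar s a) * M.localReward i s a) + β ^ 2 * (n * κ)) =
      β * (-(1 / (n : ℝ) * ∑ i, M.flow (x.mu i) vStar)
        + 1 / (n : ℝ) * ∑ i, ∑ s, ∑ a, |mixMu (W t) x i s a - avg s a|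
        + 1 / (n : ℝ) * ∑ i, ∑ s, ∑ a, (avg s a - muStar s a) * M.localReward i s a)
        + β ^ 2 * κ := by
    field_simp
    ring
  rw [hfin, havgflow, hc, hteam, hgap]
  nlinarith [mul_le_mul_of_nonneg_left hl hβ]

end Potential

/-! ### Expectations over finite histories -/

section History

variable {Ω X : Type*} {Z : ℕ → Ω → X}

/-- Extend a finite history by a constant. -/
def extendHistory {X : Type*} (x₀ : X) {t : ℕ} (h : Fin t → X) (k : ℕ) : X :=
  if hk : k < t then h ⟨k, hk⟩ else x₀

theorem history_eq_iff (x₀ : X) {t : ℕ} (h : Fin t → X) (ω : Ω) :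
    ((fun k : Fin t => Z k ω) = h) ↔ ∀ k < t, Z k ω = extendHistory x₀ h k := by
  constructor
  · rintro rfl k hk
    simp [extendHistory, hk]
  · intro hh
    funext k
    rw [hh k k.2]
    simp [extendHistory]

theorem DependsOn.comp_history {β : Type*} (x₀ : X) {t : ℕ} {F : (ℕ → X) → β}
    (hF : DependsOn F (Set.Iio t)) (ω : Ω) :
    F (fun k => Z k ω) = F (extendHistory x₀ fun k : Fin t => Z k ω) :=
  hF fun k hk => (history_eq_iff (Z := Z) x₀ _ ω).1 rfl k hk

end History

section FiniteValued

variable {Ω : Type*} [MeasurableSpace Ω] {P : Measure Ω} [IsFiniteMeasure P]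

/-- Measurable level sets suffice: the function is a finite sum of indicators, and neither a
σ-algebra on `Y` nor measurability of `f` enters. -/
theorem integral_comp_of_fintype {Y : Type*} [Fintype Y] (y : Ω → Y)
    (hy : ∀ c, MeasurableSet {ω | y ω = c}) (f : Y → ℝ) :
    Integrable (fun ω => f (y ω)) P ∧ ∫ ω, f (y ω) ∂P = ∑ c, P.real {ω | y ω = c} * f c := by
  classical
  have hdec : (fun ω => f (y ω)) = fun ω => ∑ c, {ω | y ω = c}.indicator (fun _ => f c) ω := by
    funext ω
    rw [Finset.sum_eq_single (y ω)]
    · simp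
    · intro c _ hc
      exact Set.indicator_of_notMem (fun h => hc h.symm) _
    · simp
  have hint : ∀ c, Integrable ({ω | y ω = c}.indicator fun _ => f c) P := fun c =>
    (integrable_const _).indicator (hy c)
  rw [hdec]
  refine ⟨integrable_finsetSum _ fun c _ => hint c, ?_⟩
  rw [integral_finsetSum _ fun c _ => hint c]
  exact Finset.sum_congr rfl fun c _ => by rw [integral_indicator_const _ (hy c), smul_eq_mul]

variable {X : Type*} {Z : ℕ → Ω → X}

theorem measurableSet_history (hZ : ∀ t z, MeasurableSet {ω | Z t ω = z}) {t : ℕ}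
    (h : Fin t → X) : MeasurableSet {ω | (fun k : Fin t => Z k ω) = h} := by
  have : {ω | (fun k : Fin t => Z k ω) = h} = ⋂ k : Fin t, {ω | Z k ω = h k} := by
    ext ω; simp [funext_iff]
  rw [this]
  exact MeasurableSet.iInter fun k => hZ k _

theorem integrable_of_dependsOn [Fintype X] (x₀ : X) (hZ : ∀ t z, MeasurableSet {ω | Z t ω = z})
    {t : ℕ} {F : (ℕ → X) → ℝ} (hF : DependsOn F (Set.Iio t)) :
    Integrable (fun ω => F fun k => Z k ω) P := by
  classical
  simp only [hF.comp_history (Z := Z) x₀]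
  exact (integral_comp_of_fintype (fun ω => fun k : Fin t => Z k ω)
    (measurableSet_history hZ) (fun h => F (extendHistory x₀ h))).1

end FiniteValued

/-! ### Random runs of the algorithm -/

section Run

variable {n : ℕ} {S A : Type*} [Fintype S] [Fintype A] [DecidableEq S] [DecidableEq A]
  {M : TeamMDP n S A} {W : ℕ → Matrix (Fin n) (Fin n) ℝ} {tmix τ α β : ℝ} {ζ : S → A → ℝ}

theorem dependsOn_iterates (t : ℕ) :
    DependsOn (fun z => iterates M tmix τ α β W ζ z t) (Set.Iio t) := by
  induction t with
  | zero => exact fun _ _ _ => rfl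
  | succ t ih =>
    intro z z' hz
    have h1 : iterates M tmix τ α β W ζ z t = iterates M tmix τ α β W ζ z' t :=
      ih fun k hk => hz k (lt_trans hk (Nat.lt_succ_self t))
    change algStep M tmix τ α β (W t) (iterates M tmix τ α β W ζ z t) (z t) =
      algStep M tmix τ α β (W t) (iterates M tmix τ α β W ζ z' t) (z' t)
    rw [h1, hz t (Nat.lt_succ_self t)]

theorem DependsOn.comp_left {ι : Type*} {X : ι → Type*} {β γ : Type*} {F : (∀ i, X i) → β}
    {s : Set ι} (hF : DependsOn F s) (g : β → γ) : DependsOn (fun z => g (F z)) s :=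
  fun _ _ h => congrArg g (hF h)

namespace IsRun

variable {Ω : Type*} [MeasurableSpace Ω] {P : Measure Ω} {Z : ℕ → Ω → Fin n → Transition S A}

theorem measurableSet_eq (hZ : IsRun P M tmix τ α β W ζ Z) (t : ℕ) (i : Fin n)
    (z : Transition S A) : MeasurableSet {ω | Z t ω i = z} := by
  have : {ω | Z t ω i = z} = ⋃ u ∈ {u : Fin n → Transition S A | u i = z}, {ω | Z t ω = u} := by
    ext ω; simp
  rw [this]
  exact MeasurableSet.biUnion (Set.to_countable _) fun u _ => hZ.measurable t u

variable [IsProbabilityMeasure P]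

theorem integrable_comp [Nonempty S] [Nonempty A] (hZ : IsRun P M tmix τ α β W ζ Z) (t : ℕ)
    (f : TeamState n S A → ℝ) :
    Integrable (fun ω => f (iterates M tmix τ α β W ζ (fun k => Z k ω) t)) P :=
  integrable_of_dependsOn (F := fun z => f (iterates M tmix τ α β W ζ z t))
    (Classical.arbitrary _) hZ.measurable ((dependsOn_iterates t).comp_left f)

/-- The conditional mean of a function of the current iterate and of the sample of agent `i`. -/
theorem integral_sample [Nonempty S] [Nonempty A] (hZ : IsRun P M tmix τ α β W ζ Z) (t : ℕ)
    (i : Fin n) (f : TeamState n S A → Transition S A → ℝ) :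
    Integrable (fun ω => f (iterates M tmix τ α β W ζ (fun k => Z k ω) t) (Z t ω i)) P ∧
    ∫ ω, f (iterates M tmix τ α β W ζ (fun k => Z k ω) t) (Z t ω i) ∂P =
      ∫ ω, M.sampleMean (W t) (iterates M tmix τ α β W ζ (fun k => Z k ω) t) i
        (f (iterates M tmix τ α β W ζ (fun k => Z k ω) t)) ∂P := by
  have x₀ : Fin n → Transition S A := Classical.arbitrary _
  have hdep := dependsOn_iterates (M := M) (tmix := tmix) (τ := τ) (α := α) (β := β) (W := W)
    (ζ := ζ) t
  set y : (Fin t → Fin n → Transition S A) → TeamState n S A := fun h =>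
    iterates M tmix τ α β W ζ (extendHistory x₀ h) t with hy
  have hcomp : ∀ ω, iterates M tmix τ α β W ζ (fun k => Z k ω) t = y fun k : Fin t => Z k ω :=
    fun ω => hdep.comp_history (Z := Z) x₀ ω
  simp only [hcomp]
  have hset : ∀ c : (Fin t → Fin n → Transition S A) × Transition S A,
      {ω | ((fun k : Fin t => Z k ω), Z t ω i) = c} =
        {ω | (fun k : Fin t => Z k ω) = c.1} ∩ {ω | Z t ω i = c.2} := fun c => by
    ext ω; simp [Prod.ext_iff]
  have h1 := integral_comp_of_fintype (P := P)
    (fun ω => ((fun k : Fin t => Z k ω), Z t ω i))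
    (fun c => by
      rw [hset]
      exact (measurableSet_history hZ.measurable c.1).inter (hZ.measurableSet_eq t i c.2))
    (fun c => f (y c.1) c.2)
  have h2 := integral_comp_of_fintype (P := P) (fun ω => (fun k : Fin t => Z k ω))
    (measurableSet_history hZ.measurable) (fun h => M.sampleMean (W t) (y h) i (f (y h)))
  refine ⟨h1.1, h1.2.trans (Eq.trans ?_ h2.2.symm)⟩
  rw [Fintype.sum_prod_type]
  refine Finset.sum_congr rfl fun h _ => ?_
  rw [TeamMDP.sampleMean, Finset.mul_sum]
  refine Finset.sum_congr rfl fun z _ => ?_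
  -- Only the conditional law of a single agent's sample is used, so the dependence between agents
  -- never matters.
  have hlaw := hZ.law t i (extendHistory x₀ h) z.1 z.2.1 z.2.2
  have e1 : {ω | (∀ k < t, Z k ω = extendHistory x₀ h k) ∧ Z t ω i = (z.1, z.2.1, z.2.2)} =
      {ω | ((fun k : Fin t => Z k ω), Z t ω i) = (h, z)} := by
    ext ω
    simp only [Set.mem_ofPred_eq, Prod.mk.injEq, history_eq_iff x₀]
  have e2 : {ω | ∀ k < t, Z k ω = extendHistory x₀ h k} =
      {ω | (fun k : Fin t => Z k ω) = h} := by
    ext ω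
    simp only [Set.mem_ofPred_eq, history_eq_iff x₀]
  rw [e1, e2] at hlaw
  rw [hlaw]
  ring

end IsRun

end Run

/-! ### Disagreement about the occupancy measures along a trajectory -/

section Trajectory

variable {n : ℕ} {S A : Type*} [Fintype S] [Fintype A] {M : TeamMDP n S A}
  {G : ℕ → SimpleGraph (Fin n)} {W : ℕ → Matrix (Fin n) (Fin n) ℝ} {η : ℝ} {B : ℕ}
  {τ tmix α β : ℝ} {ζ : S → A → ℝ}

/-- The total disagreement of the agents about their occupancy measures. -/
noncomputable def totalDisagreement (x : TeamState n S A) : ℝ :=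
  ∑ s, ∑ a, disagreement fun i => x.mu i s a

/-- The total deviation of the occupancy measures of `y` from the mixed measures of `x`. -/
noncomputable def totalDeviation (w : Matrix (Fin n) (Fin n) ℝ) (x y : TeamState n S A) : ℝ :=
  ∑ i, ∑ s, ∑ a, |y.mu i s a - mixMu w x i s a|

theorem sum_disagreement_sub_le (hn : 0 < n) (w : Matrix (Fin n) (Fin n) ℝ)
    (x y : TeamState n S A) :
    ∑ s, ∑ a, disagreement ((fun i => y.mu i s a) - w.mulVec fun i => x.mu i s a) ≤
      totalDeviation w x y := by
  refine le_trans (Finset.sum_le_sum fun s _ => ?_) (le_of_eq Finset.sum_comm)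
  refine le_trans (Finset.sum_le_sum fun a _ => ?_) (le_of_eq Finset.sum_comm)
  exact disagreement_le_sum_abs hn _

namespace IsMixingNetwork

/-- Passing from ℓ¹ to ℓ² over the agents costs `√n`, and one further round of mixing does not
increase disagreement. -/
theorem consensusError_le (h : IsMixingNetwork G W η B) (t : ℕ) (x : TeamState n S A) :
    consensusError (W t) x ≤ (1 / (n : ℝ)) * (√n * totalDisagreement x) := by
  refine mul_le_mul_of_nonneg_left ?_ (by positivity)
  rw [totalDisagreement, Finset.sum_comm, Finset.mul_sum]
  refine Finset.sum_le_sum fun s _ => ?_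
  rw [Finset.sum_comm, Finset.mul_sum]
  refine Finset.sum_le_sum fun a _ => ?_
  have h1 := sum_abs_sub_agentMean_le ((W t).mulVec fun i => x.mu i s a)
  rw [h.agentMean_mulVec] at h1
  exact h1.trans (mul_le_mul_of_nonneg_left (h.disagreement_mulVec_le t _) (Real.sqrt_nonneg _))

theorem totalDisagreement_succ_le (h : IsMixingNetwork G W η B) (hn : 0 < n) (t : ℕ)
    (x y : TeamState n S A) :
    totalDisagreement y ≤ totalDisagreement x + totalDeviation (W t) x y := by
  refine le_trans ?_ (add_le_add le_rfl (sum_disagreement_sub_le hn (W t) x y))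
  simp only [totalDisagreement, ← Finset.sum_add_distrib]
  refine Finset.sum_le_sum fun s _ => Finset.sum_le_sum fun a _ => ?_
  have h1 := disagreement_add_le ((W t).mulVec fun i => x.mu i s a)
    ((fun i => y.mu i s a) - (W t).mulVec fun i => x.mu i s a)
  rw [add_sub_cancel] at h1
  linarith [h.disagreement_mulVec_le t fun i => x.mu i s a]

theorem totalDisagreement_window_le (h : IsMixingNetwork G W η B) (hn : 0 < n) (t : ℕ)
    (x : ℕ → TeamState n S A) :
    totalDisagreement (x (t + B)) ≤
      (1 - η / (4 * (n : ℝ) ^ 2)) * totalDisagreement (x t) +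
        ∑ k ∈ Finset.range B, totalDeviation (W (t + k)) (x (t + k)) (x (t + k + 1)) := by
  have h1 : ∑ k ∈ Finset.range B, ∑ s, ∑ a, disagreement ((fun i => (x (t + k + 1)).mu i s a) -
      (W (t + k)).mulVec fun i => (x (t + k)).mu i s a) ≤
      ∑ k ∈ Finset.range B, totalDeviation (W (t + k)) (x (t + k)) (x (t + k + 1)) :=
    Finset.sum_le_sum fun k _ => sum_disagreement_sub_le hn _ _ _
  refine le_trans ?_ (add_le_add le_rfl h1)
  rw [Finset.sum_comm, totalDisagreement, totalDisagreement, Finset.mul_sum,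
    ← Finset.sum_add_distrib]
  refine Finset.sum_le_sum fun s _ => ?_
  rw [Finset.sum_comm, Finset.mul_sum, ← Finset.sum_add_distrib]
  exact Finset.sum_le_sum fun a _ =>
    h.disagreement_perturbed_window hn t fun t i => (x t).mu i s a

end IsMixingNetwork

/-- A sequence that grows by at most `c` per step and contracts over windows of length `B` stays
bounded. -/
theorem le_of_window_contraction {a : ℕ → ℝ} {B : ℕ} {q c : ℝ} (hB : 1 ≤ B) (hq0 : 0 < q)
    (hq1 : q ≤ 1) (hc : 0 ≤ c) (h0 : a 0 ≤ 0) (h1 : ∀ t, a (t + 1) ≤ a t + c)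
    (hw : ∀ t, a (t + B) ≤ (1 - q) * a t + B * c) (t : ℕ) : a t ≤ B * c / q := by
  -- Linear growth covers the times `t < B`, before the first full window; contraction takes over
  -- afterwards.
  have hlin : ∀ t : ℕ, a t ≤ t * c := by
    intro t
    induction t with
    | zero => simpa using h0
    | succ t ih => push_cast; linarith [h1 t]
  induction t using Nat.strong_induction_on with
  | _ t ih =>
    rw [le_div_iff₀ hq0]
    rcases lt_or_ge t B with htB | htB
    · have h2 : (t : ℝ) * c ≤ B * c := mul_le_mul_of_nonneg_right (by exact_mod_cast htB.le) hc
      have h3 : 0 ≤ (B : ℝ) * c := by positivity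
      nlinarith [hlin t]
    · obtain ⟨r, rfl⟩ := Nat.exists_eq_add_of_le' htB
      have h2 := ih r (by omega)
      rw [le_div_iff₀ hq0] at h2
      nlinarith [hw r, mul_le_mul_of_nonneg_left h2 (by linarith : 0 ≤ 1 - q)]

theorem initState_isFeasible (htmix : 0 ≤ tmix) (hζ : ζ ∈ occSet S A τ) (hζ0 : ∀ s a, 0 < ζ s a) :
    (initState n ζ).IsFeasible τ tmix :=
  ⟨fun _ => hζ0, fun _ => hζ, fun _ _ => by simp [initState, htmix]⟩

variable [DecidableEq S] [DecidableEq A]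

theorem iterates_isFeasible [Nonempty S] [Nonempty A] (hτ : 1 < τ) (htmix : 0 ≤ tmix)
    (h : IsMixingNetwork G W η B) (hζ : ζ ∈ occSet S A τ) (hζ0 : ∀ s a, 0 < ζ s a)
    (z : ℕ → Fin n → Transition S A) (t : ℕ) :
    (iterates M tmix τ α β W ζ z t).IsFeasible τ tmix := by
  induction t with
  | zero => exact initState_isFeasible htmix hζ hζ0
  | succ t ih => exact algStep_isFeasible hτ htmix h t ih (z t)

/-- With step size zero the occupancy measures do not move. -/
theorem iterates_mu_eq_of_step_eq_zero [Nonempty S] [Nonempty A] (hτ : 1 < τ) (htmix : 0 ≤ tmix)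
    (h : IsMixingNetwork G W η B) (hζ : ζ ∈ occSet S A τ) (hζ0 : ∀ s a, 0 < ζ s a)
    (z : ℕ → Fin n → Transition S A) (t : ℕ) (i : Fin n) :
    (iterates M tmix τ α 0 W ζ z t).mu i = ζ := by
  induction t generalizing i with
  | zero => rfl
  | succ t ih =>
    have hx := iterates_isFeasible (M := M) (α := α) (β := 0) hτ htmix h hζ hζ0 z t
    have hx' := iterates_isFeasible (M := M) (α := α) (β := 0) hτ htmix h hζ hζ0 z (t + 1)
    have hmix : mixMu (W t) (iterates M tmix τ α 0 W ζ z t) i = ζ := by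
      funext s a
      simp only [mixMu, ih, ← Finset.sum_mul, h.row_sum, one_mul]
    have h1 := klDist_algStep_le (M := M) (α := α) hτ h t hx le_rfl (z t) i hζ
    have h2 : klDist ζ ζ = 0 := by rw [klDist_eq_sub hζ0]; simp
    rw [hmix, h2] at h1
    simp [dualGrad] at h1
    exact (eq_of_klDist_nonpos hζ.1 (hx'.mu_pos i) hζ.2.1 (hx'.mu_mem i).2.1 h1).symm

end Trajectory

/-! ### Expected consensus error and expected gap -/

namespace IsRun

variable {n : ℕ} {S A : Type*} [Fintype S] [Fintype A] [DecidableEq S] [DecidableEq A]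
  [Nonempty S] [Nonempty A] {M : TeamMDP n S A} {G : ℕ → SimpleGraph (Fin n)}
  {W : ℕ → Matrix (Fin n) (Fin n) ℝ} {η : ℝ} {B : ℕ} {τ tmix α β : ℝ} {ζ : S → A → ℝ}
  {Ω : Type*} [MeasurableSpace Ω] {P : Measure Ω} [IsProbabilityMeasure P]
  {Z : ℕ → Ω → Fin n → Transition S A}

theorem integrable_comp_pair (hZ : IsRun P M tmix τ α β W ζ Z) (t : ℕ)
    (f : TeamState n S A → TeamState n S A → ℝ) :
    Integrable (fun ω => f (iterates M tmix τ α β W ζ (fun k => Z k ω) t)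
      (iterates M tmix τ α β W ζ (fun k => Z k ω) (t + 1))) P := by
  refine integrable_of_dependsOn (t := t + 1) (F := fun z => f (iterates M tmix τ α β W ζ z t)
    (iterates M tmix τ α β W ζ z (t + 1))) (Classical.arbitrary _) hZ.measurable ?_
  intro z z' hz
  have h1 : iterates M tmix τ α β W ζ z t = iterates M tmix τ α β W ζ z' t :=
    dependsOn_iterates t fun k hk => hz k (lt_trans hk (Nat.lt_succ_self t))
  have h2 : iterates M tmix τ α β W ζ z (t + 1) = iterates M tmix τ α β W ζ z' (t + 1) :=
    dependsOn_iterates (t + 1) hz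
  simp only [h1, h2]

/-- The mean deviation of the new occupancy measures from the mixed ones is of order `β`. -/
theorem integral_totalDeviation_le (hZ : IsRun P M tmix τ α β W ζ Z) (hτ : 1 < τ)
    (htmix : 0 ≤ tmix) (h : IsMixingNetwork G W η B) (hζ : ζ ∈ occSet S A τ)
    (hζ0 : ∀ s a, 0 < ζ s a) (hβ : 0 < β) (t : ℕ) :
    ∫ ω, totalDeviation (W t) (iterates M tmix τ α β W ζ (fun k => Z k ω) t)
      (iterates M tmix τ α β W ζ (fun k => Z k ω) (t + 1)) ∂P ≤
      n * (4 * β * (1 + 4 * tmix) * (Fintype.card S * Fintype.card A)) := by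
  set x : Ω → ℕ → TeamState n S A := fun ω => iterates M tmix τ α β W ζ fun k => Z k ω with hx
  have hfeas : ∀ ω t, (x ω t).IsFeasible τ tmix := fun ω t =>
    iterates_isFeasible hτ htmix h hζ hζ0 _ t
  set N : ℝ := Fintype.card S * Fintype.card A with hN
  have hN1 : 1 ≤ N := by
    have h1 : (1 : ℝ) ≤ Fintype.card S := by exact_mod_cast Fintype.card_pos
    have h2 : (1 : ℝ) ≤ Fintype.card A := by exact_mod_cast Fintype.card_pos
    nlinarith
  -- The deviation is at most `√(4Q) ≤ θ + Q/θ`, which avoids integrating a square root. This `θ`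
  -- satisfies `θ² ≥ E Q`, so the mean is at most `2θ`. Having `N` rather than `√N` is affordable,
  -- as the dual second moment carries `N` too.
  set θ : ℝ := 2 * β * (1 + 4 * tmix) * N with hθ
  have hθ0 : 0 < θ := by positivity
  set Q : TeamState n S A → Fin n → Transition S A → ℝ := fun y i z =>
    ∑ s, ∑ a, mixMu (W t) y i s a * dualGrad M tmix β (W t) y i z s a ^ 2 with hQ
  have hpath : ∀ ω, totalDeviation (W t) (x ω t) (x ω (t + 1)) ≤
      ∑ i, (θ + 1 / θ * Q (x ω t) i (Z t ω i)) := by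
    intro ω
    refine Finset.sum_le_sum fun i _ => ?_
    have h1 := sq_sum_abs_algStep_sub_mixMu_le (M := M) (α := α) hτ htmix h t (hfeas ω t) hβ.le
      (fun i => Z t ω i) i
    have hQ0 : 0 ≤ Q (x ω t) i (Z t ω i) := Finset.sum_nonneg fun s _ => Finset.sum_nonneg fun a _ =>
      mul_nonneg (h.mixMu_pos t (hfeas ω t) i s a).le (sq_nonneg _)
    refine le_of_sq_le_sq (h1.trans ?_) (by positivity)
    have h2 : θ * (1 / θ * Q (x ω t) i (Z t ω i)) = Q (x ω t) i (Z t ω i) := by field_simp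
    change 4 * Q (x ω t) i (Z t ω i) ≤ _
    nlinarith [sq_nonneg (θ - 1 / θ * Q (x ω t) i (Z t ω i))]
  have hQint := fun i => hZ.integral_sample t i fun y z => Q y i z
  have hQle : ∀ i, ∫ ω, Q (x ω t) i (Z t ω i) ∂P ≤ 4 * β ^ 2 * (1 + 4 * tmix) ^ 2 * N := by
    intro i
    rw [(hQint i).2]
    calc _ ≤ ∫ _ω : Ω, 4 * β ^ 2 * (1 + 4 * tmix) ^ 2 * N ∂P :=
          integral_mono (hZ.integrable_comp t fun y => M.sampleMean (W t) y i (Q y i))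
            (integrable_const _)
            fun ω => sampleMean_sum_mul_dualGrad_sq_le h t (hfeas ω t) i
      _ = _ := by simp
  have hterm : ∀ i, Integrable (fun ω => θ + 1 / θ * Q (x ω t) i (Z t ω i)) P := fun i =>
    (integrable_const _).add ((hQint i).1.const_mul _)
  calc _ ≤ ∫ ω, ∑ i, (θ + 1 / θ * Q (x ω t) i (Z t ω i)) ∂P :=
        integral_mono (hZ.integrable_comp_pair t fun y y' => totalDeviation (W t) y y')
          (integrable_finsetSum _ fun i _ => hterm i) hpath
    _ = ∑ i, (θ + 1 / θ * ∫ ω, Q (x ω t) i (Z t ω i) ∂P) := by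
        rw [integral_finsetSum _ fun i _ => hterm i]
        refine Finset.sum_congr rfl fun i _ => ?_
        rw [integral_add (integrable_const _) ((hQint i).1.const_mul _),
          integral_const_mul (1 / θ), integral_const, probReal_univ, one_smul]
    _ ≤ ∑ _i : Fin n, 2 * θ := by
        refine Finset.sum_le_sum fun i _ => ?_
        have h3 : 1 / θ * ∫ ω, Q (x ω t) i (Z t ω i) ∂P ≤ θ := by
          rw [one_div_mul_eq_div, div_le_iff₀ hθ0]
          refine (hQle i).trans ?_
          have : θ * θ = 4 * β ^ 2 * (1 + 4 * tmix) ^ 2 * N * N := by rw [hθ]; ring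
          rw [this]
          exact le_mul_of_one_le_right (by positivity) hN1
        linarith
    _ = _ := by
        rw [Finset.sum_const, Finset.card_univ, Fintype.card_fin, nsmul_eq_mul, hθ]; ring

theorem integral_totalDisagreement_le (hZ : IsRun P M tmix τ α β W ζ Z) (hτ : 1 < τ)
    (htmix : 0 ≤ tmix) (h : IsMixingNetwork G W η B) (hn : 0 < n) (hζ : ζ ∈ occSet S A τ)
    (hζ0 : ∀ s a, 0 < ζ s a) (hβ : 0 < β) (t : ℕ) :
    ∫ ω, totalDisagreement (iterates M tmix τ α β W ζ (fun k => Z k ω) t) ∂P ≤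
      n * (4 * β * (1 + 4 * tmix) * (Fintype.card S * Fintype.card A)) * netD n η B := by
  set x : Ω → ℕ → TeamState n S A := fun ω => iterates M tmix τ α β W ζ fun k => Z k ω with hx
  set c : ℝ := n * (4 * β * (1 + 4 * tmix) * (Fintype.card S * Fintype.card A)) with hc
  have hc0 : 0 ≤ c := by positivity
  have hdis := fun t => hZ.integrable_comp t totalDisagreement
  have hdev := fun t => hZ.integrable_comp_pair t fun y y' => totalDeviation (W t) y y'
  have hdevle := fun t => hZ.integral_totalDeviation_le hτ htmix h hζ hζ0 hβ t
  have hη := h.eta_pos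
  have hn' : (1 : ℝ) ≤ n := by exact_mod_cast hn
  have hq1 : η / (4 * (n : ℝ) ^ 2) ≤ 1 := by
    rw [div_le_one (by positivity)]; nlinarith [h.eta_lt_one]
  refine (le_of_window_contraction (a := fun t => ∫ ω, totalDisagreement (x ω t) ∂P) h.B_pos
    (by positivity) hq1 hc0 ?_ (fun t => ?_) (fun t => ?_) t).trans ?_
  · have : ∀ ω, totalDisagreement (x ω 0) = 0 := fun ω => by
      have hn0 : (n : ℝ) ≠ 0 := by positivity
      simp [hx, iterates, initState, totalDisagreement, disagreement, agentMean, hn0]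
    simp [this]
  · calc _ ≤ ∫ ω, (totalDisagreement (x ω t) + totalDeviation (W t) (x ω t) (x ω (t + 1))) ∂P :=
          integral_mono (hdis (t + 1)) ((hdis t).add (hdev t))
            fun ω => h.totalDisagreement_succ_le hn t _ _
      _ ≤ _ := by
          rw [integral_add (hdis t) (hdev t)]
          exact add_le_add le_rfl (hdevle t)
  · have hsum : Integrable (fun ω => ∑ k ∈ Finset.range B, totalDeviation (W (t + k)) (x ω (t + k))
        (x ω (t + k + 1))) P := integrable_finsetSum _ fun k _ => hdev (t + k)
    calc _ ≤ ∫ ω, ((1 - η / (4 * (n : ℝ) ^ 2)) * totalDisagreement (x ω t) +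
          ∑ k ∈ Finset.range B, totalDeviation (W (t + k)) (x ω (t + k)) (x ω (t + k + 1))) ∂P :=
          integral_mono (hdis (t + B)) (((hdis t).const_mul _).add hsum)
            fun ω => h.totalDisagreement_window_le hn t (x ω)
      _ ≤ _ := by
          rw [integral_add ((hdis t).const_mul _) hsum, integral_const_mul,
            integral_finsetSum _ fun k _ => hdev (t + k)]
          refine add_le_add le_rfl ?_
          calc _ ≤ ∑ _k ∈ Finset.range B, c := Finset.sum_le_sum fun k _ => hdevle (t + k)
            _ = B * c := by simp
  · have := mul_le_mul_of_nonneg_left (h.le_netD hn) hc0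
    refine le_trans (le_of_eq ?_) this
    ring

theorem integral_consensusError_le (hZ : IsRun P M tmix τ α β W ζ Z) (hτ : 1 < τ)
    (htmix : 0 ≤ tmix) (h : IsMixingNetwork G W η B) (hn : 0 < n) (hζ : ζ ∈ occSet S A τ)
    (hζ0 : ∀ s a, 0 < ζ s a) (hβ : 0 < β) (t : ℕ) :
    ∫ ω, consensusError (W t) (iterates M tmix τ α β W ζ (fun k => Z k ω) t) ∂P ≤
      4 * β * (√n * Fintype.card S * Fintype.card A * (1 + 4 * tmix) * netD n η B) := by
  have hn' : (0 : ℝ) < n := by exact_mod_cast hn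
  calc _ ≤ ∫ ω, (1 / (n : ℝ)) * (√n *
        totalDisagreement (iterates M tmix τ α β W ζ (fun k => Z k ω) t)) ∂P :=
        integral_mono (hZ.integrable_comp t (consensusError (W t)))
          (hZ.integrable_comp t fun y => (1 / (n : ℝ)) * (√n * totalDisagreement y))
          fun ω => h.consensusError_le t _
    _ = (1 / (n : ℝ)) * (√n *
        ∫ ω, totalDisagreement (iterates M tmix τ α β W ζ (fun k => Z k ω) t) ∂P) := by
        rw [integral_const_mul, integral_const_mul]
    _ ≤ (1 / (n : ℝ)) * (√n *
        (n * (4 * β * (1 + 4 * tmix) * (Fintype.card S * Fintype.card A)) * netD n η B)) :=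
        mul_le_mul_of_nonneg_left (mul_le_mul_of_nonneg_left
          (hZ.integral_totalDisagreement_le hτ htmix h hn hζ hζ0 hβ t) (Real.sqrt_nonneg _))
          (by positivity)
    _ = _ := by field_simp

/-- The mean change of the potential in one round. -/
theorem integral_potential_succ_le (hZ : IsRun P M tmix τ α β W ζ Z) (hτ : 1 < τ)
    (htmix : 1 ≤ tmix) (h : IsMixingNetwork G W η B) (hn : 0 < n) (hζ : ζ ∈ occSet S A τ)
    (hζ0 : ∀ s a, 0 < ζ s a) (hβ : 0 < β) (hα : α = Fintype.card S * tmix ^ 2 * β)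
    {muStar : S → A → ℝ} (hmu : M.IsOccupancy muStar) (hmu' : muStar ∈ occSet S A τ) {l : ℝ}
    {vStar : S → ℝ} (hl : l ≤ ∑ s, ∑ a, muStar s a * M.teamReward s a)
    (hv : ∀ s, |vStar s| ≤ 2 * tmix) (t : ℕ) :
    ∫ ω, potential tmix muStar vStar (iterates M tmix τ α β W ζ (fun k => Z k ω) (t + 1)) ∂P +
      β * ∫ ω, ∑ s, ∑ a, avgMu (iterates M tmix τ α β W ζ (fun k => Z k ω) t) s a *
        M.advantage l vStar s a ∂P ≤
      ∫ ω, potential tmix muStar vStar (iterates M tmix τ α β W ζ (fun k => Z k ω) t) ∂P +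
      9 * β ^ 2 *
        (√n * Fintype.card S * Fintype.card A * (1 + 4 * tmix) ^ 2 * netD n η B) := by
  set x : Ω → ℕ → TeamState n S A := fun ω => iterates M tmix τ α β W ζ fun k => Z k ω with hx
  have htmix0 : 0 ≤ tmix := by linarith
  have hfeas : ∀ ω t, (x ω t).IsFeasible τ tmix := fun ω t =>
    iterates_isFeasible hτ htmix0 h hζ hζ0 _ t
  set gain := sampleGain M tmix α β muStar vStar (W t) with hgain
  set gap : TeamState n S A → ℝ := fun y => ∑ s, ∑ a, avgMu y s a * M.advantage l vStar s a
    with hgap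
  set κ := 4 * (1 + 4 * tmix) ^ 2 * (Fintype.card S * Fintype.card A) +
    Fintype.card S * tmix ^ 2 / η with hκ
  have hpot := fun t => hZ.integrable_comp t (potential tmix muStar vStar)
  have hgaint := fun i => hZ.integral_sample t i fun y z => gain y i z
  have hgainsum : Integrable (fun ω => (1 / (n : ℝ)) * ∑ i, gain (x ω t) i (Z t ω i)) P :=
    (integrable_finsetSum _ fun i _ => (hgaint i).1).const_mul _
  have hmean := fun i => hZ.integrable_comp t fun y => M.sampleMean (W t) y i (gain y i)
  have hgapint := hZ.integrable_comp t gap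
  have hcons := hZ.integrable_comp t (consensusError (W t))
  have h1 : ∫ ω, potential tmix muStar vStar (x ω (t + 1)) ∂P ≤
      ∫ ω, potential tmix muStar vStar (x ω t) ∂P +
        ∫ ω, (1 / (n : ℝ)) * ∑ i, gain (x ω t) i (Z t ω i) ∂P := by
    rw [← integral_add (hpot t) hgainsum]
    exact integral_mono (hpot (t + 1)) ((hpot t).add hgainsum) fun ω =>
      potential_algStep_le hτ htmix0 h t (hfeas ω t) hβ.le hmu' hv _
  have h2 : ∫ ω, (1 / (n : ℝ)) * ∑ i, gain (x ω t) i (Z t ω i) ∂P =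
      ∫ ω, (1 / (n : ℝ)) * ∑ i, M.sampleMean (W t) (x ω t) i (gain (x ω t) i) ∂P := by
    rw [integral_const_mul, integral_const_mul, integral_finsetSum _ fun i _ => (hgaint i).1,
      integral_finsetSum _ fun i _ => hmean i]
    congr 1
    exact Finset.sum_congr rfl fun i _ => (hgaint i).2
  have h3 : ∫ ω, (1 / (n : ℝ)) * ∑ i, M.sampleMean (W t) (x ω t) i (gain (x ω t) i) ∂P ≤
      -(β * ∫ ω, gap (x ω t) ∂P) + β * ∫ ω, consensusError (W t) (x ω t) ∂P + β ^ 2 * κ := by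
    have hi1 : Integrable (fun ω => -(β * gap (x ω t))) P := (hgapint.const_mul β).neg
    have hi2 : Integrable (fun ω => β * consensusError (W t) (x ω t)) P := hcons.const_mul β
    have hi3 : Integrable (fun ω => -(β * gap (x ω t)) + β * consensusError (W t) (x ω t)) P :=
      hi1.add hi2
    calc _ ≤ ∫ ω, (-(β * gap (x ω t)) + β * consensusError (W t) (x ω t) + β ^ 2 * κ) ∂P :=
          integral_mono ((integrable_finsetSum _ fun i _ => hmean i).const_mul _)
            (hi3.add (integrable_const _)) fun ω =>
            sum_sampleMean_sampleGain_le hn (by linarith) h t (hfeas ω t) hβ.le hα hmu hl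
      _ = _ := by
          rw [integral_add hi3 (integrable_const _), integral_add hi1 hi2, integral_neg,
            integral_const_mul, integral_const_mul]
          simp
  have h4 := hZ.integral_consensusError_le hτ htmix0 h hn hζ hζ0 hβ t
  have hD := h.le_netD hn
  have hη := h.eta_pos
  have hη1 := h.eta_lt_one
  have hn' : (1 : ℝ) ≤ n := by exact_mod_cast hn
  have hB : (1 : ℝ) ≤ B := by exact_mod_cast h.B_pos
  -- This absorbs into `D` the factor `1/η` of the primal second moment.
  have hDη : 1 / η ≤ netD n η B := by
    refine le_trans ?_ hD
    rw [div_div_eq_mul_div, div_le_div_iff_of_pos_right hη]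
    nlinarith
  have hD1 : 1 ≤ netD n η B := by
    refine le_trans ?_ hDη
    rw [le_div_iff₀ hη]; linarith
  have hsn : 1 ≤ √(n : ℝ) := Real.one_le_sqrt.2 hn'
  have hS : (1 : ℝ) ≤ Fintype.card S := by exact_mod_cast Fintype.card_pos
  have hA : (1 : ℝ) ≤ Fintype.card A := by exact_mod_cast Fintype.card_pos
  set D := netD n η B
  set s := √(n : ℝ)
  set m : ℝ := (Fintype.card S : ℝ)
  set K : ℝ := (Fintype.card A : ℝ)
  set R := s * m * K * (1 + 4 * tmix) ^ 2 * D with hR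
  have hu : 1 ≤ 1 + 4 * tmix := by linarith
  have hsD : 1 ≤ s * D := by nlinarith
  -- The constant 9 is `4 + 1 + 4`: the dual second moment, the primal second moment and the
  -- consensus error.
  have k1 : 4 * (1 + 4 * tmix) ^ 2 * (m * K) ≤ 4 * R := by
    have : 4 * R = 4 * (1 + 4 * tmix) ^ 2 * (m * K) * (s * D) := by rw [hR]; ring
    rw [this]
    exact le_mul_of_one_le_right (by positivity) hsD
  have k2 : m * tmix ^ 2 / η ≤ R := by
    have e1 : m * tmix ^ 2 / η = m * (tmix ^ 2 * (1 / η)) := by ring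
    have e2 : R = m * ((1 + 4 * tmix) ^ 2 * D) * (s * K) := by rw [hR]; ring
    rw [e1, e2]
    have e3 : tmix ^ 2 * (1 / η) ≤ (1 + 4 * tmix) ^ 2 * D :=
      mul_le_mul (by nlinarith) hDη (by positivity) (by positivity)
    refine (mul_le_mul_of_nonneg_left e3 (by positivity)).trans ?_
    exact le_mul_of_one_le_right (by positivity) (by nlinarith)
  have k3 : 4 * β * (s * m * K * (1 + 4 * tmix) * D) ≤ 4 * β * R := by
    refine mul_le_mul_of_nonneg_left ?_ (by positivity)
    have : R = s * m * K * (1 + 4 * tmix) * D * (1 + 4 * tmix) := by rw [hR]; ring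
    rw [this]
    exact le_mul_of_one_le_right (by positivity) hu
  have k4 := mul_le_mul_of_nonneg_left (h4.trans k3) hβ.le
  have k5 := mul_le_mul_of_nonneg_left (add_le_add k1 k2) (sq_nonneg β)
  rw [h2] at h1
  linarith

/-- The mean suboptimality, averaged over the iterates. -/
theorem integral_average_gap_le (hZ : IsRun P M tmix τ α β W ζ Z) (hτ : 1 < τ)
    (htmix : 1 ≤ tmix) (h : IsMixingNetwork G W η B) (hn : 0 < n) (hζ : ζ ∈ occSet S A τ)
    (hζ0 : ∀ s a, 0 < ζ s a) (hβ : 0 < β) (hα : α = Fintype.card S * tmix ^ 2 * β)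
    {muStar : S → A → ℝ} (hmu : M.IsOccupancy muStar) (hmu' : muStar ∈ occSet S A τ) {l : ℝ}
    {vStar : S → ℝ} (hl : l ≤ ∑ s, ∑ a, muStar s a * M.teamReward s a)
    (hadv : M.SolvesBellman l vStar) (hv : ∀ s, |vStar s| ≤ 2 * tmix) {T : ℕ} (hT : 1 ≤ T) :
    ∫ ω, (1 / (T : ℝ)) * ∑ t ∈ Finset.Icc 1 T, ∑ s, ∑ a,
        avgMu (iterates M tmix τ α β W ζ (fun k => Z k ω) t) s a * M.advantage l vStar s a ∂P ≤
      lyapunov tmix muStar vStar (initState n ζ) / (β * T) + 18 * β *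
        (√n * Fintype.card S * Fintype.card A * (1 + 4 * tmix) ^ 2 * netD n η B) := by
  set x : Ω → ℕ → TeamState n S A := fun ω => iterates M tmix τ α β W ζ fun k => Z k ω with hx
  have htmix0 : 0 ≤ tmix := by linarith
  have hfeas : ∀ ω t, (x ω t).IsFeasible τ tmix := fun ω t =>
    iterates_isFeasible hτ htmix0 h hζ hζ0 _ t
  set gap : TeamState n S A → ℝ := fun y => ∑ s, ∑ a, avgMu y s a * M.advantage l vStar s a
    with hgap
  set R := √n * Fintype.card S * Fintype.card A * (1 + 4 * tmix) ^ 2 * netD n η B with hR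
  set E := lyapunov tmix muStar vStar (initState n ζ) with hE
  have hgap0 : ∀ ω t, 0 ≤ gap (x ω t) := fun ω t =>
    Finset.sum_nonneg fun s _ => Finset.sum_nonneg fun a _ =>
      mul_nonneg ((avgMu_mem hn (hfeas ω t)).1 s a) (hadv.advantage_nonneg s a)
  have hgapint := fun t => hZ.integrable_comp t gap
  have hstep := fun t => hZ.integral_potential_succ_le hτ htmix h hn hζ hζ0 hβ hα hmu hmu' hl hv t
  have htel : ∀ K : ℕ, ∫ ω, potential tmix muStar vStar (x ω K) ∂P +
      β * ∑ t ∈ Finset.range K, ∫ ω, gap (x ω t) ∂P ≤ E + K * (9 * β ^ 2 * R) := by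
    intro K
    induction K with
    | zero =>
      have : ∀ ω, potential tmix muStar vStar (x ω 0) = E := fun ω => potential_initState hn ζ
      simp [this]
    | succ K ih =>
      rw [Finset.sum_range_succ]
      push_cast
      linarith [hstep K]
  have hpot0 : 0 ≤ ∫ ω, potential tmix muStar vStar (x ω (T + 1)) ∂P :=
    integral_nonneg fun ω => potential_nonneg hmu' (hfeas ω _)
  -- The output averages times `1` to `T`, whereas the telescoped sum starts at `0`. The extra gap
  -- is nonnegative, and `T + 1 ≤ 2T` turns 9 into 18.
  have hsub : ∑ t ∈ Finset.Icc 1 T, ∫ ω, gap (x ω t) ∂P ≤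
      ∑ t ∈ Finset.range (T + 1), ∫ ω, gap (x ω t) ∂P :=
    Finset.sum_le_sum_of_subset_of_nonneg
      (fun t ht => Finset.mem_range.2 (Nat.lt_succ_of_le (Finset.mem_Icc.1 ht).2))
      fun t _ _ => integral_nonneg fun ω => hgap0 ω t
  have hT' : (1 : ℝ) ≤ T := by exact_mod_cast hT
  have hR0 : 0 ≤ R := by
    have : 0 ≤ netD n η B := le_trans (by have := h.eta_pos; positivity) (h.le_netD hn)
    positivity
  rw [integral_const_mul, integral_finsetSum _ fun t _ => hgapint t, one_div_mul_eq_div,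
    div_le_iff₀ (by linarith)]
  have h1 := htel (T + 1)
  push_cast at h1
  have h2 := mul_le_mul_of_nonneg_left hsub hβ.le
  have h3 : (T + 1) * (9 * β ^ 2 * R) ≤ 2 * T * (9 * β ^ 2 * R) :=
    mul_le_mul_of_nonneg_right (by linarith) (by positivity)
  have h4 : (E / (β * T) + 18 * β * R) * T = (E + 18 * β ^ 2 * R * T) / β := by
    field_simp
  rw [h4, le_div_iff₀ hβ]
  linarith

end IsRun

/-! ### From the mean to probability, and the choice of constants -/

theorem two_thirds_le_measureReal_lt {Ω : Type*} [MeasurableSpace Ω] {P : Measure Ω}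
    [IsProbabilityMeasure P] {f : Ω → ℝ} (hf : Integrable f P) (hf0 : ∀ ω, 0 ≤ f ω) {δ : ℝ}
    (hδ : 0 < δ) (h : 3 * ∫ ω, f ω ∂P ≤ δ) : 2 / 3 ≤ P.real {ω | f ω < δ} := by
  -- Markov's inequality: the event `δ ≤ f` has probability at most 1/3.
  have h1 := mul_meas_ge_le_integral_of_nonneg (Eventually.of_forall hf0) hf δ
  have h2 : (1 : ℝ) ≤ P.real {ω | f ω < δ} + P.real {ω | δ ≤ f ω} := by
    have : {ω | f ω < δ} ∪ {ω | δ ≤ f ω} = Set.univ := by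
      ext ω; simp [lt_or_ge]
    calc (1 : ℝ) = P.real ({ω | f ω < δ} ∪ {ω | δ ≤ f ω}) := by rw [this]; simp
      _ ≤ _ := measureReal_union_le _ _
  nlinarith

/-- With the prescribed step size and number of iterations, the bound on the mean suboptimality is
at most a third of the target. -/
theorem three_mul_bound_le {c₁ c₂ E R ε τ T β₀ β : ℝ} (hc₁ : 0 < c₁) (hc₂ : c₁ ≤ c₂)
    (hR : 0 < R) (hε : 0 < ε) (hτ : 0 < τ) (hT : 0 < T) (hβ₀ : 0 < β₀)
    (hβ₀sq : β₀ ^ 2 * (R * T) = E) (hβ₁ : c₁ * β₀ ≤ β) (hβ₂ : β ≤ c₂ * β₀)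
    (hTbig : (3 * (1 / c₁ + 18 * c₂)) ^ 2 * (τ ^ 2 * R * E / ε ^ 2) ≤ T) :
    3 * (E / (β * T) + 18 * β * R) ≤ ε / τ := by
  have hc₂' : 0 < c₂ := hc₁.trans_le hc₂
  -- Since `E = β₀² R T`, both terms are multiples of `β₀ R`: the first by at most `1/c₁`, as `β ≥
  -- c₁ β₀`, the second by at most `18 c₂`, as `β ≤ c₂ β₀`. The hypothesis on `T` says that `k β₀ R
  -- τ ≤ ε`, squared.
  set k := 3 * (1 / c₁ + 18 * c₂) with hk
  have hβ : 0 < β := lt_of_lt_of_le (by positivity) hβ₁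
  have h1 : E / (β * T) ≤ β₀ * R * (1 / c₁) := by
    rw [div_le_iff₀ (by positivity), ← hβ₀sq]
    calc β₀ ^ 2 * (R * T) = β₀ * R * (1 / c₁) * (c₁ * β₀ * T) := by field_simp
      _ ≤ β₀ * R * (1 / c₁) * (β * T) := mul_le_mul_of_nonneg_left
          (mul_le_mul_of_nonneg_right hβ₁ hT.le) (by positivity)
  have h2 : 18 * β * R ≤ β₀ * R * (18 * c₂) := by nlinarith
  have h3 : k * (β₀ * R) ≤ ε / τ := by
    rw [le_div_iff₀ hτ]
    refine le_of_sq_le_sq ?_ hε.le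
    rw [mul_div_assoc', div_le_iff₀ (by positivity), ← hβ₀sq] at hTbig
    have h4 : (k * (β₀ * R) * τ) ^ 2 * T ≤ ε ^ 2 * T := by
      refine le_trans (le_of_eq ?_) (hTbig.trans (le_of_eq ?_)) <;> ring
    exact le_of_mul_le_mul_right h4 hT
  calc 3 * (E / (β * T) + 18 * β * R) ≤ 3 * (β₀ * R * (1 / c₁) + β₀ * R * (18 * c₂)) := by linarith
    _ = k * (β₀ * R) := by rw [hk]; ring
    _ ≤ ε / τ := h3

theorem lemma2 (c₁ c₂ : ℝ) (hc₁ : 0 < c₁) (hc₂ : c₁ ≤ c₂) :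
    ∃ C : ℝ, 0 < C ∧
      ∀ (n : ℕ) (_ : 0 < n)
        (S : Type*) [Fintype S] [DecidableEq S]
        (Act : Fin n → Type*) [∀ i, Fintype (Act i)] [∀ i, DecidableEq (Act i)]
        (M : TeamMDP n S (∀ i, Act i)) (tmix τ : ℝ)
        (_ : M.IsIrreducible) (_ : M.IsTauStationary τ) (_ : M.IsMixing tmix)
        (G : ℕ → SimpleGraph (Fin n)) (W : ℕ → Matrix (Fin n) (Fin n) ℝ) (η : ℝ) (B : ℕ)
        (_ : IsMixingNetwork G W η B)
        (muStar : S → (∀ i, Act i) → ℝ) (vStar : S → ℝ)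
        (_ : M.IsOptOccupancy muStar)
        (_ : M.SolvesBellman M.optAvgReward vStar)
        (_ : ∑ s, vStar s * ∑ a, muStar s a = 0)
        (ζ : S → (∀ i, Act i) → ℝ)
        (_ : ζ ∈ occSet S (∀ i, Act i) τ) (_ : ∀ s a, 0 < ζ s a)
        (E₀ : ℝ) (_ : E₀ = lyapunov tmix muStar vStar (initState n ζ))
        (ε : ℝ) (_ : 0 < ε) (T : ℕ) (_ : 1 ≤ T)
        (_ : C * (τ ^ 2 * (1 + 4 * tmix) ^ 2 *
            (Real.sqrt n * E₀ * Fintype.card S * Fintype.card (∀ i, Act i) * netD n η B) / ε ^ 2)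
          ≤ T)
        (β₀ α β : ℝ)
        (_ : β₀ = Real.sqrt (E₀ / (Real.sqrt n * Fintype.card S * Fintype.card (∀ i, Act i) *
            (1 + 4 * tmix) ^ 2 * netD n η B * T)))
        (_ : c₁ * β₀ ≤ β) (_ : β ≤ c₂ * β₀)
        (_ : α = Fintype.card S * tmix ^ 2 * β)
        (Ω : Type*) [MeasurableSpace Ω] (P : Measure Ω) [IsProbabilityMeasure P]
        (Z : ℕ → Ω → Fin n → Transition S (∀ i, Act i))
        (_ : IsRun P M tmix τ α β W ζ Z),
        2 / 3 ≤ P.real {ω | ∃ l : ℝ,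
          M.HasAvgReward
            (outputPolicy (iterates M tmix τ α β W ζ (fun t => Z t ω)) T) l ∧
          M.optAvgReward - ε ≤ l} := by
  have hc₂' : 0 < c₂ := hc₁.trans_le hc₂
  refine ⟨(3 * (1 / c₁ + 18 * c₂)) ^ 2, by positivity, ?_⟩
  intro n hn S _ _ Act _ _ M tmix τ _ hτ hmix G W η B hnet muStar vStar hopt hbell hnorm ζ hζ hζ0 E₀
    hE ε hε T hT hTbig β₀ α β hβ₀ hβ₁ hβ₂ hα Ω _ P _ Z hZ
  -- A measure of total mass one exists, so there are a state and a joint action.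
  obtain ⟨s₀, a₀⟩ : Nonempty (S × ∀ i, Act i) := by
    by_contra hemp
    rw [not_nonempty_iff] at hemp
    have h1 := hopt.1.2.1
    rw [← Fintype.sum_prod_type'] at h1
    simp at h1
  have : Nonempty S := ⟨s₀⟩
  have : Nonempty (∀ i, Act i) := ⟨a₀⟩
  obtain ⟨g, hpol, -⟩ := hbell.exists_greedy
  have htmix := hmix.one_le hpol
  have htmix0 : 0 ≤ tmix := by linarith
  have hτ1 := hτ.1
  have hmu := hτ.mem_occSet hopt.1
  have hl := hbell.le_sum_mul_teamReward hopt
  have hv : ∀ s, |vStar s| ≤ 2 * tmix := hbell.abs_le hmix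
    (fun s => Finset.sum_nonneg fun a _ => hmu.1 s a) hmu.2.1 hnorm
  set x : Ω → ℕ → TeamState n S (∀ i, Act i) := fun ω =>
    iterates M tmix τ α β W ζ fun t => Z t ω with hx
  have hfeas : ∀ ω t, (x ω t).IsFeasible τ tmix := fun ω t =>
    iterates_isFeasible hτ1 htmix0 hnet hζ hζ0 _ t
  set gap : TeamState n S (∀ i, Act i) → ℝ := fun y =>
    ∑ s, ∑ a, avgMu y s a * M.advantage M.optAvgReward vStar s a with hgap
  set good : Set Ω := {ω | ∃ l : ℝ, M.HasAvgReward (outputPolicy (x ω) T) l ∧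
    M.optAvgReward - ε ≤ l} with hgood
  have hsuff : ∀ ω, (1 / (T : ℝ)) * ∑ t ∈ Finset.Icc 1 T, gap (x ω t) ≤ ε / τ → ω ∈ good := by
    intro ω hω
    obtain ⟨l, hl1, hl2⟩ := TeamMDP.exists_hasAvgReward_of_average hmix hτ hbell hT
      (fun t => avgMu (x ω t)) (fun t => avgMu_mem hn (hfeas ω t)) hω
    rw [mul_div_cancel₀ _ (by linarith : τ ≠ 0)] at hl2
    exact ⟨l, hl1, hl2⟩
  have hE0 : 0 ≤ E₀ := by
    rw [hE, ← potential_initState hn]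
    exact potential_nonneg hmu (initState_isFeasible htmix0 hζ hζ0)
  have hT0 : (0 : ℝ) < T := by exact_mod_cast hT
  -- If `E₀ = 0` the step sizes vanish and division by `β` is unavailable. Then `KL(μ*‖ζ) = 0`, so
  -- all agents start at the optimal measure and stay there, and every run is good.
  rcases hE0.eq_or_lt with hE0 | hE0
  · have hβ : β = 0 := by
      rw [hβ₀, ← hE0] at hβ₁ hβ₂
      simp at hβ₁ hβ₂
      exact le_antisymm hβ₂ hβ₁
    have hkl : klDist muStar ζ ≤ 0 := by
      have hn' : (n : ℝ) ≠ 0 := by positivity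
      have h1 : klDist muStar ζ + 1 / (2 * Fintype.card S * tmix ^ 2) *
          ∑ s, ((1 / (n : ℝ)) * ∑ i, (initState n ζ).v i s - vStar s) ^ 2 = 0 := by
        rw [hE0, hE, lyapunov]
        simp [initState, hn']
      have h2 : 0 ≤ 1 / (2 * Fintype.card S * tmix ^ 2) *
          ∑ s, ((1 / (n : ℝ)) * ∑ i, (initState n ζ).v i s - vStar s) ^ 2 := by positivity
      linarith
    have hmuζ := eq_of_klDist_nonpos hmu.1 hζ0 hmu.2.1 hζ.2.1 hkl
    have hall : good = Set.univ := by
      refine Set.eq_univ_of_forall fun ω => hsuff ω ?_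
      have hgap0 : ∀ t, gap (x ω t) ≤ 0 := by
        intro t
        have hn' : (n : ℝ) ≠ 0 := by positivity
        have h1 : avgMu (x ω t) = muStar := by
          funext s a
          have h2 : ∀ i, (x ω t).mu i = ζ := fun i => by
            simp only [hx, hβ]
            exact iterates_mu_eq_of_step_eq_zero hτ1 htmix0 hnet hζ hζ0 _ t i
          simp [avgMu, h2, hmuζ, hn']
        simp only [hgap, h1, hopt.1.sum_mul_advantage]
        linarith
      have h3 : ∑ t ∈ Finset.Icc 1 T, gap (x ω t) ≤ 0 := Finset.sum_nonpos fun t _ => hgap0 t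
      have h4 : 0 ≤ ε / τ := by positivity
      exact (mul_nonpos_of_nonneg_of_nonpos (by positivity) h3).trans h4
    rw [hall]
    simp
    norm_num
  · have hD : 0 < netD n η B := by
      refine lt_of_lt_of_le ?_ (hnet.le_netD hn)
      have := hnet.eta_pos
      have : (0 : ℝ) < B := by exact_mod_cast hnet.B_pos
      positivity
    have hS : (0 : ℝ) < Fintype.card S := by exact_mod_cast Fintype.card_pos
    have hA : (0 : ℝ) < Fintype.card (∀ i, Act i) := by exact_mod_cast Fintype.card_pos
    set R : ℝ := √n * Fintype.card S * Fintype.card (∀ i, Act i) * (1 + 4 * tmix) ^ 2 *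
      netD n η B with hR
    have hR0 : 0 < R := by positivity
    have hβ₀pos : 0 < β₀ := by rw [hβ₀]; positivity
    have hβpos : 0 < β := lt_of_lt_of_le (by positivity) hβ₁
    have hβ₀sq : β₀ ^ 2 * (R * T) = E₀ := by
      rw [hβ₀, Real.sq_sqrt (by positivity)]
      exact div_mul_cancel₀ _ (by positivity)
    have hTbig' : (3 * (1 / c₁ + 18 * c₂)) ^ 2 * (τ ^ 2 * R * E₀ / ε ^ 2) ≤ T := by
      refine le_trans (le_of_eq ?_) hTbig
      rw [hR]; ring
    have hmean := hZ.integral_average_gap_le hτ1 htmix hnet hn hζ hζ0 hβpos hα hopt.1 hmu hl hbell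
      hv hT
    rw [← hE, ← hR] at hmean
    have hbound := three_mul_bound_le hc₁ hc₂ hR0 hε (by linarith : 0 < τ) hT0 hβ₀pos hβ₀sq hβ₁ hβ₂
      hTbig'
    have hint : Integrable (fun ω => (1 / (T : ℝ)) * ∑ t ∈ Finset.Icc 1 T, gap (x ω t)) P :=
      (integrable_finsetSum _ fun t _ => hZ.integrable_comp t gap).const_mul _
    have hnonneg : ∀ ω, 0 ≤ (1 / (T : ℝ)) * ∑ t ∈ Finset.Icc 1 T, gap (x ω t) := fun ω =>
      mul_nonneg (by positivity) (Finset.sum_nonneg fun t _ => Finset.sum_nonneg fun s _ =>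
        Finset.sum_nonneg fun a _ => mul_nonneg ((avgMu_mem hn (hfeas ω t)).1 s a)
          (hbell.advantage_nonneg s a))
    refine (two_thirds_le_measureReal_lt hint hnonneg (by positivity : 0 < ε / τ)
      (le_trans (by linarith) hbound)).trans ?_
    -- Monotonicity of the measure requires no measurability of `good`.
    exact measureReal_mono fun ω hω => hsuff ω (le_of_lt hω)
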